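/- Let $G$ be a finite group and $A\trianglelefteq G$ a normal subgroup. Let $\mathrm{Irr}(A)$ be the set of isomorphism classes of finite-dimensional complex irreducible representations of $A$, with the $G$-action induced by $(g\cdot\rho)(a)=\rho(g^{-1}ag)$, and let $G_{[\tau]}$ denote the isotropy group of $[\tau]\in\mathrm{Irr}(A)$; it contains $A$. Choose a representative $\tau\colon A\to GL(V_\tau)$ in every orbit of $G\backslash\mathrm{Irr}(A)$. All spaces $X$ below are compact Hausdorff $G$-spaces on which $A$ acts trivially. For a $G$-vector bundle $E\to X$ (complex, of finite rank) the group $A$ acts linearly on each fibre. The bundle $V_\tau\otimes\mathrm{Hom}_A(V_\tau,E)$ is a $G_{[\tau]}$-vector bundle with action $h\star(v\otimes f)=M_hv\otimes (h\circ f\circ M_h^{-1})$, where $M_h\in GL(V_\tau)$ is any operator with $\tau(h^{-1}ah)=M_h^{-1}\tau(a)M_h$ for all $a\in A$ (the action does not depend on its choice). A $G_{[\tau]}$-vector bundle $F\to X$ is called $(G_{[\tau]},\tau)$-equivariant if the evaluation map $V_\tau\otimes\mathrm{Hom}_A(V_\tau,F)\to F$, $v\otimes f\mapsto f(v)$, is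 an isomorphism of vector bundles. Let $K^0_G(X)$, respectively $K^0_{G_{[\tau]},\tau}(X)$, be the Grothendieck group of the monoid of isomorphism classes of $G$-vector bundles, respectively of $(G_{[\tau]},\tau)$-equivariant vector bundles, over $X$ under direct sum. For $n>0$ let $K^n_G(X)$ and $K^n_{G_{[\tau]},\tau}(X)$ be the corresponding reduced groups of $\Sigma^nX_+$, that is, the kernels of restriction of $K^0(\Sigma^nX_+)$ to the base point. Then: 1. For every $X$ and every $n\ge 0$ the assignment $E\mapsto\bigoplus_{[\tau]}V_\tau\otimes\mathrm{Hom}_A(V_\tau,E)$ induces an isomorphism of abelian groups $$\Psi_X\colon K^n_G(X)\;\xrightarrow{\ \cong\ }\bigoplus_{[\tau]\in G\backslash\mathrm{Irr}(A)}K^n_{G_{[\tau]},\tau}(X),$$ and $\Psi$ is natural with respect to continuous $G$-equivariant maps between such spaces. 2. For every $G$-vector bundle $E\to X$, evaluation gives an isomorphism $\bigoplus_{[\sigma]\in\mathrm{Irr}(A)}V_\sigma\otimes\mathrm{Hom}_A(V_\sigma,E)\to E$ on every fibre. For each $G$-orbit $O\subseteq\mathrm{Irr}(A)$ the sum $E_O\subseteq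 E$ of the images of the pieces with $[\sigma]\in O$ is a $G$-invariant subbundle, and $E=\bigoplus_OE_O$ as $G$-vector bundles. 3. The inverse of $\Psi_X$ is given on the summand of $[\tau]$ by the map that induction from $G_{[\tau]}$ to $G$ induces on $K^n$: it sends $F$ to $\bigoplus_j(g_j^{-1})^*F$, where $g_1,\dots,g_r$ are representatives of the cosets in $G/G_{[\tau]}$; an element $g\in G$ maps the $j$-th summand to the $l$-th, by the action of $h$ on $F$, where $gg_j=g_lh$ with $h\in G_{[\tau]}$. -/

import Mathlib

universe u u' v w

namespace EqK

open TensorProduct Topology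

/-- The disjoint union of a family of fibres, without a preferred topology. -/
structure Tot {X : Type u} (F : X → Type v) : Type (max u v) where
  base : X
  vec : F base

/-- `F` is trivial over `U` with fibre `W`: linear maps `φ x : F x → W` and `ψ x : W → F x`,
mutually inverse for `x ∈ U`, such that `(x, v) ↦ φ x v` is continuous on the part of the total
space over `U` and `(x, w) ↦ (x, ψ x w)` is continuous on `U × W`. -/
def IsTrivialOn {X : Type u} [TopologicalSpace X] (F : X → Type v)
    [∀ x, AddCommGroup (F x)] [∀ x, Module ℂ (F x)] [TopologicalSpace (Tot F)] (U : Set X)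
    (W : Type w) [AddCommGroup W] [Module ℂ W] [TopologicalSpace W] : Prop :=
  ∃ (φ : ∀ x, F x →ₗ[ℂ] W) (ψ : ∀ x, W →ₗ[ℂ] F x),
    (∀ x ∈ U, ∀ v, ψ x (φ x v) = v) ∧ (∀ x ∈ U, ∀ w, φ x (ψ x w) = w) ∧
    ContinuousOn (fun p : Tot F => φ p.base p.vec) (Tot.base ⁻¹' U) ∧
    ContinuousOn (fun q : X × W => (⟨q.1, ψ q.1 q.2⟩ : Tot F)) (U ×ˢ Set.univ)

/-- A complex vector bundle of finite rank (the rank is locally constant) over a space `X`. -/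
structure VB (X : Type u) [TopologicalSpace X] : Type (max u (v + 1)) where
  fiber : X → Type v
  [acg : ∀ x, AddCommGroup (fiber x)]
  [mod : ∀ x, Module ℂ (fiber x)]
  [top : TopologicalSpace (Tot fiber)]
  continuous_base : Continuous (Tot.base : Tot fiber → X)
  locTriv : ∀ x : X, ∃ U : Set X, IsOpen U ∧ x ∈ U ∧ ∃ n : ℕ, IsTrivialOn fiber U (Fin n → ℂ)

attribute [instance] VB.acg VB.mod VB.top

theorem IsTrivialOn.change {X : Type u} [TopologicalSpace X] {F : X → Type v}
    [∀ x, AddCommGroup (F x)] [∀ x, Module ℂ (F x)] [TopologicalSpace (Tot F)] {U : Set X}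
    {W : Type w} [NormedAddCommGroup W] [NormedSpace ℂ W] [FiniteDimensional ℂ W]
    (h : IsTrivialOn F U W) : ∃ n : ℕ, IsTrivialOn F U (Fin n → ℂ) := by
  obtain ⟨φ, ψ, h1, h2, h3, h4⟩ := h
  let e : W ≃ₗ[ℂ] (Fin (Module.finrank ℂ W) → ℂ) := (Module.finBasis ℂ W).equivFun
  have ce : Continuous e := LinearMap.continuous_of_finiteDimensional e.toLinearMap
  have ce' : Continuous e.symm := LinearMap.continuous_of_finiteDimensional e.symm.toLinearMap
  refine ⟨_, fun x => e.toLinearMap ∘ₗ φ x, fun x => ψ x ∘ₗ e.symm.toLinearMap, ?_, ?_, ?_, ?_⟩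
  · intro x hx v; simp [h1 x hx]
  · intro x hx v; simp [h2 x hx]
  · exact ce.comp_continuousOn h3
  · exact h4.comp (f := fun q : X × _ => (q.1, e.symm q.2))
      (continuous_fst.prodMk (ce'.comp continuous_snd)).continuousOn (fun q hq => ⟨hq.1, trivial⟩)

namespace Tot

variable {X : Type u} {F : X → Type v}

theorem mk_inj {x : X} {v v' : F x} (h : (⟨x, v⟩ : Tot F) = ⟨x, v'⟩) : v = v' := by
  cases h; rfl

end Tot

namespace VB

variable {X : Type u} {Y : Type u'} [TopologicalSpace X] [TopologicalSpace Y]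

/-- Transport of fibres along an equality of base points. -/
def cast (E : VB.{u, v} X) {x y : X} (h : x = y) : E.fiber x ≃ₗ[ℂ] E.fiber y :=
  h ▸ LinearEquiv.refl ℂ (E.fiber x)

@[simp] theorem cast_rfl (E : VB.{u, v} X) {x : X} (h : x = x) (v : E.fiber x) : E.cast h v = v := rfl

theorem mk_cast (E : VB.{u, v} X) {x y : X} (h : x = y) (v : E.fiber x) :
    (⟨y, E.cast h v⟩ : Tot E.fiber) = ⟨x, v⟩ := by subst h; rfl

theorem mk_cast_symm (E : VB.{u, v} X) {x y : X} (h : x = y) (v : E.fiber y) :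
    (⟨x, (E.cast h).symm v⟩ : Tot E.fiber) = ⟨y, v⟩ := by subst h; rfl

/-- The pullback `f^* E`, a subspace of `Y × E`. -/
def pullback (E : VB.{u, v} X) (f : Y → X) (hf : Continuous f) : VB.{u', v} Y :=
  letI top : TopologicalSpace (Tot fun y => E.fiber (f y)) :=
    TopologicalSpace.induced
      (fun p => ((p.base, ⟨f p.base, p.vec⟩) : Y × Tot E.fiber)) inferInstance
  have hj : IsInducing fun p : Tot fun y => E.fiber (f y) =>
      ((p.base, ⟨f p.base, p.vec⟩) : Y × Tot E.fiber) := ⟨rfl⟩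
  { fiber := fun y => E.fiber (f y)
    top := top
    continuous_base := continuous_fst.comp hj.continuous
    locTriv := by
      intro y
      obtain ⟨U, hU, hy, n, φ, ψ, h1, h2, h3, h4⟩ := E.locTriv (f y)
      refine ⟨f ⁻¹' U, hU.preimage hf, hy, n, fun y => φ (f y), fun y => ψ (f y),
        fun y hy => h1 _ hy, fun y hy => h2 _ hy, ?_, ?_⟩
      · exact h3.comp (continuous_snd.comp hj.continuous).continuousOn (fun p hp => hp)
      · rw [hj.continuousOn_iff]
        refine continuous_fst.continuousOn.prodMk ?_
        exact h4.comp (f := fun q : Y × (Fin n → ℂ) => (f q.1, q.2))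
          ((hf.comp continuous_fst).prodMk continuous_snd).continuousOn
          (fun q hq => ⟨hq.1, trivial⟩) }

/-- The direct sum `E ⊕ F`, a subspace of `E × F`. -/
def prod (E F : VB.{u, v} X) : VB.{u, v} X :=
  letI top : TopologicalSpace (Tot fun x => E.fiber x × F.fiber x) :=
    TopologicalSpace.induced
      (fun p => ((⟨p.base, p.vec.1⟩, ⟨p.base, p.vec.2⟩) : Tot E.fiber × Tot F.fiber)) inferInstance
  have hj : IsInducing fun p : Tot fun x => E.fiber x × F.fiber x =>
      ((⟨p.base, p.vec.1⟩, ⟨p.base, p.vec.2⟩) : Tot E.fiber × Tot F.fiber) := ⟨rfl⟩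
  { fiber := fun x => E.fiber x × F.fiber x
    top := top
    continuous_base :=
      E.continuous_base.comp (continuous_fst.comp hj.continuous)
    locTriv := by
      intro x
      obtain ⟨U, hU, hx, n, φ, ψ, h1, h2, h3, h4⟩ := E.locTriv x
      obtain ⟨U', hU', hx', n', φ', ψ', h1', h2', h3', h4'⟩ := F.locTriv x
      refine ⟨U ∩ U', hU.inter hU', ⟨hx, hx'⟩,
        IsTrivialOn.change (W := (Fin n → ℂ) × (Fin n' → ℂ))
        ⟨fun x => (φ x).prodMap (φ' x), fun x => (ψ x).prodMap (ψ' x), ?_, ?_, ?_, ?_⟩⟩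
      · intro x hx v; simp [h1 x hx.1, h1' x hx.2]
      · intro x hx v; simp [h2 x hx.1, h2' x hx.2]
      · exact (h3.comp (continuous_fst.comp hj.continuous).continuousOn
            (fun p hp => hp.1)).prodMk
          (h3'.comp (continuous_snd.comp hj.continuous).continuousOn (fun p hp => hp.2))
      · rw [hj.continuousOn_iff]
        refine (h4.comp (f := fun q : X × ((Fin n → ℂ) × (Fin n' → ℂ)) => (q.1, q.2.1))
          (by fun_prop) (fun q hq => ⟨hq.1.1, trivial⟩)).prodMk
          (h4'.comp (f := fun q : X × ((Fin n → ℂ) × (Fin n' → ℂ)) => (q.1, q.2.2))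
          (by fun_prop) (fun q hq => ⟨hq.1.2, trivial⟩)) }

/-- The direct sum of a finite family of bundles, a subspace of `X × ∏ᵢ Eᵢ`. -/
def pi {ι : Type v} [Finite ι] (E : ι → VB.{u, v} X) : VB.{u, v} X :=
  letI top : TopologicalSpace (Tot fun x => ∀ k, (E k).fiber x) :=
    TopologicalSpace.induced
      (fun p => ((p.base, fun k => ⟨p.base, p.vec k⟩) : X × ∀ k, Tot (E k).fiber)) inferInstance
  have hj : IsInducing fun p : Tot fun x => ∀ k, (E k).fiber x =>
      ((p.base, fun k => ⟨p.base, p.vec k⟩) : X × ∀ k, Tot (E k).fiber) := ⟨rfl⟩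
  { fiber := fun x => ∀ k, (E k).fiber x
    top := top
    continuous_base := continuous_fst.comp hj.continuous
    locTriv := by
      have := Fintype.ofFinite ι
      intro x
      choose U hU hx n φ ψ h1 h2 h3 h4 using fun k => (E k).locTriv x
      refine ⟨⋂ k, U k, isOpen_iInter_of_finite hU, Set.mem_iInter.2 hx,
        IsTrivialOn.change (W := ∀ k, Fin (n k) → ℂ)
        ⟨fun x => LinearMap.pi fun k => φ k x ∘ₗ LinearMap.proj k,
         fun x => LinearMap.pi fun k => ψ k x ∘ₗ LinearMap.proj k, ?_, ?_, ?_, ?_⟩⟩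
      · intro x hx v; funext k; exact h1 k x (Set.mem_iInter.1 hx k) _
      · intro x hx v; funext k; exact h2 k x (Set.mem_iInter.1 hx k) _
      · refine continuousOn_pi.2 fun k => ?_
        exact (h3 k).comp (((continuous_apply k).comp continuous_snd).comp
          hj.continuous).continuousOn (fun p hp => Set.mem_iInter.1 hp k)
      · rw [hj.continuousOn_iff]
        refine continuous_fst.continuousOn.prodMk (continuousOn_pi.2 fun k => ?_)
        exact (h4 k).comp (f := fun q : X × (∀ k, Fin (n k) → ℂ) => (q.1, q.2 k))
          (by fun_prop) (fun q hq => ⟨Set.mem_iInter.1 hq.1 k, trivial⟩) }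

/-- The zero bundle. -/
def zero (X : Type u) [TopologicalSpace X] : VB.{u, v} X :=
  letI top : TopologicalSpace (Tot fun _ : X => PUnit.{v + 1}) :=
    TopologicalSpace.induced Tot.base inferInstance
  { fiber := fun _ => PUnit.{v + 1}
    top := top
    continuous_base := continuous_induced_dom
    locTriv := by
      intro x
      refine ⟨Set.univ, isOpen_univ, trivial, 0, 0, 0, ?_, ?_, ?_, ?_⟩
      · intro x hx v; rfl
      · intro x hx v; exact Subsingleton.elim _ _
      · exact continuousOn_const
      · exact (Continuous.continuousOn (continuous_induced_rng.2 continuous_fst)) }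

/-- Let `K x ⊆ E x` be a family of subspaces, split by retractions whose associated projector of
`E` is continuous. Then `K`, with the topology induced from `E`, is a vector bundle. -/
def ofSplit (E : VB.{u, v} X) (K : X → Type v) [∀ x, AddCommGroup (K x)] [∀ x, Module ℂ (K x)]
    (i : ∀ x, K x →ₗ[ℂ] E.fiber x) (r : ∀ x, E.fiber x →ₗ[ℂ] K x) (hri : ∀ x k, r x (i x k) = k)
    (hc : Continuous fun p : Tot E.fiber => (⟨p.base, i p.base (r p.base p.vec)⟩ : Tot E.fiber)) :
    VB.{u, v} X :=
  letI top : TopologicalSpace (Tot K) :=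
    TopologicalSpace.induced (fun p => (⟨p.base, i p.base p.vec⟩ : Tot E.fiber)) inferInstance
  have hj : IsInducing fun p : Tot K => (⟨p.base, i p.base p.vec⟩ : Tot E.fiber) := ⟨rfl⟩
  { fiber := K
    top := top
    continuous_base := E.continuous_base.comp hj.continuous
    locTriv := by
      intro x₀
      obtain ⟨U, hU, hx₀, n, φ, ψ, h1, h2, h3, h4⟩ := E.locTriv x₀
      let W := Fin n → ℂ
      let P : X → (W →L[ℂ] W) := fun x =>
        LinearMap.toContinuousLinearMap (φ x ∘ₗ i x ∘ₗ r x ∘ₗ ψ x)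
      have hP : ∀ x w, P x w = φ x (i x (r x (ψ x w))) := fun x w => rfl
      have hPP : ∀ x ∈ U, ∀ w, P x (P x w) = P x w := by
        intro x hx w; simp only [hP, h1 x hx, hri]
      have hpc : ContinuousOn (fun q : X × W => P q.1 q.2) (U ×ˢ Set.univ) :=
        h3.comp (hc.comp_continuousOn h4) (fun q hq => hq.1)
      have hPc : ContinuousOn P U := by
        rw [continuousOn_clm_apply]
        intro w
        exact hpc.comp (f := fun x : X => (x, w)) (by fun_prop) (fun x hx => ⟨hx, trivial⟩)
      let T : X → (W →L[ℂ] W) := fun x => P x * P x₀ + (1 - P x) * (1 - P x₀)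
      have hT : ContinuousOn T U := by
        have := hPc.mul (continuousOn_const (c := P x₀))
        exact this.add ((continuousOn_const.sub hPc).mul continuousOn_const)
      have hPP' : ∀ x ∈ U, P x * P x = P x := fun x hx => by
        ext1 w; exact hPP x hx w
      have hT0 : T x₀ = 1 := by
        have := hPP' x₀ hx₀
        simp only [T, mul_sub, sub_mul, mul_one, one_mul, this]
        abel
      let S : X → (W →L[ℂ] W) := fun x => Ring.inverse (T x)
      let V : Set X := U ∩ T ⁻¹' {t | IsUnit t}
      have hV : IsOpen V := hT.isOpen_inter_preimage hU Units.isOpen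
      have hSc : ContinuousOn S V := by
        intro x hx
        obtain ⟨t, ht⟩ := hx.2
        have hinv : ContinuousAt Ring.inverse (T x) := by
          rw [← ht]; exact NormedRing.inverse_continuousAt t
        exact hinv.comp_continuousWithinAt ((hT x hx.1).mono Set.inter_subset_left)
      have hTS : ∀ x ∈ V, ∀ w, T x (S x w) = w := fun x hx w => by
        have := Ring.mul_inverse_cancel _ hx.2
        exact congrArg (fun L : W →L[ℂ] W => L w) this
      have hST : ∀ x ∈ V, ∀ w, S x (T x w) = w := fun x hx w => by
        have := Ring.inverse_mul_cancel _ hx.2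
        exact congrArg (fun L : W →L[ℂ] W => L w) this
      have hcomm : ∀ x ∈ U, T x * P x₀ = P x * T x := fun x hx => by
        have e0 := hPP' x₀ hx₀
        have e1 := hPP' x hx
        simp only [T, mul_sub, sub_mul, mul_one, one_mul, mul_add, add_mul]
        simp only [mul_assoc, e0]
        simp only [← mul_assoc, e1]
        abel
      have hcomm' : ∀ x ∈ U, ∀ w, T x (P x₀ w) = P x (T x w) := fun x hx w =>
        congrArg (fun L : W →L[ℂ] W => L w) (hcomm x hx)
      let W₀ := LinearMap.range (P x₀).toLinearMap
      let R : W →ₗ[ℂ] W₀ := (P x₀).toLinearMap.rangeRestrict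
      have hRc : Continuous R := LinearMap.continuous_of_finiteDimensional R
      have hR : ∀ w : W, ((R w : W₀) : W) = P x₀ w := fun w => rfl
      refine ⟨V, hV, ⟨hx₀, by simp [hT0]⟩, IsTrivialOn.change (W := W₀)
        ⟨fun x => R ∘ₗ (S x).toLinearMap ∘ₗ φ x ∘ₗ i x,
          fun x => r x ∘ₗ ψ x ∘ₗ (T x).toLinearMap ∘ₗ W₀.subtype, ?_, ?_, ?_, ?_⟩⟩
      · intro x hx k
        change r x (ψ x (T x (P x₀ (S x (φ x (i x k)))))) = k
        rw [hcomm' x hx.1, hTS x hx, hP, h1 x hx.1, h1 x hx.1, hri, hri]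
      · rintro x hx ⟨w, z, hz⟩
        apply Subtype.ext
        change P x₀ (S x (P x (T x w))) = w
        rw [← hcomm' x hx.1, hST x hx, hPP x₀ hx₀, ← hz]
        exact hPP x₀ hx₀ z
      · refine hRc.comp_continuousOn ?_
        have hb : Continuous (Tot.base : Tot K → X) :=
          E.continuous_base.comp hj.continuous
        have a1 : ContinuousOn (fun p : Tot K => S p.base) (Tot.base ⁻¹' V) :=
          hSc.comp hb.continuousOn (fun p hp => hp)
        have a2 : ContinuousOn (fun p : Tot K => φ p.base (i p.base p.vec)) (Tot.base ⁻¹' V) :=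
          h3.comp (f := fun p : Tot K => (⟨p.base, i p.base p.vec⟩ : Tot E.fiber))
            hj.continuous.continuousOn (fun p hp => hp.1)
        exact a1.clm_apply a2
      · rw [hj.continuousOn_iff]
        refine hc.comp_continuousOn (f := fun q : X × W₀ =>
          (⟨q.1, ψ q.1 (T q.1 q.2)⟩ : Tot E.fiber)) ?_
        refine h4.comp (f := fun q : X × W₀ => (q.1, T q.1 q.2)) ?_ (fun q hq => ⟨hq.1.1, trivial⟩)
        refine continuous_fst.continuousOn.prodMk ?_
        exact ((hT.mono Set.inter_subset_left).comp continuous_fst.continuousOn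
          (fun q hq => hq.1)).clm_apply (continuous_subtype_val.comp continuous_snd).continuousOn }

end VB

namespace VB

variable {X : Type u} {Y : Type u'} [TopologicalSpace X] [TopologicalSpace Y]

theorem pullback_isInducing (E : VB.{u, v} X) (f : Y → X) (hf : Continuous f) :
    IsInducing fun p : Tot (E.pullback f hf).fiber =>
      ((p.base, ⟨f p.base, p.vec⟩) : Y × Tot E.fiber) := ⟨rfl⟩

theorem prod_isInducing (E F : VB.{u, v} X) :
    IsInducing fun p : Tot (E.prod F).fiber =>
      ((⟨p.base, p.vec.1⟩, ⟨p.base, p.vec.2⟩) : Tot E.fiber × Tot F.fiber) := ⟨rfl⟩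

theorem pi_isInducing {ι : Type v} [Finite ι] (E : ι → VB.{u, v} X) :
    IsInducing fun p : Tot (VB.pi E).fiber =>
      ((p.base, fun k => ⟨p.base, p.vec k⟩) : X × ∀ k, Tot (E k).fiber) := ⟨rfl⟩

theorem pullback_ext {E : VB.{u, v} X} {f : Y → X} {hf : Continuous f}
    {p q : Tot (E.pullback f hf).fiber} (h : p.base = q.base)
    (h' : (⟨f p.base, p.vec⟩ : Tot E.fiber) = ⟨f q.base, q.vec⟩) : p = q := by
  obtain ⟨x, v⟩ := p; obtain ⟨y, w⟩ := q
  obtain rfl : x = y := h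
  have := Tot.mk_inj h'
  exact congrArg _ this

theorem prod_ext {E F : VB.{u, v} X} {p q : Tot (E.prod F).fiber}
    (h : (⟨p.base, p.vec.1⟩ : Tot E.fiber) = ⟨q.base, q.vec.1⟩)
    (h' : (⟨p.base, p.vec.2⟩ : Tot F.fiber) = ⟨q.base, q.vec.2⟩) : p = q := by
  obtain ⟨x, v⟩ := p; obtain ⟨y, w⟩ := q
  obtain rfl : x = y := congrArg Tot.base h
  have h1 := Tot.mk_inj h
  have h2 := Tot.mk_inj h'
  exact congrArg _ (Prod.ext h1 h2)

theorem pi_ext {ι : Type v} [Finite ι] {E : ι → VB.{u, v} X} {p q : Tot (VB.pi E).fiber}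
    (hb : p.base = q.base)
    (h : ∀ k, (⟨p.base, p.vec k⟩ : Tot (E k).fiber) = ⟨q.base, q.vec k⟩) : p = q := by
  obtain ⟨x, v⟩ := p; obtain ⟨y, w⟩ := q
  obtain rfl : x = y := hb
  exact congrArg _ (funext fun k => Tot.mk_inj (h k))

/-- Addition of two continuous maps into `E` over the same map into the base is continuous. -/
theorem continuous_add (E : VB.{u, v} X) {Z : Type w} [TopologicalSpace Z] {b : Z → X}
    {s t : ∀ z, E.fiber (b z)} (hs : Continuous fun z => (⟨b z, s z⟩ : Tot E.fiber))
    (ht : Continuous fun z => (⟨b z, t z⟩ : Tot E.fiber)) :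
    Continuous fun z => (⟨b z, s z + t z⟩ : Tot E.fiber) := by
  have hb : Continuous b := E.continuous_base.comp hs
  rw [continuous_iff_continuousAt]
  intro z
  obtain ⟨U, hU, hz, n, φ, ψ, h1, h2, h3, h4⟩ := E.locTriv (b z)
  have hV : IsOpen (b ⁻¹' U) := hU.preimage hb
  have c1 : ContinuousOn (fun z => φ (b z) (s z)) (b ⁻¹' U) :=
    h3.comp hs.continuousOn (fun z hz => hz)
  have c2 : ContinuousOn (fun z => φ (b z) (t z)) (b ⁻¹' U) :=
    h3.comp ht.continuousOn (fun z hz => hz)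
  have c3 : ContinuousOn (fun z => (⟨b z, ψ (b z) (φ (b z) (s z) + φ (b z) (t z))⟩ : Tot E.fiber))
      (b ⁻¹' U) :=
    h4.comp (f := fun z => (b z, φ (b z) (s z) + φ (b z) (t z)))
      (hb.continuousOn.prodMk (c1.add c2)) (fun z hz => ⟨hz, trivial⟩)
  have c4 := c3.continuousAt (hV.mem_nhds hz)
  refine c4.congr ?_
  filter_upwards [hV.mem_nhds hz] with z hz
  rw [← map_add, h1 _ hz]

theorem continuous_smul (E : VB.{u, v} X) {Z : Type w} [TopologicalSpace Z] {b : Z → X}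
    {s : ∀ z, E.fiber (b z)} (hs : Continuous fun z => (⟨b z, s z⟩ : Tot E.fiber)) (c : ℂ) :
    Continuous fun z => (⟨b z, c • s z⟩ : Tot E.fiber) := by
  have hb : Continuous b := E.continuous_base.comp hs
  rw [continuous_iff_continuousAt]
  intro z
  obtain ⟨U, hU, hz, n, φ, ψ, h1, h2, h3, h4⟩ := E.locTriv (b z)
  have hV : IsOpen (b ⁻¹' U) := hU.preimage hb
  have c1 : ContinuousOn (fun z => φ (b z) (s z)) (b ⁻¹' U) :=
    h3.comp hs.continuousOn (fun z hz => hz)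
  have c3 : ContinuousOn (fun z => (⟨b z, ψ (b z) (c • φ (b z) (s z))⟩ : Tot E.fiber))
      (b ⁻¹' U) :=
    h4.comp (f := fun z => (b z, c • φ (b z) (s z)))
      (hb.continuousOn.prodMk (c1.const_smul c)) (fun z hz => ⟨hz, trivial⟩)
  have c4 := c3.continuousAt (hV.mem_nhds hz)
  refine c4.congr ?_
  filter_upwards [hV.mem_nhds hz] with z hz
  rw [← map_smul, h1 _ hz]

theorem continuous_zero (E : VB.{u, v} X) {Z : Type w} [TopologicalSpace Z] {b : Z → X}
    (hb : Continuous b) : Continuous fun z => (⟨b z, 0⟩ : Tot E.fiber) := by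
  rw [continuous_iff_continuousAt]
  intro z
  obtain ⟨U, hU, hz, n, φ, ψ, h1, h2, h3, h4⟩ := E.locTriv (b z)
  have hV : IsOpen (b ⁻¹' U) := hU.preimage hb
  have c3 : ContinuousOn (fun z => (⟨b z, ψ (b z) 0⟩ : Tot E.fiber)) (b ⁻¹' U) :=
    h4.comp (f := fun z => (b z, 0)) (hb.continuousOn.prodMk continuousOn_const)
      (fun z hz => ⟨hz, trivial⟩)
  simpa using c3.continuousAt (hV.mem_nhds hz)

theorem continuous_sum (E : VB.{u, v} X) {Z : Type w} [TopologicalSpace Z] {b : Z → X}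
    (hb : Continuous b) {κ : Type*} (S : Finset κ) {s : κ → ∀ z, E.fiber (b z)}
    (hs : ∀ k ∈ S, Continuous fun z => (⟨b z, s k z⟩ : Tot E.fiber)) :
    Continuous fun z => (⟨b z, ∑ k ∈ S, s k z⟩ : Tot E.fiber) := by
  classical
  induction S using Finset.induction_on with
  | empty => simpa using E.continuous_zero hb
  | insert a S ha ih =>
    simp only [Finset.sum_insert ha]
    exact E.continuous_add (hs a (Finset.mem_insert_self a S))
      (ih fun k hk => hs k (Finset.mem_insert_of_mem hk))

end VB

/-- A continuous equivariant map of `G`-spaces. -/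
structure GMap (G : Type w) [Group G] (Y : Type u') (X : Type u) [TopologicalSpace Y]
    [TopologicalSpace X] [MulAction G Y] [MulAction G X] where
  toFun : Y → X
  continuous_toFun : Continuous toFun
  map_smul : ∀ (g : G) (y : Y), toFun (g • y) = g • toFun y

/-- A `G`-equivariant complex vector bundle over the `G`-space `X`, for a discrete group `G`:
the elements of `G` act on the total space by homeomorphisms covering the action on `X`,
linearly on the fibres. -/
structure GVect (G : Type w) [Group G] (X : Type u) [TopologicalSpace X] [MulAction G X]
    extends VB.{u, v} X where
  act : ∀ (g : G) (x : X), fiber x →ₗ[ℂ] fiber (g • x)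
  act_one : ∀ (x : X) (v : fiber x), (⟨(1 : G) • x, act 1 x v⟩ : Tot fiber) = ⟨x, v⟩
  act_mul : ∀ (g h : G) (x : X) (v : fiber x), (⟨(g * h) • x, act (g * h) x v⟩ : Tot fiber) =
    ⟨g • h • x, act g (h • x) (act h x v)⟩
  continuous_act : ∀ g : G,
    Continuous fun p : Tot fiber => (⟨g • p.base, act g p.base p.vec⟩ : Tot fiber)

namespace GVect

variable {G : Type w} [Group G] {X : Type u} {Y : Type u'} [TopologicalSpace X]
  [TopologicalSpace Y] [MulAction G X] [MulAction G Y]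

/-- The action on the total space. -/
def tact (E : GVect.{u, v} G X) (g : G) (p : Tot E.fiber) : Tot E.fiber :=
  ⟨g • p.base, E.act g p.base p.vec⟩

theorem tact_mk (E : GVect.{u, v} G X) (g : G) (x : X) (v : E.fiber x) :
    E.tact g ⟨x, v⟩ = ⟨g • x, E.act g x v⟩ := rfl

theorem tact_one (E : GVect.{u, v} G X) (p : Tot E.fiber) : E.tact 1 p = p := E.act_one _ _

theorem tact_mul (E : GVect.{u, v} G X) (g h : G) (p : Tot E.fiber) :
    E.tact (g * h) p = E.tact g (E.tact h p) := E.act_mul _ _ _ _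

theorem continuous_tact (E : GVect.{u, v} G X) (g : G) : Continuous (E.tact g) :=
  E.continuous_act g

/-- Homomorphisms of `G`-vector bundles over the identity of the base. -/
structure Hom (E F : GVect.{u, v} G X) where
  toFun : ∀ x, E.fiber x →ₗ[ℂ] F.fiber x
  continuous_toFun :
    Continuous fun p : Tot E.fiber => (⟨p.base, toFun p.base p.vec⟩ : Tot F.fiber)
  map_act : ∀ g x v, toFun (g • x) (E.act g x v) = F.act g x (toFun x v)

/-- Isomorphisms of `G`-vector bundles over the identity of the base. -/
structure Iso (E F : GVect.{u, v} G X) where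
  toEquiv : ∀ x, E.fiber x ≃ₗ[ℂ] F.fiber x
  continuous_toFun :
    Continuous fun p : Tot E.fiber => (⟨p.base, toEquiv p.base p.vec⟩ : Tot F.fiber)
  continuous_invFun :
    Continuous fun p : Tot F.fiber => (⟨p.base, (toEquiv p.base).symm p.vec⟩ : Tot E.fiber)
  map_act : ∀ g x v, toEquiv (g • x) (E.act g x v) = F.act g x (toEquiv x v)

namespace Iso

variable {E F D : GVect.{u, v} G X}

def refl (E : GVect.{u, v} G X) : Iso E E :=
  ⟨fun _ => LinearEquiv.refl ℂ _, continuous_id, continuous_id, fun _ _ _ => rfl⟩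

def symm (e : Iso E F) : Iso F E :=
  ⟨fun x => (e.toEquiv x).symm, e.continuous_invFun, e.continuous_toFun, fun g x v => by
    rw [LinearEquiv.symm_apply_eq, e.map_act, LinearEquiv.apply_symm_apply]⟩

def trans (e : Iso E F) (f : Iso F D) : Iso E D :=
  ⟨fun x => (e.toEquiv x).trans (f.toEquiv x), f.continuous_toFun.comp e.continuous_toFun,
    e.continuous_invFun.comp f.continuous_invFun, fun g x v => by
    simp only [LinearEquiv.trans_apply, e.map_act, f.map_act]⟩

theorem apply_cast (e : Iso E F) {x y : X} (h : x = y) (v : E.fiber x) :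
    e.toEquiv y (E.cast h v) = F.cast h (e.toEquiv x v) := by subst h; rfl

end Iso

/-- The zero bundle. -/
def zero (G : Type w) [Group G] (X : Type u) [TopologicalSpace X] [MulAction G X]
    [ContinuousConstSMul G X] : GVect.{u, v} G X where
  toVB := VB.zero X
  act _ _ := LinearMap.id
  act_one x v := by
    change (⟨_, _⟩ : Tot fun _ : X => PUnit.{v + 1}) = ⟨_, _⟩
    rw [one_smul]; rfl
  act_mul g h x v := by
    change (⟨_, _⟩ : Tot fun _ : X => PUnit.{v + 1}) = ⟨_, _⟩
    rw [mul_smul]; rfl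
  continuous_act g := continuous_induced_rng.2
    ((continuous_const_smul g).comp (VB.zero X).continuous_base)

/-- The direct sum of two `G`-vector bundles. -/
def sum (E F : GVect.{u, v} G X) : GVect.{u, v} G X where
  toVB := E.toVB.prod F.toVB
  act g x := (E.act g x).prodMap (F.act g x)
  act_one x v := VB.prod_ext (E.act_one x v.1) (F.act_one x v.2)
  act_mul g h x v := VB.prod_ext (E.act_mul g h x v.1) (F.act_mul g h x v.2)
  continuous_act g := by
    have hj := VB.prod_isInducing E.toVB F.toVB
    refine hj.continuous_iff.2 ?_
    exact ((E.continuous_act g).comp (continuous_fst.comp hj.continuous)).prodMk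
      ((F.continuous_act g).comp (continuous_snd.comp hj.continuous))

/-- The pullback of a `G`-vector bundle along a `G`-map. -/
def pullback (E : GVect.{u, v} G X) (f : GMap G Y X) [ContinuousConstSMul G Y] :
    GVect.{u', v} G Y where
  toVB := E.toVB.pullback f.toFun f.continuous_toFun
  act g y := (E.cast (f.map_smul g y).symm).toLinearMap ∘ₗ E.act g (f.toFun y)
  act_one y v := VB.pullback_ext (one_smul G y) ((E.mk_cast _ _).trans (E.act_one _ v))
  act_mul g h y v := by
    refine VB.pullback_ext (mul_smul g h y) ?_
    refine (E.mk_cast _ _).trans ((E.act_mul g h _ v).trans ?_)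
    refine Eq.trans ?_ (E.mk_cast _ _).symm
    change E.tact g ⟨_, _⟩ = E.tact g ⟨_, _⟩
    exact congrArg _ (E.mk_cast _ _).symm
  continuous_act g := by
    have hj := VB.pullback_isInducing E.toVB f.toFun f.continuous_toFun
    refine hj.continuous_iff.2 ?_
    refine ((continuous_const_smul g).comp (continuous_fst.comp hj.continuous)).prodMk ?_
    refine ((E.continuous_act g).comp (continuous_snd.comp hj.continuous)).congr fun p => ?_
    exact (E.mk_cast _ _).symm

instance setoid (G : Type w) [Group G] (X : Type u) [TopologicalSpace X] [MulAction G X] :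
    Setoid (GVect.{u, v} G X) where
  r E F := Nonempty (Iso E F)
  iseqv := ⟨fun E => ⟨Iso.refl E⟩, fun ⟨e⟩ => ⟨e.symm⟩, fun ⟨e⟩ ⟨f⟩ => ⟨e.trans f⟩⟩

def sumCongr {E E' F F' : GVect.{u, v} G X} (e : Iso E E') (f : Iso F F') :
    Iso (E.sum F) (E'.sum F') where
  toEquiv x := (e.toEquiv x).prodCongr (f.toEquiv x)
  continuous_toFun := by
    have hj := VB.prod_isInducing E.toVB F.toVB
    refine (VB.prod_isInducing E'.toVB F'.toVB).continuous_iff.2 ?_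
    exact (e.continuous_toFun.comp (continuous_fst.comp hj.continuous)).prodMk
      (f.continuous_toFun.comp (continuous_snd.comp hj.continuous))
  continuous_invFun := by
    have hj := VB.prod_isInducing E'.toVB F'.toVB
    refine (VB.prod_isInducing E.toVB F.toVB).continuous_iff.2 ?_
    exact (e.continuous_invFun.comp (continuous_fst.comp hj.continuous)).prodMk
      (f.continuous_invFun.comp (continuous_snd.comp hj.continuous))
  map_act g x v := Prod.ext (e.map_act g x v.1) (f.map_act g x v.2)

def sumComm (E F : GVect.{u, v} G X) : Iso (E.sum F) (F.sum E) where
  toEquiv x := LinearEquiv.prodComm ℂ (E.fiber x) (F.fiber x)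
  continuous_toFun := by
    have hj := VB.prod_isInducing E.toVB F.toVB
    refine (VB.prod_isInducing F.toVB E.toVB).continuous_iff.2 ?_
    exact (continuous_snd.comp hj.continuous).prodMk (continuous_fst.comp hj.continuous)
  continuous_invFun := by
    have hj := VB.prod_isInducing F.toVB E.toVB
    refine (VB.prod_isInducing E.toVB F.toVB).continuous_iff.2 ?_
    exact (continuous_snd.comp hj.continuous).prodMk (continuous_fst.comp hj.continuous)
  map_act g x v := rfl

def sumAssoc (E F D : GVect.{u, v} G X) : Iso ((E.sum F).sum D) (E.sum (F.sum D)) where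
  toEquiv x := LinearEquiv.prodAssoc ℂ (E.fiber x) (F.fiber x) (D.fiber x)
  continuous_toFun := by
    have h1 := (VB.prod_isInducing E.toVB F.toVB).continuous
    have h2 := (VB.prod_isInducing (E.sum F).toVB D.toVB).continuous
    refine (VB.prod_isInducing E.toVB (F.sum D).toVB).continuous_iff.2 ?_
    refine (continuous_fst.comp (h1.comp (continuous_fst.comp h2))).prodMk ?_
    refine (VB.prod_isInducing F.toVB D.toVB).continuous_iff.2 ?_
    exact (continuous_snd.comp (h1.comp (continuous_fst.comp h2))).prodMk (continuous_snd.comp h2)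
  continuous_invFun := by
    have h1 := (VB.prod_isInducing F.toVB D.toVB).continuous
    have h2 := (VB.prod_isInducing E.toVB (F.sum D).toVB).continuous
    refine (VB.prod_isInducing (E.sum F).toVB D.toVB).continuous_iff.2 ?_
    refine Continuous.prodMk ?_ (continuous_snd.comp (h1.comp (continuous_snd.comp h2)))
    refine (VB.prod_isInducing E.toVB F.toVB).continuous_iff.2 ?_
    exact (continuous_fst.comp h2).prodMk (continuous_fst.comp (h1.comp (continuous_snd.comp h2)))
  map_act g x v := rfl

def sumZero [ContinuousConstSMul G X] (E : GVect.{u, v} G X) : Iso (E.sum (zero G X)) E where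
  toEquiv x := LinearEquiv.prodUnique (R := ℂ) (M := E.fiber x) (M₂ := PUnit.{v + 1})
  continuous_toFun := continuous_fst.comp (VB.prod_isInducing E.toVB (zero G X).toVB).continuous
  continuous_invFun := by
    refine (VB.prod_isInducing E.toVB (zero G X).toVB).continuous_iff.2 ?_
    exact continuous_id.prodMk (continuous_induced_rng.2 E.continuous_base)
  map_act g x v := rfl

def pullbackCongr {E E' : GVect.{u, v} G X} (e : Iso E E') (f : GMap G Y X)
    [ContinuousConstSMul G Y] : Iso (E.pullback f) (E'.pullback f) where
  toEquiv y := e.toEquiv (f.toFun y)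
  continuous_toFun := by
    have hj := VB.pullback_isInducing E.toVB f.toFun f.continuous_toFun
    refine (VB.pullback_isInducing E'.toVB f.toFun f.continuous_toFun).continuous_iff.2 ?_
    exact (continuous_fst.comp hj.continuous).prodMk
      (e.continuous_toFun.comp (continuous_snd.comp hj.continuous))
  continuous_invFun := by
    have hj := VB.pullback_isInducing E'.toVB f.toFun f.continuous_toFun
    refine (VB.pullback_isInducing E.toVB f.toFun f.continuous_toFun).continuous_iff.2 ?_
    exact (continuous_fst.comp hj.continuous).prodMk
      (e.continuous_invFun.comp (continuous_snd.comp hj.continuous))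
  map_act g y v := by
    exact (e.apply_cast _ _).trans (congrArg _ (e.map_act g _ v))

theorem cast_prod {E F : VB.{u, v} X} {x y : X} (h : x = y) (v : E.fiber x × F.fiber x) :
    (E.prod F).cast h v = (E.cast h v.1, F.cast h v.2) := by subst h; rfl

def pullbackSum (E F : GVect.{u, v} G X) (f : GMap G Y X) [ContinuousConstSMul G Y] :
    Iso ((E.sum F).pullback f) ((E.pullback f).sum (F.pullback f)) where
  toEquiv y := LinearEquiv.refl ℂ (E.fiber (f.toFun y) × F.fiber (f.toFun y))
  continuous_toFun := by
    have h1 := (VB.pullback_isInducing (E.sum F).toVB f.toFun f.continuous_toFun).continuous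
    have h2 := (VB.prod_isInducing E.toVB F.toVB).continuous.comp (continuous_snd.comp h1)
    refine (VB.prod_isInducing (E.pullback f).toVB (F.pullback f).toVB).continuous_iff.2 ?_
    refine Continuous.prodMk ?_ ?_
    · refine (VB.pullback_isInducing E.toVB f.toFun f.continuous_toFun).continuous_iff.2 ?_
      exact (continuous_fst.comp h1).prodMk (continuous_fst.comp h2)
    · refine (VB.pullback_isInducing F.toVB f.toFun f.continuous_toFun).continuous_iff.2 ?_
      exact (continuous_fst.comp h1).prodMk (continuous_snd.comp h2)
  continuous_invFun := by
    have h := (VB.prod_isInducing (E.pullback f).toVB (F.pullback f).toVB).continuous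
    have h1 := (VB.pullback_isInducing E.toVB f.toFun f.continuous_toFun).continuous.comp
      (continuous_fst.comp h)
    have h2 := (VB.pullback_isInducing F.toVB f.toFun f.continuous_toFun).continuous.comp
      (continuous_snd.comp h)
    refine (VB.pullback_isInducing (E.sum F).toVB f.toFun f.continuous_toFun).continuous_iff.2 ?_
    refine (continuous_fst.comp h1).prodMk ?_
    refine (VB.prod_isInducing E.toVB F.toVB).continuous_iff.2 ?_
    exact (continuous_snd.comp h1).prodMk (continuous_snd.comp h2)
  map_act g y v := cast_prod (f.map_smul g y).symm _

def pullbackZero (G : Type w) [Group G] [MulAction G X] [MulAction G Y] [ContinuousConstSMul G X]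
    [ContinuousConstSMul G Y] (f : GMap G Y X) :
    Iso ((zero.{u, v} G X).pullback f) (zero G Y) where
  toEquiv y := LinearEquiv.refl ℂ PUnit.{v + 1}
  continuous_toFun := by
    have h1 := (VB.pullback_isInducing (zero.{u, v} G X).toVB f.toFun
      f.continuous_toFun).continuous
    exact continuous_induced_rng.2 (continuous_fst.comp h1)
  continuous_invFun := by
    refine (VB.pullback_isInducing (zero.{u, v} G X).toVB f.toFun f.continuous_toFun).continuous_iff.2 ?_
    exact (VB.zero Y).continuous_base.prodMk
      (continuous_induced_rng.2 (f.continuous_toFun.comp (VB.zero Y).continuous_base))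
  map_act g y v := rfl

end GVect

/-- The monoid `Vec_G(X)` of isomorphism classes of `G`-vector bundles over `X`. -/
def Vec (G : Type w) [Group G] (X : Type u) [TopologicalSpace X] [MulAction G X] :=
  Quotient (GVect.setoid.{u, v} G X)

namespace Vec

variable {G : Type w} [Group G] {X : Type u} {Y : Type u'} [TopologicalSpace X]
  [TopologicalSpace Y] [MulAction G X] [MulAction G Y]

/-- The isomorphism class of a bundle. -/
def mk (E : GVect.{u, v} G X) : Vec.{u, v} G X := Quotient.mk _ E

theorem mk_eq {E F : GVect.{u, v} G X} (e : GVect.Iso E F) : mk E = mk F := Quotient.sound ⟨e⟩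

instance [ContinuousConstSMul G X] : Zero (Vec.{u, v} G X) := ⟨mk (GVect.zero G X)⟩

instance : Add (Vec.{u, v} G X) :=
  ⟨Quotient.map₂ GVect.sum fun _ _ ⟨e⟩ _ _ ⟨f⟩ => ⟨GVect.sumCongr e f⟩⟩

instance [ContinuousConstSMul G X] : AddCommMonoid (Vec.{u, v} G X) where
  add_assoc := by
    rintro ⟨E⟩ ⟨F⟩ ⟨D⟩; exact mk_eq (GVect.sumAssoc E F D)
  add_comm := by
    rintro ⟨E⟩ ⟨F⟩; exact mk_eq (GVect.sumComm E F)
  zero_add := by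
    rintro ⟨E⟩; exact mk_eq ((GVect.sumComm _ _).trans (GVect.sumZero E))
  add_zero := by
    rintro ⟨E⟩; exact mk_eq (GVect.sumZero E)
  nsmul := nsmulRec

theorem mk_add [ContinuousConstSMul G X] (E F : GVect.{u, v} G X) :
    mk E + mk F = mk (E.sum F) := rfl

/-- Pullback of isomorphism classes along a `G`-map. -/
def pullback [ContinuousConstSMul G X] [ContinuousConstSMul G Y] (f : GMap G Y X) :
    Vec.{u, v} G X →+ Vec.{u', v} G Y where
  toFun := Quotient.map (fun E => E.pullback f) fun _ _ ⟨e⟩ => ⟨GVect.pullbackCongr e f⟩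
  map_zero' := mk_eq (GVect.pullbackZero G f)
  map_add' := by rintro ⟨E⟩ ⟨F⟩; exact mk_eq (GVect.pullbackSum E F f)

theorem pullback_mk [ContinuousConstSMul G X] [ContinuousConstSMul G Y] (f : GMap G Y X)
    (E : GVect.{u, v} G X) : pullback f (mk E) = mk (E.pullback f) := rfl

end Vec

/-- The homomorphism of Grothendieck groups induced by a homomorphism of commutative monoids. -/
noncomputable def grothMap {M : Type u} {N : Type u'} [AddCommMonoid M] [AddCommMonoid N]
    (f : M →+ N) : Algebra.GrothendieckAddGroup M →+ Algebra.GrothendieckAddGroup N :=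
  Algebra.GrothendieckAddGroup.lift (Algebra.GrothendieckAddGroup.of.comp f)

theorem grothMap_of {M : Type u} {N : Type u'} [AddCommMonoid M] [AddCommMonoid N]
    (f : M →+ N) (m : M) : grothMap f (Algebra.GrothendieckAddGroup.of m) =
      Algebra.GrothendieckAddGroup.of (f m) := by
  have := Algebra.GrothendieckAddGroup.lift.symm_apply_apply
    ((Algebra.GrothendieckAddGroup.of (M := N)).comp f)
  exact DFunLike.congr_fun this m

theorem groth_ext {M : Type u} {N : Type u'} [AddCommMonoid M] [AddCommGroup N]
    {f g : Algebra.GrothendieckAddGroup M →+ N}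
    (h : ∀ m, f (Algebra.GrothendieckAddGroup.of m) = g (Algebra.GrothendieckAddGroup.of m)) :
    f = g := by
  apply Algebra.GrothendieckAddGroup.lift.symm.injective
  ext m
  exact h m

/-! ### Representations -/

/-- A finite-dimensional complex irreducible representation of `A`. -/
structure IrrRep (A : Type w) [Group A] : Type (max w (v + 1)) where
  V : Type v
  [acg : AddCommGroup V]
  [mod : Module ℂ V]
  [fd : FiniteDimensional ℂ V]
  ρ : Representation ℂ A V
  irr : ρ.IsIrreducible

attribute [instance] IrrRep.acg IrrRep.mod IrrRep.fd IrrRep.irr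

section Rep

variable {A : Type w} [Group A] (τ : IrrRep.{v} A) {W : Type v} [AddCommGroup W] [Module ℂ W]
  (σ : Representation ℂ A W)

/-- The evaluation `V_τ ⊗ Hom_A(V_τ, W) → W`, `v ⊗ f ↦ f v`. -/
noncomputable def evRep : τ.V ⊗[ℂ] (τ.ρ.IntertwiningMap σ) →ₗ[ℂ] W :=
  TensorProduct.lift
    { toFun := fun v =>
        { toFun := fun f => f v
          map_add' := fun _ _ => rfl
          map_smul' := fun _ _ => rfl }
      map_add' := fun v v' => by ext f; exact map_add f v v'
      map_smul' := fun c v => by ext f; exact map_smul f c v }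

@[simp] theorem evRep_tmul (v : τ.V) (f : τ.ρ.IntertwiningMap σ) :
    evRep τ σ (v ⊗ₜ f) = f v := rfl

theorem schur_average [Fintype A] (T : τ.V →ₗ[ℂ] τ.V) :
    (Module.finrank ℂ τ.V : ℂ) • ∑ a, τ.ρ a ∘ₗ T ∘ₗ τ.ρ a⁻¹ =
      ((Fintype.card A : ℂ) * LinearMap.trace ℂ τ.V T) • LinearMap.id := by
  let S : τ.V →ₗ[ℂ] τ.V := ∑ a, τ.ρ a ∘ₗ T ∘ₗ τ.ρ a⁻¹
  have hS : ∀ b, S ∘ₗ τ.ρ b = τ.ρ b ∘ₗ S := by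
    intro b
    ext v
    simp only [S, LinearMap.comp_apply, LinearMap.sum_apply, map_sum]
    refine Fintype.sum_equiv (Equiv.mulLeft b⁻¹) _ _ fun a => ?_
    have h1 : τ.ρ (b⁻¹ * a)⁻¹ v = τ.ρ a⁻¹ (τ.ρ b v) := by
      rw [mul_inv_rev, inv_inv, map_mul, Module.End.mul_apply]
    have h2 : ∀ z, τ.ρ b (τ.ρ (b⁻¹ * a) z) = τ.ρ a z := by
      intro z
      rw [← Module.End.mul_apply, ← map_mul, mul_inv_cancel_left]
    rw [Equiv.coe_mulLeft, h2, h1]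
  let S' : τ.ρ.IntertwiningMap τ.ρ := ⟨S, hS⟩
  obtain ⟨c, hc⟩ :=
    (Representation.IsIrreducible.algebraMap_intertwiningMap_bijective_of_isAlgClosed
      (ρ := τ.ρ)).2 S'
  have hc' : S = c • LinearMap.id := by
    ext v
    have := DFunLike.congr_fun hc v
    exact this.symm
  have ht : LinearMap.trace ℂ τ.V S = (Fintype.card A : ℂ) * LinearMap.trace ℂ τ.V T := by
    simp only [S, map_sum]
    have : ∀ a, LinearMap.trace ℂ τ.V (τ.ρ a ∘ₗ T ∘ₗ τ.ρ a⁻¹) = LinearMap.trace ℂ τ.V T := by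
      intro a
      rw [LinearMap.trace_comp_comm', LinearMap.comp_assoc, ← Module.End.mul_eq_comp (τ.ρ a⁻¹),
        ← map_mul, inv_mul_cancel, map_one]
      rfl
    simp [this]
  have ht' : LinearMap.trace ℂ τ.V S = c * Module.finrank ℂ τ.V := by
    rw [hc', map_smul, LinearMap.trace_id, smul_eq_mul]
  change (Module.finrank ℂ τ.V : ℂ) • S = _
  rw [hc', smul_smul, ← ht, ht', mul_comm]

/-- The map `w ↦ ∑ₐ ξ(τ(a⁻¹) w) • σ(a) e` as an element of `Hom_A(V_τ, W)`. -/
noncomputable def coeffMap [Fintype A] (ξ : Module.Dual ℂ τ.V) :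
    W →ₗ[ℂ] τ.ρ.IntertwiningMap σ where
  toFun e :=
    { toLinearMap := ∑ a, (ξ ∘ₗ τ.ρ a⁻¹).smulRight (σ a e)
      isIntertwining' := by
        intro b
        ext v
        simp only [LinearMap.comp_apply, LinearMap.sum_apply, map_sum, LinearMap.smulRight_apply,
          map_smul]
        refine Fintype.sum_equiv (Equiv.mulLeft b⁻¹) _ _ fun a => ?_
        simp only [Equiv.coe_mulLeft, mul_inv_rev, inv_inv, ← Module.End.mul_apply, ← map_mul,
          mul_inv_cancel_left] }
  map_add' e e' := by
    ext v
    simp [Finset.sum_add_distrib]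
  map_smul' c e := by
    ext v
    simp [Finset.smul_sum, smul_comm c]

theorem coeffMap_apply [Fintype A] (ξ : Module.Dual ℂ τ.V) (e : W) (v : τ.V) :
    coeffMap τ σ ξ e v = ∑ a, ξ (τ.ρ a⁻¹ v) • σ a e := by
  change (∑ a, (ξ ∘ₗ τ.ρ a⁻¹).smulRight (σ a e)) v = _
  simp

theorem exists_retraction [Fintype A] : ∃ c : A → ℂ,
    ∀ {W : Type v} [AddCommGroup W] [Module ℂ W] (σ : Representation ℂ A W),
      ∃ r : W →ₗ[ℂ] τ.V ⊗[ℂ] (τ.ρ.IntertwiningMap σ),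
        (∀ t, r (evRep τ σ t) = t) ∧ ∀ e, evRep τ σ (r e) = ∑ a, c a • σ a e := by
  let b := Module.finBasis ℂ τ.V
  let k : ℂ := (Module.finrank ℂ τ.V : ℂ) / (Fintype.card A : ℂ)
  have hA : (Fintype.card A : ℂ) ≠ 0 := Nat.cast_ne_zero.2 Fintype.card_ne_zero
  refine ⟨fun a => k * ∑ i, b.coord i (τ.ρ a⁻¹ (b i)), fun {W} _ _ σ => ?_⟩
  let r : W →ₗ[ℂ] τ.V ⊗[ℂ] (τ.ρ.IntertwiningMap σ) :=
    k • ∑ i, (TensorProduct.mk ℂ _ _ (b i)) ∘ₗ coeffMap τ σ (b.coord i)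
  have hr : ∀ e, r e = k • ∑ i, b i ⊗ₜ[ℂ] coeffMap τ σ (b.coord i) e := by
    intro e; simp [r]
  refine ⟨r, ?_, ?_⟩
  · intro t
    induction t using TensorProduct.induction_on with
    | zero => simp
    | add x y hx hy => rw [map_add, map_add, hx, hy]
    | tmul v f =>
      have key : ∀ ξ : Module.Dual ℂ τ.V, k • coeffMap τ σ ξ (f v) = ξ v • f := by
        intro ξ
        ext w
        have h1 := LinearMap.congr_fun (schur_average τ (ξ.smulRight v)) w
        have h2 : coeffMap τ σ ξ (f v) w =
            f ((∑ a, τ.ρ a ∘ₗ (ξ.smulRight v) ∘ₗ τ.ρ a⁻¹) w) := by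
          rw [coeffMap_apply]
          simp only [LinearMap.sum_apply, map_sum]
          refine Finset.sum_congr rfl fun a _ => ?_
          simp only [LinearMap.comp_apply, LinearMap.smulRight_apply, map_smul]
          rw [f.isIntertwining]
        have h3 : LinearMap.trace ℂ τ.V (ξ.smulRight v) = ξ v := by
          simp
        have h4 : (k • coeffMap τ σ ξ (f v)) w = k • (coeffMap τ σ ξ (f v) w) := rfl
        have h5 : (ξ v • f) w = ξ v • f w := rfl
        change (k • coeffMap τ σ ξ (f v)) w = (ξ v • f) w
        rw [h4, h5, h2, ← map_smul f, ← map_smul f]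
        congr 1
        rw [h3] at h1
        have h6 : k • (∑ a, τ.ρ a ∘ₗ (ξ.smulRight v) ∘ₗ τ.ρ a⁻¹) w = (Fintype.card A : ℂ)⁻¹ •
            ((Module.finrank ℂ τ.V : ℂ) • ∑ a, τ.ρ a ∘ₗ (ξ.smulRight v) ∘ₗ τ.ρ a⁻¹) w := by
          rw [LinearMap.smul_apply, smul_smul]; congr 1; simp only [k]; field_simp
        rw [h6, h1, LinearMap.smul_apply, smul_smul, LinearMap.id_apply, inv_mul_cancel_left₀ hA]
      rw [hr, evRep_tmul, Finset.smul_sum]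
      have : ∀ i, k • b i ⊗ₜ[ℂ] coeffMap τ σ (b.coord i) (f v) = (b.coord i v • b i) ⊗ₜ[ℂ] f := by
        intro i
        rw [← TensorProduct.tmul_smul, key, TensorProduct.tmul_smul, TensorProduct.smul_tmul']
      simp only [this, ← TensorProduct.sum_tmul]
      congr 1
      exact b.sum_repr v
  · intro e
    rw [hr, map_smul, map_sum]
    simp only [evRep_tmul, coeffMap_apply]
    rw [Finset.sum_comm, Finset.smul_sum]
    refine Finset.sum_congr rfl fun a _ => ?_
    rw [← Finset.sum_smul, smul_smul]

theorem evRep_injective [Finite A] : Function.Injective (evRep τ σ) := by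
  have := Fintype.ofFinite A
  obtain ⟨c, hc⟩ := exists_retraction τ
  obtain ⟨r, hr, -⟩ := hc σ
  exact Function.LeftInverse.injective hr

end Rep

/-- Two irreducible representations are equivalent if they are isomorphic. -/
instance IrrRep.setoid (A : Type w) [Group A] : Setoid (IrrRep.{v} A) where
  r σ τ := Nonempty (σ.ρ.Equiv τ.ρ)
  iseqv := ⟨fun σ => ⟨Representation.Equiv.refl σ.ρ⟩, fun ⟨e⟩ => ⟨e.symm⟩,
    fun ⟨e⟩ ⟨f⟩ => ⟨e.trans f⟩⟩

/-- The set `Irr(A)` of isomorphism classes of complex irreducible representations of `A`. -/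
def Irr (A : Type w) [Group A] := Quotient (IrrRep.setoid.{v} A)

/-- The class `[τ] ∈ Irr(A)`. -/
def Irr.mk {A : Type w} [Group A] (τ : IrrRep.{v} A) : Irr.{v} A := Quotient.mk _ τ

section Conj

variable {G : Type w} [Group G] {A : Subgroup G} [A.Normal]

theorem irreducible_comp {B : Type*} {C : Type*} [Group B] [Group C] {V : Type*} [AddCommGroup V]
    [Module ℂ V] (ρ : Representation ℂ B V) [ρ.IsIrreducible] (e : C ≃* B) :
    Representation.IsIrreducible (ρ.comp e.toMonoidHom : Representation ℂ C V) := by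
  let f : Subrepresentation (ρ.comp e.toMonoidHom : Representation ℂ C V) ≃o
      Subrepresentation ρ :=
    { toFun := fun s => ⟨s.toSubmodule, fun b v hv => by
        have := s.apply_mem_toSubmodule (e.symm b) hv
        simpa using this⟩
      invFun := fun s => ⟨s.toSubmodule, fun c v hv => s.apply_mem_toSubmodule (e c) hv⟩
      left_inv := fun s => rfl
      right_inv := fun s => rfl
      map_rel_iff' := Iff.rfl }
  exact f.isSimpleOrder_iff.2 inferInstance

/-- The conjugate `g · τ`, `(g · τ)(a) = τ(g⁻¹ a g)`. -/
def IrrRep.conj (g : G) (τ : IrrRep.{v} A) : IrrRep.{v} A where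
  V := τ.V
  ρ := τ.ρ.comp (MulAut.conjNormal g⁻¹ : A ≃* A).toMonoidHom
  irr := irreducible_comp τ.ρ _

theorem IrrRep.conj_apply (g : G) (τ : IrrRep.{v} A) (a : A) :
    (τ.conj g).ρ a = τ.ρ (MulAut.conjNormal g⁻¹ a) := rfl

/-- The action of `G` on `Irr(A)` by conjugation. -/
instance : MulAction G (Irr.{v} A) where
  smul g := Quotient.map (IrrRep.conj g) fun σ τ ⟨e⟩ =>
    ⟨Representation.Equiv.mk e.toLinearEquiv fun a => by
      ext v; exact e.toIntertwiningMap.isIntertwining _ _ _ v⟩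
  one_smul := by
    rintro ⟨τ⟩
    refine Quotient.sound ⟨Representation.Equiv.mk (LinearEquiv.refl ℂ τ.V) fun a => ?_⟩
    ext v
    change τ.ρ (MulAut.conjNormal 1⁻¹ a) v = τ.ρ a v
    simp
  mul_smul := by
    rintro g h ⟨τ⟩
    refine Quotient.sound ⟨Representation.Equiv.mk (LinearEquiv.refl ℂ τ.V) fun a => ?_⟩
    ext v
    change τ.ρ (MulAut.conjNormal (g * h)⁻¹ a) v =
      τ.ρ (MulAut.conjNormal h⁻¹ (MulAut.conjNormal g⁻¹ a)) v
    rw [mul_inv_rev, map_mul, MulAut.mul_apply]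

/-- The isotropy group `G_[τ]` of the class of `τ`. -/
def IrrRep.stab (τ : IrrRep.{v} A) : Subgroup G := MulAction.stabilizer G (Irr.mk τ)

theorem IrrRep.exists_intertwiner (τ : IrrRep.{v} A) (h : τ.stab) :
    ∃ M : τ.V ≃ₗ[ℂ] τ.V, ∀ (a : A) (v : τ.V),
      M (τ.ρ (MulAut.conjNormal (h : G)⁻¹ a) v) = τ.ρ a (M v) := by
  obtain ⟨e⟩ := Quotient.exact (s := IrrRep.setoid.{v} A) (MulAction.mem_stabilizer_iff.1 h.2)
  exact ⟨e.toLinearEquiv, fun a v => e.toIntertwiningMap.isIntertwining _ _ a v⟩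

/-- A linear automorphism `M_h` of `V_τ` with `τ(h⁻¹ a h) = M_h⁻¹ τ(a) M_h`. -/
noncomputable def IrrRep.inter (τ : IrrRep.{v} A) (h : τ.stab) : τ.V ≃ₗ[ℂ] τ.V :=
  (τ.exists_intertwiner h).choose

theorem IrrRep.inter_spec (τ : IrrRep.{v} A) (h : τ.stab) (a : A) (v : τ.V) :
    τ.inter h (τ.ρ (MulAut.conjNormal (h : G)⁻¹ a) v) = τ.ρ a (τ.inter h v) :=
  (τ.exists_intertwiner h).choose_spec a v

theorem IrrRep.le_stab (τ : IrrRep.{v} A) : A ≤ τ.stab := by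
  intro b hb
  let c : A := ⟨b, hb⟩
  have h1 : τ.ρ c ∘ₗ τ.ρ c⁻¹ = LinearMap.id := by
    rw [← Module.End.mul_eq_comp, ← map_mul, mul_inv_cancel, map_one]; rfl
  have h2 : τ.ρ c⁻¹ ∘ₗ τ.ρ c = LinearMap.id := by
    rw [← Module.End.mul_eq_comp, ← map_mul, inv_mul_cancel, map_one]; rfl
  refine MulAction.mem_stabilizer_iff.2 (Quotient.sound ⟨Representation.Equiv.mk
    (LinearEquiv.ofLinearMap (τ.ρ c) (τ.ρ c⁻¹) h1 h2) fun a => ?_⟩)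
  change τ.ρ c * τ.ρ (MulAut.conjNormal b⁻¹ a) = τ.ρ a * τ.ρ c
  rw [← map_mul, ← map_mul]
  congr 1
  ext
  simp [c, mul_assoc]

/-- The inclusion `A → G_[τ]`. -/
def IrrRep.incl (τ : IrrRep.{v} A) : A →* τ.stab := Subgroup.inclusion τ.le_stab

end Conj

/-- `A` acts trivially, through `i : A → H`, on the `H`-space `X`. -/
class ActsTrivially {A : Type*} {H : Type*} [Group A] [Group H] (i : A →* H) (X : Type*)
    [MulAction H X] : Prop where
  smul_eq : ∀ (a : A) (x : X), i a • x = x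

namespace GVect

section FiberRep

variable {A : Type*} {H : Type*} [Group A] [Group H] (i : A →* H) {X : Type u}
  [TopologicalSpace X] [MulAction H X] [ActsTrivially i X]

/-- The fibre `E_x` as a representation of `A`. -/
def fiberRep (E : GVect.{u, v} H X) (x : X) : Representation ℂ A (E.fiber x) :=
  have key : ∀ (a : A) (v : E.fiber x),
      (⟨x, E.cast (ActsTrivially.smul_eq (i := i) a x) (E.act (i a) x v)⟩ : Tot E.fiber) =
        E.tact (i a) ⟨x, v⟩ := fun a v => E.mk_cast _ _
  { toFun := fun a =>
      (E.cast (ActsTrivially.smul_eq (i := i) a x)).toLinearMap ∘ₗ E.act (i a) x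
    map_one' := by
      ext v
      apply Tot.mk_inj (F := E.fiber)
      refine (key 1 v).trans ?_
      rw [map_one, E.tact_one]; rfl
    map_mul' := fun a b => by
      ext v
      apply Tot.mk_inj (F := E.fiber)
      refine (key (a * b) v).trans ?_
      rw [map_mul, E.tact_mul, ← key b v, ← key a]; rfl }

theorem mk_fiberRep (E : GVect.{u, v} H X) (x : X) (a : A) (v : E.fiber x) :
    (⟨x, E.fiberRep i x a v⟩ : Tot E.fiber) = E.tact (i a) ⟨x, v⟩ := E.mk_cast _ _

variable (τ : IrrRep.{v} A)

/-- The fibre `V_τ ⊗ Hom_A(V_τ, E_x)`. -/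
abbrev IsoFiber (E : GVect.{u, v} H X) (x : X) : Type v :=
  τ.V ⊗[ℂ] (τ.ρ.IntertwiningMap (E.fiberRep i x))

/-- The evaluation `V_τ ⊗ Hom_A(V_τ, E_x) → E_x`, `v ⊗ f ↦ f v`. -/
noncomputable def ev (E : GVect.{u, v} H X) (x : X) : E.IsoFiber i τ x →ₗ[ℂ] E.fiber x :=
  evRep τ (E.fiberRep i x)

theorem ev_injective [Finite A] (E : GVect.{u, v} H X) (x : X) :
    Function.Injective (E.ev i τ x) := evRep_injective τ _

/-- `E` is an `(H, τ)`-equivariant bundle: the evaluation `V_τ ⊗ Hom_A(V_τ, E) → E` is an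
isomorphism. (The source carries the topology for which evaluation is a topological embedding, see
`isoVB`, so that it suffices to ask for bijectivity on the fibres.) -/
def IsIsotypic (E : GVect.{u, v} H X) : Prop := ∀ x, Function.Bijective (E.ev i τ x)

theorem exists_isoRetraction [Finite A] (E : GVect.{u, v} H X) :
    ∃ r : ∀ x, E.fiber x →ₗ[ℂ] E.IsoFiber i τ x, (∀ x t, r x (E.ev i τ x t) = t) ∧
      Continuous fun p : Tot E.fiber => (⟨p.base, E.ev i τ p.base (r p.base p.vec)⟩ :
        Tot E.fiber) := by
  have := Fintype.ofFinite A
  obtain ⟨c, hc⟩ := exists_retraction τ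
  choose r h1 h2 using fun x => hc (E.fiberRep i x)
  refine ⟨r, h1, ?_⟩
  have : (fun p : Tot E.fiber => (⟨p.base, E.ev i τ p.base (r p.base p.vec)⟩ : Tot E.fiber)) =
      fun p => ⟨p.base, ∑ a, c a • E.fiberRep i p.base a p.vec⟩ := by
    funext p
    exact congrArg _ (h2 p.base p.vec)
  rw [this]
  refine E.continuous_sum E.continuous_base _ fun a _ => E.continuous_smul ?_ _
  exact (E.continuous_tact (i a)).congr fun p => (E.mk_fiberRep i _ a _).symm

/-- The vector bundle `V_τ ⊗ Hom_A(V_τ, E)`. Evaluation embeds it fibrewise into `E`, as a direct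
summand, and its topology is the one induced by this embedding. -/
noncomputable def isoVB [Finite A] (E : GVect.{u, v} H X) : VB.{u, v} X :=
  E.toVB.ofSplit (E.IsoFiber i τ) (E.ev i τ) (E.exists_isoRetraction i τ).choose
    (E.exists_isoRetraction i τ).choose_spec.1 (E.exists_isoRetraction i τ).choose_spec.2

theorem isoVB_isInducing [Finite A] (E : GVect.{u, v} H X) :
    IsInducing fun p : Tot (E.isoVB i τ).fiber =>
      (⟨p.base, E.ev i τ p.base p.vec⟩ : Tot E.fiber) := ⟨rfl⟩

theorem isoVB_ext [Finite A] {E : GVect.{u, v} H X} {p q : Tot (E.isoVB i τ).fiber}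
    (h : (⟨p.base, E.ev i τ p.base p.vec⟩ : Tot E.fiber) = ⟨q.base, E.ev i τ q.base q.vec⟩) :
    p = q := by
  obtain ⟨x, v⟩ := p; obtain ⟨y, w⟩ := q
  obtain rfl : x = y := congrArg Tot.base h
  exact congrArg _ (E.ev_injective i τ x (Tot.mk_inj h))

/-- The map `V_τ ⊗ Hom_A(V_τ, E_x) → V_τ ⊗ Hom_A(V_τ, F_y)` induced by an `A`-map `E_x → F_y`. -/
noncomputable def isoMap {B : Type*} [Group B] (j : A →* B) {Y : Type u'} [TopologicalSpace Y]
    [MulAction B Y] [ActsTrivially j Y] {E : GVect.{u, v} H X} {F : GVect.{u', v} B Y} {x : X}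
    {y : Y} (φ : E.fiber x →ₗ[ℂ] F.fiber y)
    (hφ : ∀ a v, φ (E.fiberRep i x a v) = F.fiberRep j y a (φ v)) :
    E.IsoFiber i τ x →ₗ[ℂ] F.IsoFiber j τ y :=
  TensorProduct.map LinearMap.id
    { toFun := fun f => ⟨φ ∘ₗ f.toLinearMap, fun a => by
        ext v
        change φ (f (τ.ρ a v)) = F.fiberRep j y a (φ (f v))
        rw [f.isIntertwining, hφ]⟩
      map_add' := fun f g => by ext v; exact map_add φ _ _
      map_smul' := fun c f => by ext v; exact map_smul φ _ _ }

theorem ev_isoMap {B : Type*} [Group B] (j : A →* B) {Y : Type u'} [TopologicalSpace Y]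
    [MulAction B Y] [ActsTrivially j Y] {E : GVect.{u, v} H X} {F : GVect.{u', v} B Y} {x : X}
    {y : Y} (φ : E.fiber x →ₗ[ℂ] F.fiber y)
    (hφ : ∀ a v, φ (E.fiberRep i x a v) = F.fiberRep j y a (φ v)) (t : E.IsoFiber i τ x) :
    F.ev j τ y (isoMap i τ j φ hφ t) = φ (E.ev i τ x t) := by
  induction t using TensorProduct.induction_on with
  | zero => simp
  | add s t hs ht => simp only [map_add, hs, ht]
  | tmul v f => rfl

end FiberRep

section Isotypic

variable {G : Type w} [Group G] {A : Subgroup G} [A.Normal] (τ : IrrRep.{v} A)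
  {X : Type u} [TopologicalSpace X] [MulAction G X] [hA : ActsTrivially A.subtype X]

instance : ActsTrivially τ.incl X := ⟨fun a x => hA.smul_eq a x⟩

theorem act_fiberRep (E : GVect.{u, v} G X) (g : G) (x : X) (a : A) (v : E.fiber x) :
    E.act g x (E.fiberRep A.subtype x (MulAut.conjNormal g⁻¹ a) v) =
      E.fiberRep A.subtype (g • x) a (E.act g x v) := by
  apply Tot.mk_inj (F := E.fiber)
  rw [mk_fiberRep, ← E.tact_mk, ← E.tact_mk, mk_fiberRep, ← E.tact_mul, ← E.tact_mul]
  congr 1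
  simp [mul_assoc]

/-- The operation `h • f = h ∘ f ∘ M_h⁻¹ : V_τ → E_{hx}` on `f ∈ Hom_A(V_τ, E_x)`. -/
noncomputable def bullet (E : GVect.{u, v} G X) (h : τ.stab) (x : X) :
    τ.ρ.IntertwiningMap (E.fiberRep A.subtype x) →ₗ[ℂ]
      τ.ρ.IntertwiningMap (E.fiberRep A.subtype ((h : G) • x)) where
  toFun f := ⟨E.act (h : G) x ∘ₗ f.toLinearMap ∘ₗ (τ.inter h).symm.toLinearMap, fun a => by
    ext w
    change E.act (h : G) x (f ((τ.inter h).symm (τ.ρ a w))) =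
      E.fiberRep A.subtype ((h : G) • x) a (E.act (h : G) x (f ((τ.inter h).symm w)))
    have : (τ.inter h).symm (τ.ρ a w) =
        τ.ρ (MulAut.conjNormal (h : G)⁻¹ a) ((τ.inter h).symm w) := by
      rw [LinearEquiv.symm_apply_eq, τ.inter_spec, LinearEquiv.apply_symm_apply]
    rw [this, f.isIntertwining, act_fiberRep]⟩
  map_add' f g := by ext w; exact map_add (E.act (h : G) x) _ _
  map_smul' c f := by ext w; exact map_smul (E.act (h : G) x) _ _

/-- The action `h ⋆ (v ⊗ f) = M_h v ⊗ (h • f)` of `G_[τ]` on `V_τ ⊗ Hom_A(V_τ, E)`. -/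
noncomputable def star (E : GVect.{u, v} G X) (h : τ.stab) (x : X) :
    E.IsoFiber A.subtype τ x →ₗ[ℂ] E.IsoFiber A.subtype τ ((h : G) • x) :=
  TensorProduct.map (τ.inter h).toLinearMap (E.bullet τ h x)

theorem ev_star (E : GVect.{u, v} G X) (h : τ.stab) (x : X) (t : E.IsoFiber A.subtype τ x) :
    E.ev A.subtype τ _ (E.star τ h x t) = E.act (h : G) x (E.ev A.subtype τ x t) := by
  induction t using TensorProduct.induction_on with
  | zero => simp
  | add s t hs ht => simp only [map_add, hs, ht]
  | tmul v f =>
    change E.act (h : G) x (f ((τ.inter h).symm (τ.inter h v))) = E.act (h : G) x (f v)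
    rw [LinearEquiv.symm_apply_apply]

variable [Finite G]

/-- The `G_[τ]`-vector bundle `V_τ ⊗ Hom_A(V_τ, E)` of a `G`-vector bundle `E`. -/
noncomputable def isotypic (E : GVect.{u, v} G X) : GVect.{u, v} τ.stab X where
  toVB := E.isoVB A.subtype τ
  act h x := E.star τ h x
  act_one x t := by
    apply isoVB_ext
    exact (congrArg _ (E.ev_star τ 1 x t)).trans (E.act_one x _)
  act_mul g h x t := by
    apply isoVB_ext
    refine (congrArg _ (E.ev_star τ (g * h) x t)).trans ((E.act_mul g h x _).trans ?_)
    exact (congrArg _ ((E.ev_star τ g _ _).trans (congrArg _ (E.ev_star τ h x t)))).symm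
  continuous_act h := by
    have hj := E.isoVB_isInducing A.subtype τ
    refine hj.continuous_iff.2 (((E.continuous_tact (h : G)).comp hj.continuous).congr fun p => ?_)
    exact congrArg _ (E.ev_star τ h p.base p.vec).symm

theorem ev_fiberRep_isotypic (E : GVect.{u, v} G X) (x : X) (a : A)
    (t : E.IsoFiber A.subtype τ x) :
    E.ev A.subtype τ x ((E.isotypic τ).fiberRep τ.incl x a t) =
      E.fiberRep A.subtype x a (E.ev A.subtype τ x t) := by
  apply Tot.mk_inj (F := E.fiber)
  rw [mk_fiberRep]
  have h := (E.isotypic τ).mk_fiberRep τ.incl x a t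
  have h' := congrArg (fun p : Tot (E.isotypic τ).fiber =>
    (⟨p.base, E.ev A.subtype τ p.base p.vec⟩ : Tot E.fiber)) h
  exact h'.trans (congrArg _ (E.ev_star τ (τ.incl a) x t))

theorem isotypic_isIsotypic (E : GVect.{u, v} G X) :
    (E.isotypic τ).IsIsotypic τ.incl τ := by
  intro x
  refine ⟨ev_injective _ _ _ _, fun t => ?_⟩
  change E.IsoFiber A.subtype τ x at t
  induction t using TensorProduct.induction_on with
  | zero => exact ⟨0, map_zero _⟩
  | add s t hs ht =>
    obtain ⟨s', hs'⟩ := hs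
    obtain ⟨t', ht'⟩ := ht
    exact ⟨s' + t', (map_add _ _ _).trans (congrArg₂ _ hs' ht')⟩
  | tmul v f =>
    let k : τ.V →ₗ[ℂ] E.IsoFiber A.subtype τ x := (TensorProduct.mk ℂ _ _).flip f
    let g : τ.ρ.IntertwiningMap ((E.isotypic τ).fiberRep τ.incl x) := ⟨k, fun a => by
      ext w
      apply E.ev_injective A.subtype τ x
      refine Eq.trans ?_ (E.ev_fiberRep_isotypic τ x a (w ⊗ₜ f)).symm
      exact f.isIntertwining _ _ a w⟩
    exact ⟨v ⊗ₜ g, rfl⟩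

end Isotypic

end GVect

instance {G : Type*} [Group G] (S : Subgroup G) {X : Type*} [TopologicalSpace X] [MulAction G X]
    [ContinuousConstSMul G X] : ContinuousConstSMul S X :=
  ⟨fun s => continuous_const_smul (s : G)⟩

namespace GVect

/-! ### Functoriality of the isotypic parts -/

section

variable {A : Type*} {H : Type*} [Group A] [Group H] (i : A →* H) {X : Type u} {Y : Type u'}
  [TopologicalSpace X] [MulAction H X] [ActsTrivially i X]
  [TopologicalSpace Y] [MulAction H Y] [ActsTrivially i Y] (τ : IrrRep.{v} A)

theorem fiberRep_sum (E F : GVect.{u, v} H X) (x : X) (a : A) (v : E.fiber x × F.fiber x) :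
    (E.sum F).fiberRep i x a v = (E.fiberRep i x a v.1, F.fiberRep i x a v.2) :=
  cast_prod (E := E.toVB) (F := F.toVB) _ _

theorem fiberRep_inl (E F : GVect.{u, v} H X) (x : X) (a : A) (v : E.fiber x) :
    (LinearMap.inl ℂ (E.fiber x) (F.fiber x) (E.fiberRep i x a v) : (E.sum F).fiber x) =
      (E.sum F).fiberRep i x a (LinearMap.inl ℂ (E.fiber x) (F.fiber x) v) :=
  Eq.trans (b := (E.fiberRep i x a v, F.fiberRep i x a 0))
    (congrArg (Prod.mk _) (map_zero (F.fiberRep i x a)).symm)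
    (fiberRep_sum i E F x a (LinearMap.inl ℂ (E.fiber x) (F.fiber x) v)).symm

theorem fiberRep_inr (E F : GVect.{u, v} H X) (x : X) (a : A) (v : F.fiber x) :
    (LinearMap.inr ℂ (E.fiber x) (F.fiber x) (F.fiberRep i x a v) : (E.sum F).fiber x) =
      (E.sum F).fiberRep i x a (LinearMap.inr ℂ (E.fiber x) (F.fiber x) v) :=
  Eq.trans (b := (E.fiberRep i x a 0, F.fiberRep i x a v))
    (congrArg (fun z => (z, F.fiberRep i x a v)) (map_zero (E.fiberRep i x a)).symm)
    (fiberRep_sum i E F x a (LinearMap.inr ℂ (E.fiber x) (F.fiber x) v)).symm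

theorem fiberRep_pullback (E : GVect.{u, v} H X) (f : GMap H Y X) [ContinuousConstSMul H Y]
    (y : Y) (a : A) (v : E.fiber (f.toFun y)) :
    (E.pullback f).fiberRep i y a v = E.fiberRep i (f.toFun y) a v := by
  apply Tot.mk_inj (F := E.fiber)
  rw [mk_fiberRep]
  have h := (E.pullback f).mk_fiberRep i y a v
  have h' := congrArg (fun p : Tot (E.pullback f).fiber =>
    (⟨f.toFun p.base, p.vec⟩ : Tot E.fiber)) h
  exact h'.trans (E.mk_cast _ _)

theorem Iso.map_fiberRep {E F : GVect.{u, v} H X} (e : Iso E F) (x : X) (a : A) (v : E.fiber x) :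
    e.toEquiv x (E.fiberRep i x a v) = F.fiberRep i x a (e.toEquiv x v) :=
  (e.apply_cast _ _).trans (congrArg _ (e.map_act (i a) x v))

theorem IsIsotypic.sum [Finite A] {E F : GVect.{u, v} H X} (hE : E.IsIsotypic i τ)
    (hF : F.IsIsotypic i τ) : (E.sum F).IsIsotypic i τ := by
  intro x
  refine ⟨ev_injective _ _ _ _, ?_⟩
  rintro ⟨e, f⟩
  obtain ⟨s, rfl⟩ := (hE x).2 e
  obtain ⟨t, rfl⟩ := (hF x).2 f
  have h1 := ev_isoMap i τ i (E := E) (F := E.sum F) (x := x) (y := x)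
    (LinearMap.inl ℂ (E.fiber x) (F.fiber x)) (fiberRep_inl i E F x) s
  have h2 := ev_isoMap i τ i (E := F) (F := E.sum F) (x := x) (y := x)
    (LinearMap.inr ℂ (E.fiber x) (F.fiber x)) (fiberRep_inr i E F x) t
  refine ⟨_ + _, (map_add _ _ _).trans ((congrArg₂ _ h1 h2).trans ?_)⟩
  exact Prod.ext (add_zero _) (zero_add _)

theorem IsIsotypic.zero [Finite A] [ContinuousConstSMul H X] :
    (GVect.zero.{u, v} H X).IsIsotypic i τ :=
  fun _ => ⟨ev_injective _ _ _ _, fun _ => ⟨0, rfl⟩⟩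

theorem IsIsotypic.pullback [Finite A] {E : GVect.{u, v} H X} (hE : E.IsIsotypic i τ)
    (f : GMap H Y X) [ContinuousConstSMul H Y] : (E.pullback f).IsIsotypic i τ := by
  intro y
  refine ⟨ev_injective _ _ _ _, fun e => ?_⟩
  obtain ⟨s, hs⟩ := (hE (f.toFun y)).2 e
  have h1 := ev_isoMap i τ i (E := E) (F := E.pullback f) (x := f.toFun y) (y := y)
    LinearMap.id (fun a v => (E.fiberRep_pullback i f y a v).symm) s
  exact ⟨_, h1.trans hs⟩

end

section

variable {G : Type w} [Group G] [Finite G] {A : Subgroup G} [A.Normal] (τ : IrrRep.{v} A)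
  {X : Type u} {Y : Type u'}
  [TopologicalSpace X] [MulAction G X] [ActsTrivially A.subtype X]
  [TopologicalSpace Y] [MulAction G Y] [ActsTrivially A.subtype Y]

/-- A `G`-map is an `S`-map for every subgroup `S`. -/
def _root_.EqK.GMap.restrict (f : GMap G Y X) (S : Subgroup G) : GMap S Y X :=
  ⟨f.toFun, f.continuous_toFun, fun s y => f.map_smul s y⟩

noncomputable def isotypicCongr {E F : GVect.{u, v} G X} (e : Iso E F) :
    Iso (E.isotypic τ) (F.isotypic τ) :=
  let φ : ∀ x, E.IsoFiber A.subtype τ x →ₗ[ℂ] F.IsoFiber A.subtype τ x := fun x =>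
    isoMap A.subtype τ A.subtype (e.toEquiv x).toLinearMap (e.map_fiberRep A.subtype x)
  let ψ : ∀ x, F.IsoFiber A.subtype τ x →ₗ[ℂ] E.IsoFiber A.subtype τ x := fun x =>
    isoMap A.subtype τ A.subtype (e.symm.toEquiv x).toLinearMap (e.symm.map_fiberRep A.subtype x)
  have hφ : ∀ x t, F.ev A.subtype τ x (φ x t) = e.toEquiv x (E.ev A.subtype τ x t) :=
    fun x t => ev_isoMap _ _ _ _ _ t
  have hψ : ∀ x t, E.ev A.subtype τ x (ψ x t) = (e.toEquiv x).symm (F.ev A.subtype τ x t) :=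
    fun x t => ev_isoMap _ _ _ _ _ t
  { toEquiv := fun x => LinearEquiv.ofLinearMap (φ x) (ψ x)
      (LinearMap.ext fun t => F.ev_injective A.subtype τ x 
        ((hφ _ _).trans ((congrArg _ (hψ _ _)).trans (LinearEquiv.apply_symm_apply _ _))))
      (LinearMap.ext fun t => E.ev_injective A.subtype τ x 
        ((hψ _ _).trans ((congrArg _ (hφ _ _)).trans (LinearEquiv.symm_apply_apply _ _))))
    continuous_toFun := (F.isoVB_isInducing A.subtype τ).continuous_iff.2
      ((e.continuous_toFun.comp (E.isoVB_isInducing A.subtype τ).continuous).congr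
        fun p => congrArg _ (hφ _ _).symm)
    continuous_invFun := (E.isoVB_isInducing A.subtype τ).continuous_iff.2
      ((e.continuous_invFun.comp (F.isoVB_isInducing A.subtype τ).continuous).congr
        fun p => congrArg _ (hψ _ _).symm)
    map_act := fun h x t => F.ev_injective A.subtype τ _ (by
      refine (hφ _ _).trans ((congrArg _ (E.ev_star τ h x t)).trans ?_)
      refine (e.map_act (h : G) x _).trans ?_
      exact ((F.ev_star τ h x _).trans (congrArg _ (hφ x t))).symm) }

noncomputable def isotypicSum (E F : GVect.{u, v} G X) :
    Iso ((E.sum F).isotypic τ) ((E.isotypic τ).sum (F.isotypic τ)) :=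
  let p₁ : ∀ x, (E.sum F).IsoFiber A.subtype τ x →ₗ[ℂ] E.IsoFiber A.subtype τ x := fun x =>
    isoMap A.subtype τ A.subtype (LinearMap.fst ℂ (E.fiber x) (F.fiber x))
      (fun a v => congrArg Prod.fst (fiberRep_sum A.subtype E F x a v))
  let p₂ : ∀ x, (E.sum F).IsoFiber A.subtype τ x →ₗ[ℂ] F.IsoFiber A.subtype τ x := fun x =>
    isoMap A.subtype τ A.subtype (LinearMap.snd ℂ (E.fiber x) (F.fiber x))
      (fun a v => congrArg Prod.snd (fiberRep_sum A.subtype E F x a v))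
  let i₁ : ∀ x, E.IsoFiber A.subtype τ x →ₗ[ℂ] (E.sum F).IsoFiber A.subtype τ x := fun x =>
    isoMap A.subtype τ A.subtype (LinearMap.inl ℂ (E.fiber x) (F.fiber x)) 
      (fiberRep_inl A.subtype E F x)
  let i₂ : ∀ x, F.IsoFiber A.subtype τ x →ₗ[ℂ] (E.sum F).IsoFiber A.subtype τ x := fun x =>
    isoMap A.subtype τ A.subtype (LinearMap.inr ℂ (E.fiber x) (F.fiber x)) 
      (fiberRep_inr A.subtype E F x)
  have hp₁ : ∀ x t, E.ev A.subtype τ x (p₁ x t) = ((E.sum F).ev A.subtype τ x t).1 :=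
    fun x t => ev_isoMap _ _ _ _ _ t
  have hp₂ : ∀ x t, F.ev A.subtype τ x (p₂ x t) = ((E.sum F).ev A.subtype τ x t).2 :=
    fun x t => ev_isoMap _ _ _ _ _ t
  have hi₁ : ∀ x t, (E.sum F).ev A.subtype τ x (i₁ x t) = (E.ev A.subtype τ x t, 0) :=
    fun x t => ev_isoMap _ _ _ _ _ t
  have hi₂ : ∀ x t, (E.sum F).ev A.subtype τ x (i₂ x t) = (0, F.ev A.subtype τ x t) :=
    fun x t => ev_isoMap _ _ _ _ _ t
  have hφ : ∀ x s t, (E.sum F).ev A.subtype τ x (i₁ x s + i₂ x t) =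
      (E.ev A.subtype τ x s, F.ev A.subtype τ x t) := fun x s t => by
    refine (map_add _ _ _).trans ((congrArg₂ _ (hi₁ x s) (hi₂ x t)).trans ?_)
    exact Prod.ext (add_zero _) (zero_add _)
  { toEquiv := fun x => LinearEquiv.ofLinearMap ((p₁ x).prod (p₂ x)) ((i₁ x).coprod (i₂ x))
      (LinearMap.ext fun t => Prod.ext
        (E.ev_injective A.subtype τ x ((hp₁ _ _).trans (congrArg Prod.fst (hφ x t.1 t.2))))
        (F.ev_injective A.subtype τ x ((hp₂ _ _).trans (congrArg Prod.snd (hφ x t.1 t.2)))))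
      (LinearMap.ext fun t => (E.sum F).ev_injective A.subtype τ x
        ((hφ x _ _).trans (Prod.ext (hp₁ x t) (hp₂ x t))))
    continuous_toFun := by
      have h1 := ((E.sum F).isoVB_isInducing A.subtype τ).continuous
      have h2 := (VB.prod_isInducing E.toVB F.toVB).continuous.comp h1
      refine (VB.prod_isInducing (E.isotypic τ).toVB (F.isotypic τ).toVB).continuous_iff.2 ?_
      refine Continuous.prodMk ?_ ?_
      · exact (E.isoVB_isInducing A.subtype τ).continuous_iff.2
          ((continuous_fst.comp h2).congr fun p => congrArg _ (hp₁ _ _).symm)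
      · exact (F.isoVB_isInducing A.subtype τ).continuous_iff.2
          ((continuous_snd.comp h2).congr fun p => congrArg _ (hp₂ _ _).symm)
    continuous_invFun := by
      have h1 := (VB.prod_isInducing (E.isotypic τ).toVB (F.isotypic τ).toVB).continuous
      have h2 := (E.isoVB_isInducing A.subtype τ).continuous.comp (continuous_fst.comp h1)
      have h3 := (F.isoVB_isInducing A.subtype τ).continuous.comp (continuous_snd.comp h1)
      refine ((E.sum F).isoVB_isInducing A.subtype τ).continuous_iff.2 ?_
      refine (VB.prod_isInducing E.toVB F.toVB).continuous_iff.2 ?_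
      refine (h2.prodMk h3).congr fun p => ?_
      exact congrArg (fun z : E.fiber p.base × F.fiber p.base =>
        ((⟨p.base, z.1⟩, ⟨p.base, z.2⟩) : Tot E.fiber × Tot F.fiber)) (hφ _ _ _).symm
    map_act := fun h x t => by
      have key := (E.sum F).ev_star τ h x t
      refine Prod.ext (E.ev_injective A.subtype τ _ ?_) (F.ev_injective A.subtype τ _ ?_)
      · refine (hp₁ _ _).trans ((congrArg Prod.fst key).trans ?_)
        exact ((E.ev_star τ h x _).trans (congrArg _ (hp₁ x t))).symm
      · refine (hp₂ _ _).trans ((congrArg Prod.snd key).trans ?_)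
        exact ((F.ev_star τ h x _).trans (congrArg _ (hp₂ x t))).symm }

noncomputable def isotypicZero [ContinuousConstSMul G X] :
    Iso ((GVect.zero.{u, v} G X).isotypic τ) (GVect.zero.{u, v} τ.stab X) :=
  have key : ∀ (x : X) (s t : (GVect.zero.{u, v} G X).IsoFiber A.subtype τ x), s = t :=
    fun x _ _ => ev_injective A.subtype τ (GVect.zero.{u, v} G X) x rfl
  { toEquiv := fun x => LinearEquiv.ofLinearMap (0 : _ →ₗ[ℂ] PUnit.{v + 1}) 0
      (LinearMap.ext fun _ => rfl) (LinearMap.ext fun _ => key x _ _)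
    continuous_toFun := continuous_induced_rng.2
      ((GVect.zero.{u, v} G X).isotypic τ).continuous_base
    continuous_invFun := (isoVB_isInducing A.subtype τ (GVect.zero.{u, v} G X)).continuous_iff.2
      (continuous_induced_rng.2 (GVect.zero.{u, v} τ.stab X).continuous_base)
    map_act := fun _ _ _ => rfl }

noncomputable def isotypicPullback (E : GVect.{u, v} G X) (f : GMap G Y X)
    [ContinuousConstSMul G Y] :
    Iso ((E.pullback f).isotypic τ) ((E.isotypic τ).pullback (f.restrict τ.stab)) :=
  let φ : ∀ y, (E.pullback f).IsoFiber A.subtype τ y →ₗ[ℂ]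
      E.IsoFiber A.subtype τ (f.toFun y) := fun y =>
    isoMap (E := E.pullback f) (F := E) A.subtype τ A.subtype
      (LinearMap.id : E.fiber (f.toFun y) →ₗ[ℂ] E.fiber (f.toFun y))
      (fun a v => E.fiberRep_pullback A.subtype f y a v)
  let ψ : ∀ y, E.IsoFiber A.subtype τ (f.toFun y) →ₗ[ℂ]
      (E.pullback f).IsoFiber A.subtype τ y := fun y =>
    isoMap (E := E) (F := E.pullback f) A.subtype τ A.subtype
      (LinearMap.id : E.fiber (f.toFun y) →ₗ[ℂ] E.fiber (f.toFun y))
      (fun a v => (E.fiberRep_pullback A.subtype f y a v).symm)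
  have hφ : ∀ y t, E.ev A.subtype τ _ (φ y t) = (E.pullback f).ev A.subtype τ y t :=
    fun x t => ev_isoMap (E := E.pullback f) (F := E) _ _ _ _ _ t
  have hψ : ∀ y t, (E.pullback f).ev A.subtype τ y (ψ y t) = E.ev A.subtype τ _ t :=
    fun x t => ev_isoMap (E := E) (F := E.pullback f) _ _ _ _ _ t
  { toEquiv := fun y => LinearEquiv.ofLinearMap (φ y) (ψ y)
      (LinearMap.ext fun t => E.ev_injective A.subtype τ _ ((hφ _ _).trans (hψ _ _)))
      (LinearMap.ext fun t => (E.pullback f).ev_injective A.subtype τ _ ((hψ _ _).trans (hφ _ _)))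
    continuous_toFun := by
      have h1 := ((E.pullback f).isoVB_isInducing A.subtype τ).continuous
      have h2 := (VB.pullback_isInducing E.toVB f.toFun f.continuous_toFun).continuous.comp h1
      refine (VB.pullback_isInducing (E.isotypic τ).toVB f.toFun
        f.continuous_toFun).continuous_iff.2 ?_
      refine (continuous_fst.comp h2).prodMk ?_
      exact (E.isoVB_isInducing A.subtype τ).continuous_iff.2
        ((continuous_snd.comp h2).congr fun p => congrArg (fun z : E.fiber (f.toFun p.base) =>
          (⟨f.toFun p.base, z⟩ : Tot E.fiber)) (hφ _ _).symm)
    continuous_invFun := by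
      have h1 := (VB.pullback_isInducing (E.isotypic τ).toVB f.toFun f.continuous_toFun).continuous
      have h2 := (E.isoVB_isInducing A.subtype τ).continuous.comp (continuous_snd.comp h1)
      refine ((E.pullback f).isoVB_isInducing A.subtype τ).continuous_iff.2 ?_
      refine (VB.pullback_isInducing E.toVB f.toFun f.continuous_toFun).continuous_iff.2 ?_
      refine (continuous_fst.comp h1).prodMk (h2.congr fun p => ?_)
      exact congrArg (fun z : E.fiber (f.toFun p.base) =>
          (⟨f.toFun p.base, z⟩ : Tot E.fiber)) (hψ _ _).symm
    map_act := fun h y t => by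
      refine E.ev_injective A.subtype τ _ (Tot.mk_inj (F := E.fiber) ?_)
      refine (congrArg (fun z : E.fiber (f.toFun ((h : G) • y)) =>
          (⟨f.toFun ((h : G) • y), z⟩ : Tot E.fiber))
        ((hφ _ _).trans ((E.pullback f).ev_star τ h y t))).trans ?_
      refine (E.mk_cast _ _).trans ?_
      have h1 := congrArg (fun p : Tot (E.isotypic τ).fiber =>
        (⟨p.base, E.ev A.subtype τ p.base p.vec⟩ : Tot E.fiber))
        ((E.isotypic τ).mk_cast (f.map_smul (h : G) y).symm (E.star τ h _ (φ y t)))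
      refine Eq.trans ?_ h1.symm
      refine congrArg (fun z => (⟨_, z⟩ : Tot E.fiber)) ?_
      exact ((E.ev_star τ h _ _).trans (congrArg _ (hφ y t))).symm }

end

/-! ### Induction -/

section Ind

variable {G : Type v} [Group G] [Finite G] {S : Subgroup G} {X : Type u} {Y : Type u'}
  [TopologicalSpace X] [MulAction G X] [ContinuousConstSMul G X]
  [TopologicalSpace Y] [MulAction G Y] [ContinuousConstSMul G Y]

/-- For a coset `q = g_l S` with chosen representative `g_l`, and `g ∈ G`, let `g_j` be the chosen
representative of `g⁻¹ q`; this is the element `s = g_l⁻¹ g g_j` of `S`, so that `g g_j = g_l s`. -/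
noncomputable def cosetElt {G : Type v} [Group G] (S : Subgroup G) (g : G) (q : G ⧸ S) : S :=
  ⟨q.out⁻¹ * g * (g⁻¹ • q).out, by
    rw [mul_assoc, ← QuotientGroup.eq, QuotientGroup.out_eq']
    have h : ((g * (g⁻¹ • q).out : G) : G ⧸ S) = g • (((g⁻¹ • q).out : G) : G ⧸ S) := rfl
    rw [h, QuotientGroup.out_eq', smul_inv_smul]⟩

theorem cosetElt_smul {G : Type v} [Group G] {S : Subgroup G} {X : Type u} [MulAction G X]
    (g : G) (q : G ⧸ S) (x : X) :
    cosetElt S g q • ((g⁻¹ • q).out⁻¹ • x) = q.out⁻¹ • g • x := by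
  change (q.out⁻¹ * g * (g⁻¹ • q).out) • ((g⁻¹ • q).out⁻¹ • x) = _
  simp only [mul_smul, smul_inv_smul]

/-- The vector bundle underlying the induced bundle: `⊕_j (g_j⁻¹)^* F`, the sum being over the
cosets `g_j S` in `G / S` with chosen representatives `g_j`. -/
noncomputable def indVB (F : GVect.{u, v} S X) : VB.{u, v} X :=
  VB.pi fun q : G ⧸ S => F.toVB.pullback (fun x => q.out⁻¹ • x) (continuous_const_smul _)

/-- The component in `F` at the coset `q` of an element of the induced bundle. -/
noncomputable def indComp (F : GVect.{u, v} S X) (q : G ⧸ S) (p : Tot F.indVB.fiber) :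
    Tot F.fiber := ⟨q.out⁻¹ • p.base, p.vec q⟩

theorem ind_ext {F : GVect.{u, v} S X} {p p' : Tot F.indVB.fiber} (hb : p.base = p'.base)
    (h : ∀ q, F.indComp q p = F.indComp q p') : p = p' :=
  VB.pi_ext hb fun q => VB.pullback_ext hb (h q)

theorem ind_continuous_iff {F : GVect.{u, v} S X} {Z : Type*} [TopologicalSpace Z]
    {f : Z → Tot F.indVB.fiber} : Continuous f ↔
      Continuous (fun z => (f z).base) ∧ ∀ q, Continuous fun z => F.indComp q (f z) := by
  have hj := VB.pi_isInducing
    fun q : G ⧸ S => F.toVB.pullback (fun x => q.out⁻¹ • x) (continuous_const_smul _)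
  have hk := fun q : G ⧸ S =>
    VB.pullback_isInducing F.toVB (fun x => q.out⁻¹ • x) (continuous_const_smul _)
  constructor
  · intro h
    have h' := hj.continuous.comp h
    exact ⟨continuous_fst.comp h', fun q => continuous_snd.comp ((hk q).continuous.comp
      ((continuous_apply q).comp (continuous_snd.comp h')))⟩
  · rintro ⟨h1, h2⟩
    refine hj.continuous_iff.2 (h1.prodMk (continuous_pi fun q => ?_))
    exact (hk q).continuous_iff.2 (h1.prodMk (h2 q))

theorem continuous_indComp (F : GVect.{u, v} S X) (q : G ⧸ S) : Continuous (F.indComp q) :=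
  (ind_continuous_iff.1 continuous_id).2 q

/-- The action of `g` on `⊕_j (g_j⁻¹)^* F`: the component `(x, f)` at `j` is sent to `(g x, s f)`
at `l`, where `g g_j = g_l s` with `s ∈ S`. -/
noncomputable def indAct (F : GVect.{u, v} S X) (g : G) (x : X) :
    F.indVB.fiber x →ₗ[ℂ] F.indVB.fiber (g • x) :=
  (LinearMap.pi fun q : G ⧸ S =>
    (F.cast (cosetElt_smul g q x)).toLinearMap ∘ₗ
      F.act (cosetElt S g q) ((g⁻¹ • q).out⁻¹ • x) ∘ₗ
        (LinearMap.proj (g⁻¹ • q) :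
          (∀ q : G ⧸ S, F.fiber (q.out⁻¹ • x)) →ₗ[ℂ] F.fiber ((g⁻¹ • q).out⁻¹ • x)) :
    (∀ q : G ⧸ S, F.fiber (q.out⁻¹ • x)) →ₗ[ℂ] (∀ q : G ⧸ S, F.fiber (q.out⁻¹ • g • x)))

theorem indComp_act (F : GVect.{u, v} S X) (g : G) (q : G ⧸ S) (p : Tot F.indVB.fiber) :
    F.indComp q ⟨g • p.base, F.indAct g p.base p.vec⟩ =
      F.tact (cosetElt S g q) (F.indComp (g⁻¹ • q) p) := F.mk_cast _ _

theorem tact_indComp_congr (F : GVect.{u, v} S X) {s s' : S} {q q' : G ⧸ S} (hq : q = q')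
    (hs : s = s') (p : Tot F.indVB.fiber) :
    F.tact s (F.indComp q p) = F.tact s' (F.indComp q' p) := by
  subst hq; subst hs; rfl

/-- The `G`-vector bundle induced from an `S`-vector bundle over a `G`-space. -/
noncomputable def ind (F : GVect.{u, v} S X) : GVect.{u, v} G X where
  toVB := F.indVB
  act g x := F.indAct g x
  act_one x v := by
    refine ind_ext (one_smul G x) fun q => ?_
    refine (F.indComp_act 1 q ⟨x, v⟩).trans ?_
    have hq : (1 : G)⁻¹ • q = q := by simp
    refine (F.tact_indComp_congr hq (s' := 1) ?_ _).trans (F.tact_one _)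
    apply Subtype.ext
    simp [cosetElt]
  act_mul g h x v := by
    refine ind_ext (mul_smul g h x) fun q => ?_
    refine (F.indComp_act (g * h) q ⟨x, v⟩).trans ?_
    refine Eq.trans ?_ (F.indComp_act g q ⟨h • x, F.indAct h x v⟩).symm
    rw [F.indComp_act h (g⁻¹ • q) ⟨x, v⟩, ← F.tact_mul]
    have hq : (g * h)⁻¹ • q = h⁻¹ • g⁻¹ • q := by rw [mul_inv_rev, mul_smul]
    refine F.tact_indComp_congr hq ?_ _
    apply Subtype.ext
    simp only [cosetElt, Subgroup.coe_mul, hq]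
    group
  continuous_act g := by
    refine ind_continuous_iff.2 ⟨(continuous_const_smul g).comp F.indVB.continuous_base, ?_⟩
    intro q
    exact ((F.continuous_tact _).comp (F.continuous_indComp _)).congr
      fun p => (F.indComp_act g q p).symm

theorem indAct_apply (F : GVect.{u, v} S X) (g : G) (x : X) (v : F.indVB.fiber x) (q : G ⧸ S) :
    F.indAct g x v q = F.cast (cosetElt_smul g q x)
      (F.act (cosetElt S g q) ((g⁻¹ • q).out⁻¹ • x) (v (g⁻¹ • q))) := rfl

noncomputable def indCongr {E F : GVect.{u, v} S X} (e : Iso E F) : Iso E.ind F.ind where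
  toEquiv x := LinearEquiv.piCongrRight fun q : G ⧸ S => e.toEquiv (q.out⁻¹ • x)
  continuous_toFun := ind_continuous_iff.2 ⟨E.indVB.continuous_base, fun q =>
    e.continuous_toFun.comp (E.continuous_indComp q)⟩
  continuous_invFun := ind_continuous_iff.2 ⟨F.indVB.continuous_base, fun q =>
    e.continuous_invFun.comp (F.continuous_indComp q)⟩
  map_act _ _ _ := funext fun _ =>
    (e.apply_cast _ _).trans (congrArg _ (e.map_act _ _ _))

noncomputable def indSum (E F : GVect.{u, v} S X) : Iso (E.sum F).ind (E.ind.sum F.ind) where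
  toEquiv x :=
    { toFun := fun v : (∀ q : G ⧸ S, E.fiber (q.out⁻¹ • x) × F.fiber (q.out⁻¹ • x)) =>
        ((fun q => (v q).1, fun q => (v q).2) :
          (∀ q : G ⧸ S, E.fiber (q.out⁻¹ • x)) × (∀ q : G ⧸ S, F.fiber (q.out⁻¹ • x)))
      invFun := fun v : (∀ q : G ⧸ S, E.fiber (q.out⁻¹ • x)) ×
          (∀ q : G ⧸ S, F.fiber (q.out⁻¹ • x)) => fun q => (v.1 q, v.2 q)
      left_inv := fun _ => rfl
      right_inv := fun _ => rfl
      map_add' := fun _ _ => rfl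
      map_smul' := fun _ _ => rfl }
  continuous_toFun := by
    refine (VB.prod_isInducing E.indVB F.indVB).continuous_iff.2 (Continuous.prodMk ?_ ?_)
    · exact ind_continuous_iff.2 ⟨(E.sum F).indVB.continuous_base, fun q =>
        continuous_fst.comp ((VB.prod_isInducing E.toVB F.toVB).continuous.comp
          ((E.sum F).continuous_indComp q))⟩
    · exact ind_continuous_iff.2 ⟨(E.sum F).indVB.continuous_base, fun q =>
        continuous_snd.comp ((VB.prod_isInducing E.toVB F.toVB).continuous.comp
          ((E.sum F).continuous_indComp q))⟩
  continuous_invFun := by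
    have h := (VB.prod_isInducing E.indVB F.indVB).continuous
    refine ind_continuous_iff.2 ⟨(E.ind.sum F.ind).continuous_base, fun q => ?_⟩
    refine (VB.prod_isInducing E.toVB F.toVB).continuous_iff.2 (Continuous.prodMk ?_ ?_)
    · exact (E.continuous_indComp q).comp (continuous_fst.comp h)
    · exact (F.continuous_indComp q).comp (continuous_snd.comp h)
  map_act g x v := Prod.ext
    (funext fun q => congrArg Prod.fst (cast_prod (E := E.toVB) (F := F.toVB) _ _))
    (funext fun q => congrArg Prod.snd (cast_prod (E := E.toVB) (F := F.toVB) _ _))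

noncomputable def indZero (S : Subgroup G) (X : Type u) [TopologicalSpace X] [MulAction G X]
    [ContinuousConstSMul G X] : Iso (GVect.zero.{u, v} S X).ind (GVect.zero.{u, v} G X) where
  toEquiv _ := LinearEquiv.ofLinearMap
    (0 : (∀ _ : G ⧸ S, PUnit.{v + 1}) →ₗ[ℂ] PUnit.{v + 1}) 0
    (LinearMap.ext fun _ => rfl) (LinearMap.ext fun _ => rfl)
  continuous_toFun := continuous_induced_rng.2 (GVect.zero.{u, v} S X).indVB.continuous_base
  continuous_invFun := ind_continuous_iff.2 ⟨(GVect.zero.{u, v} G X).continuous_base, fun q =>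
    continuous_induced_rng.2
      ((continuous_const_smul q.out⁻¹).comp (GVect.zero.{u, v} G X).continuous_base)⟩
  map_act _ _ _ := rfl

noncomputable def indPullback (F : GVect.{u, v} S X) (f : GMap G Y X) :
    Iso (F.pullback (f.restrict S)).ind (F.ind.pullback f) where
  toEquiv y := LinearEquiv.piCongrRight fun q : G ⧸ S => F.cast (f.map_smul q.out⁻¹ y)
  continuous_toFun := by
    have hb := (F.pullback (f.restrict S)).indVB.continuous_base
    refine (VB.pullback_isInducing F.indVB f.toFun f.continuous_toFun).continuous_iff.2 ?_
    refine hb.prodMk (ind_continuous_iff.2 ⟨f.continuous_toFun.comp hb, fun q => ?_⟩)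
    refine ((continuous_snd.comp (VB.pullback_isInducing F.toVB f.toFun
      f.continuous_toFun).continuous).comp
        ((F.pullback (f.restrict S)).continuous_indComp q)).congr fun p => ?_
    exact (F.mk_cast _ _).symm
  continuous_invFun := by
    have hj := (VB.pullback_isInducing F.indVB f.toFun f.continuous_toFun).continuous
    have hb : Continuous (Tot.base : Tot (F.ind.pullback f).fiber → Y) :=
      (F.ind.pullback f).continuous_base
    refine ind_continuous_iff.2 ⟨hb, fun q => ?_⟩
    refine (VB.pullback_isInducing F.toVB f.toFun f.continuous_toFun).continuous_iff.2 ?_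
    refine ((continuous_const_smul q.out⁻¹).comp hb).prodMk ?_
    refine ((F.continuous_indComp q).comp (continuous_snd.comp hj)).congr fun p => ?_
    exact (F.mk_cast_symm (f.map_smul q.out⁻¹ p.base) _).symm
  map_act g y v := by
    refine Tot.mk_inj (F := F.indVB.fiber) (ind_ext rfl fun q => ?_)
    refine (F.mk_cast _ _).trans ?_
    have h1 := congrArg (fun p : Tot (F.pullback (f.restrict S)).fiber =>
      (⟨f.toFun p.base, p.vec⟩ : Tot F.fiber))
      ((F.pullback (f.restrict S)).indComp_act g q ⟨y, v⟩)
    refine h1.trans ((F.mk_cast _ _).trans ?_)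
    refine Eq.trans ?_ (congrArg (F.indComp q) (F.ind.mk_cast (f.map_smul g y).symm _)).symm
    refine Eq.trans ?_ (F.indComp_act g q ⟨f.toFun y, _⟩).symm
    exact congrArg (F.tact (cosetElt S g q))
      (F.mk_cast (f.map_smul (g⁻¹ • q).out⁻¹ y) (v (g⁻¹ • q))).symm

end Ind

end GVect

/-! ### Suspensions -/

section Susp

/-- The points of `I^n × X_+` collapsed to the base point in `Σ^n X_+`, where `X_+ = X ⊔ {∗}`:
those of `∂I^n × X_+ ∪ I^n × {∗}`. -/
def SuspBase (n : ℕ) (X : Type u) : Set ((Fin n → unitInterval) × (X ⊕ PUnit.{1})) :=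
  {p | p.1 ∈ Cube.boundary (Fin n) ∨ p.2 = Sum.inr PUnit.unit}

def suspSetoid (n : ℕ) (X : Type u) : Setoid ((Fin n → unitInterval) × (X ⊕ PUnit.{1})) where
  r p q := p = q ∨ (p ∈ SuspBase n X ∧ q ∈ SuspBase n X)
  iseqv := by
    refine ⟨fun p => Or.inl rfl, ?_, ?_⟩
    · rintro p q (rfl | ⟨h, h'⟩)
      · exact Or.inl rfl
      · exact Or.inr ⟨h', h⟩
    · rintro p q r (rfl | ⟨h, h'⟩) (rfl | ⟨k, k'⟩)
      · exact Or.inl rfl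
      · exact Or.inr ⟨k, k'⟩
      · exact Or.inr ⟨h, h'⟩
      · exact Or.inr ⟨h, k'⟩

/-- The `n`-fold reduced suspension `Σ^n X_+ = (I^n × X_+) / (∂I^n × X_+ ∪ I^n × {∗})` of `X` with
an added base point. -/
def Susp (n : ℕ) (X : Type u) : Type u := Quotient (suspSetoid n X)

instance (n : ℕ) (X : Type u) [TopologicalSpace X] : TopologicalSpace (Susp n X) :=
  inferInstanceAs (TopologicalSpace (Quotient (suspSetoid n X)))

namespace Susp

variable {n : ℕ} {X : Type u} {Y : Type u'}

/-- The class of a point of `I^n × X_+`. -/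
def mk (p : (Fin n → unitInterval) × (X ⊕ PUnit.{1})) : Susp n X := Quotient.mk _ p

/-- The map of suspensions induced by a map of spaces. -/
def mapFun (n : ℕ) (f : X → Y) : Susp n X → Susp n Y :=
  Quotient.map (fun p => (p.1, Sum.map f id p.2)) (by
    rintro p q (rfl | ⟨h, h'⟩)
    · exact Or.inl rfl
    · refine Or.inr ⟨h.imp_right fun e => ?_, h'.imp_right fun e => ?_⟩
      · simp [e]
      · simp [e])

theorem mapFun_mk (f : X → Y) (p : (Fin n → unitInterval) × (X ⊕ PUnit.{1})) :
    mapFun n f (mk p) = mk (p.1, Sum.map f id p.2) := rfl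

theorem continuous_mapFun [TopologicalSpace X] [TopologicalSpace Y] {f : X → Y}
    (hf : Continuous f) : Continuous (mapFun n f) :=
  Continuous.quotient_map'
    (continuous_fst.prodMk ((hf.sumMap continuous_id).comp continuous_snd)) _

/-- The base point of `Σ^n X_+`. -/
def pt (n : ℕ) (X : Type u) : Susp n X := mk (fun _ => 0, Sum.inr PUnit.unit)

theorem mapFun_pt (f : X → Y) : mapFun n f (pt n X) = pt n Y := rfl

/-- The group acts on `Σ^n X_+` through its action on `X`. -/
instance (priority := 100) {H : Type w} [Group H] [MulAction H X] : MulAction H (Susp n X) where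
  smul h := mapFun n (h • ·)
  one_smul := by
    rintro ⟨t, x | x⟩
    · exact congrArg (fun y => mk (t, Sum.inl y)) (one_smul H x)
    · rfl
  mul_smul := by
    rintro g h ⟨t, x | x⟩
    · exact congrArg (fun y => mk (t, Sum.inl y)) (mul_smul g h x)
    · rfl

instance (priority := 100) {H : Type w} [Group H] [TopologicalSpace X] [MulAction H X]
    [ContinuousConstSMul H X] : ContinuousConstSMul H (Susp n X) :=
  ⟨fun h => continuous_mapFun (continuous_const_smul h)⟩

instance (priority := 100) {A : Type*} {H : Type w} [Group A] [Group H] (i : A →* H)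
    [MulAction H X] [hX : ActsTrivially i X] : ActsTrivially i (Susp n X) where
  smul_eq a := by
    rintro ⟨t, x | x⟩
    · exact congrArg (fun y => mk (t, Sum.inl y)) (hX.smul_eq a x)
    · rfl

end Susp

instance (H : Type w) [Group H] : ContinuousConstSMul H PUnit.{1} := ⟨fun _ => continuous_const⟩

instance {A : Type*} {H : Type w} [Group A] [Group H] (i : A →* H) :
    ActsTrivially i PUnit.{1} := ⟨fun _ _ => rfl⟩

namespace GMap

variable {G : Type w} [Group G] {X : Type u} {Y : Type u'} [TopologicalSpace X] [TopologicalSpace Y]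
  [MulAction G X] [MulAction G Y]

def comp {Z : Type*} [TopologicalSpace Z] [MulAction G Z] (f : GMap G Y X) (g : GMap G Z Y) :
    GMap G Z X :=
  ⟨f.toFun ∘ g.toFun, f.continuous_toFun.comp g.continuous_toFun, fun h z =>
    (congrArg f.toFun (g.map_smul h z)).trans (f.map_smul h _)⟩

/-- The map `Σ^n Y_+ → Σ^n X_+` induced by a `G`-map `Y → X`. -/
def susp (n : ℕ) (f : GMap G Y X) : GMap G (Susp n Y) (Susp n X) where
  toFun := Susp.mapFun n f.toFun
  continuous_toFun := Susp.continuous_mapFun f.continuous_toFun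
  map_smul g := by
    rintro ⟨t, y | y⟩
    · exact congrArg (fun y => Susp.mk (t, Sum.inl y)) (f.map_smul g y)
    · rfl

/-- The inclusion of the base point into `Σ^n X_+`. -/
def suspPt (G : Type w) [Group G] (n : ℕ) (X : Type u) [TopologicalSpace X] [MulAction G X] :
    GMap G PUnit.{1} (Susp n X) :=
  ⟨fun _ => Susp.pt n X, continuous_const, fun _ _ => rfl⟩

theorem susp_comp_pt (n : ℕ) (f : GMap G Y X) : (f.susp n).comp (suspPt G n Y) = suspPt G n X := rfl

end GMap

end Susp

/-! ### Equivariant K-theory -/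

section KTheory

variable (G : Type w) [Group G] (X : Type u) {Y : Type u'} [TopologicalSpace X]
  [TopologicalSpace Y] [MulAction G X] [MulAction G Y] [ContinuousConstSMul G X]
  [ContinuousConstSMul G Y]

/-- `K_G^0(X)`, the Grothendieck group of `Vec_G(X)`. -/
abbrev KG := Algebra.GrothendieckAddGroup (Vec.{u, v} G X)

variable {G X}

/-- The class `[E]` in `K_G^0(X)`. -/
noncomputable def KG.of (E : GVect.{u, v} G X) : KG.{u, v} G X :=
  Algebra.GrothendieckAddGroup.of (Vec.mk E)

/-- `f^* : K_G^0(X) → K_G^0(Y)`. -/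
noncomputable def KG.pullback (f : GMap G Y X) : KG.{u, v} G X →+ KG.{u', v} G Y :=
  grothMap (Vec.pullback f)

def GVect.pullbackComp {Z : Type*} [TopologicalSpace Z] [MulAction G Z] [ContinuousConstSMul G Z]
    (E : GVect.{u, v} G X) (f : GMap G Y X) (g : GMap G Z Y) :
    GVect.Iso ((E.pullback f).pullback g) (E.pullback (f.comp g)) where
  toEquiv z := LinearEquiv.refl ℂ (E.fiber (f.toFun (g.toFun z)))
  continuous_toFun := by
    have h1 := (VB.pullback_isInducing (E.pullback f).toVB g.toFun g.continuous_toFun).continuous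
    have h2 := (VB.pullback_isInducing E.toVB f.toFun f.continuous_toFun).continuous.comp
      (continuous_snd.comp h1)
    refine (VB.pullback_isInducing E.toVB _ (f.comp g).continuous_toFun).continuous_iff.2 ?_
    exact (continuous_fst.comp h1).prodMk (continuous_snd.comp h2)
  continuous_invFun := by
    have h1 := (VB.pullback_isInducing E.toVB _ (f.comp g).continuous_toFun).continuous
    refine (VB.pullback_isInducing (E.pullback f).toVB g.toFun
      g.continuous_toFun).continuous_iff.2 ?_
    refine (continuous_fst.comp h1).prodMk ?_
    refine (VB.pullback_isInducing E.toVB f.toFun f.continuous_toFun).continuous_iff.2 ?_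
    exact (g.continuous_toFun.comp (continuous_fst.comp h1)).prodMk (continuous_snd.comp h1)
  map_act h z v := by
    refine Tot.mk_inj (F := E.fiber) ?_
    have h1 := congrArg (fun p : Tot (E.pullback f).fiber => (⟨f.toFun p.base, p.vec⟩ : Tot E.fiber))
      ((E.pullback f).mk_cast (g.map_smul h z).symm ((E.pullback f).act h (g.toFun z) v))
    refine h1.trans ((E.mk_cast _ _).trans (E.mk_cast _ _).symm)

theorem Vec.pullback_comp {Z : Type*} [TopologicalSpace Z] [MulAction G Z]
    [ContinuousConstSMul G Z] (f : GMap G Y X) (g : GMap G Z Y) (c : Vec.{u, v} G X) :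
    Vec.pullback g (Vec.pullback f c) = Vec.pullback (f.comp g) c := by
  obtain ⟨E⟩ := c
  exact Vec.mk_eq (E.pullbackComp f g)

theorem KG.pullback_comp {Z : Type*} [TopologicalSpace Z] [MulAction G Z]
    [ContinuousConstSMul G Z] (f : GMap G Y X) (g : GMap G Z Y) (ξ : KG.{u, v} G X) :
    KG.pullback g (KG.pullback f ξ) = KG.pullback (f.comp g) ξ := by
  refine DFunLike.congr_fun (f := (KG.pullback g).comp (KG.pullback f)) (groth_ext fun c => ?_) ξ
  simp only [AddMonoidHom.comp_apply, KG.pullback, grothMap_of, Vec.pullback_comp]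

variable (G X)

/-- The reduced group of `Σ^n X_+`: the kernel of the restriction of `K_G^0(Σ^n X_+)` to the base
point. -/
noncomputable def KG.red (n : ℕ) : AddSubgroup (KG.{u, v} G (Susp n X)) :=
  (KG.pullback (GMap.suspPt G n X)).ker

/-- `K_G^n(X)`: the Grothendieck group of `Vec_G(X)` for `n = 0`, and the reduced `K_G^0` of
`Σ^n X_+` for `n > 0`. -/
def KGn : ℕ → Type (max u w (v + 1))
  | 0 => KG.{u, v} G X
  | n + 1 => KG.red.{u, v} G X (n + 1)

noncomputable instance : ∀ n, AddCommGroup (KGn.{u, v} G X n)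
  | 0 => inferInstanceAs (AddCommGroup (KG.{u, v} G X))
  | n + 1 => inferInstanceAs (AddCommGroup (KG.red.{u, v} G X (n + 1)))

variable {G X}

/-- `f^* : K_G^n(X) → K_G^n(Y)`. -/
noncomputable def KGn.pullback (f : GMap G Y X) : ∀ n, KGn.{u, v} G X n →+ KGn.{u', v} G Y n
  | 0 => KG.pullback f
  | n + 1 => ((KG.pullback (f.susp (n + 1))).comp (KG.red.{u, v} G X (n + 1)).subtype).codRestrict
      (KG.red.{u', v} G Y (n + 1)) fun ξ => by
        have h : KG.pullback (GMap.suspPt G (n + 1) X) ξ.1 = 0 := AddMonoidHom.mem_ker.1 ξ.2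
        exact AddMonoidHom.mem_ker.2 ((KG.pullback_comp _ _ _).trans h)

end KTheory

section KTau

variable {G : Type w} [Group G] [Finite G] {A : Subgroup G} [A.Normal] (τ : IrrRep.{v} A)
  (X : Type u) {Y : Type u'}
  [TopologicalSpace X] [MulAction G X] [ContinuousConstSMul G X] [ActsTrivially A.subtype X]
  [TopologicalSpace Y] [MulAction G Y] [ContinuousConstSMul G Y] [ActsTrivially A.subtype Y]

/-- The monoid `Vec_{G_[τ], τ}(X)` of isomorphism classes of `(G_[τ], τ)`-equivariant vector
bundles over `X`. -/
def VecTau : AddSubmonoid (Vec.{u, v} τ.stab X) where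
  carrier := {c | ∃ F : GVect.{u, v} τ.stab X, F.IsIsotypic τ.incl τ ∧ Vec.mk F = c}
  zero_mem' := ⟨_, GVect.IsIsotypic.zero τ.incl τ, rfl⟩
  add_mem' := by
    rintro _ _ ⟨E, hE, rfl⟩ ⟨F, hF, rfl⟩
    exact ⟨_, GVect.IsIsotypic.sum τ.incl τ hE hF, rfl⟩

/-- `K^0_{G_[τ], τ}(X)`, the Grothendieck group of `Vec_{G_[τ], τ}(X)`. -/
abbrev KTau := Algebra.GrothendieckAddGroup (VecTau.{u, v} τ X)

variable {X}

/-- The class `[F]` in `K^0_{G_[τ], τ}(X)`. -/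
noncomputable def KTau.of (F : GVect.{u, v} τ.stab X) (hF : F.IsIsotypic τ.incl τ) :
    KTau.{u, v} τ X :=
  Algebra.GrothendieckAddGroup.of (⟨Vec.mk F, F, hF, rfl⟩ : VecTau.{u, v} τ X)

/-- Pullback of classes of `(G_[τ], τ)`-equivariant bundles along a `G`-map. -/
def VecTau.pullback (f : GMap G Y X) : VecTau.{u, v} τ X →+ VecTau.{u', v} τ Y :=
  ((Vec.pullback (f.restrict τ.stab)).comp (VecTau.{u, v} τ X).subtype).codRestrict
    (VecTau.{u', v} τ Y) (by
      rintro ⟨_, F, hF, rfl⟩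
      exact ⟨_, hF.pullback τ.incl τ _, rfl⟩)

/-- `f^* : K^0_{G_[τ], τ}(X) → K^0_{G_[τ], τ}(Y)`. -/
noncomputable def KTau.pullback (f : GMap G Y X) : KTau.{u, v} τ X →+ KTau.{u', v} τ Y :=
  grothMap (VecTau.pullback τ f)

theorem KTau.pullback_comp {Z : Type*} [TopologicalSpace Z] [MulAction G Z]
    [ContinuousConstSMul G Z] [ActsTrivially A.subtype Z] (f : GMap G Y X) (g : GMap G Z Y)
    (ξ : KTau.{u, v} τ X) :
    KTau.pullback τ g (KTau.pullback τ f ξ) = KTau.pullback τ (f.comp g) ξ := by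
  refine DFunLike.congr_fun (f := (KTau.pullback τ g).comp (KTau.pullback τ f))
    (groth_ext fun c => ?_) ξ
  simp only [AddMonoidHom.comp_apply, KTau.pullback, grothMap_of]
  exact congrArg _ (Subtype.ext (Vec.pullback_comp _ _ _))

variable (X)

/-- The reduced group of `Σ^n X_+`. -/
noncomputable def KTau.red (n : ℕ) : AddSubgroup (KTau.{u, v} τ (Susp n X)) :=
  (KTau.pullback τ (GMap.suspPt G n X)).ker

/-- `K^n_{G_[τ], τ}(X)`: the Grothendieck group of `Vec_{G_[τ], τ}(X)` for `n = 0`, and the reduced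
`K^0_{G_[τ], τ}` of `Σ^n X_+` for `n > 0`. -/
def KTaun : ℕ → Type (max u w (v + 1))
  | 0 => KTau.{u, v} τ X
  | n + 1 => KTau.red.{u, v} τ X (n + 1)

noncomputable instance : ∀ n, AddCommGroup (KTaun.{u, v} τ X n)
  | 0 => inferInstanceAs (AddCommGroup (KTau.{u, v} τ X))
  | n + 1 => inferInstanceAs (AddCommGroup (KTau.red.{u, v} τ X (n + 1)))

variable {X}

/-- `f^* : K^n_{G_[τ], τ}(X) → K^n_{G_[τ], τ}(Y)`. -/
noncomputable def KTaun.pullback (f : GMap G Y X) :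
    ∀ n, KTaun.{u, v} τ X n →+ KTaun.{u', v} τ Y n
  | 0 => KTau.pullback τ f
  | n + 1 =>
    ((KTau.pullback τ (f.susp (n + 1))).comp (KTau.red.{u, v} τ X (n + 1)).subtype).codRestrict
      (KTau.red.{u', v} τ Y (n + 1)) fun ξ => by
        have h : KTau.pullback τ (GMap.suspPt G (n + 1) X) ξ.1 = 0 := AddMonoidHom.mem_ker.1 ξ.2
        exact AddMonoidHom.mem_ker.2 ((KTau.pullback_comp τ _ _ _).trans h)

/-- `[E] ↦ [V_τ ⊗ Hom_A(V_τ, E)]` on isomorphism classes of `G`-vector bundles. -/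
noncomputable def vecPsi : Vec.{u, v} G X →+ VecTau.{u, v} τ X where
  toFun := Quotient.lift
    (fun E => ⟨Vec.mk (E.isotypic τ), E.isotypic τ, E.isotypic_isIsotypic τ, rfl⟩)
    fun _ _ ⟨e⟩ => Subtype.ext (Vec.mk_eq (GVect.isotypicCongr τ e))
  map_zero' := Subtype.ext (Vec.mk_eq (GVect.isotypicZero τ))
  map_add' := by
    rintro ⟨E⟩ ⟨F⟩
    exact Subtype.ext (Vec.mk_eq (GVect.isotypicSum τ E F))

/-- The homomorphism `K_G^0(X) → K^0_{G_[τ], τ}(X)`, `[E] ↦ [V_τ ⊗ Hom_A(V_τ, E)]`. -/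
noncomputable def psi : KG.{u, v} G X →+ KTau.{u, v} τ X := grothMap (vecPsi τ)

theorem psi_of (E : GVect.{u, v} G X) :
    psi τ (KG.of E) = KTau.of τ (E.isotypic τ) (E.isotypic_isIsotypic τ) := grothMap_of _ _

theorem psi_pullback (f : GMap G Y X) (ξ : KG.{u, v} G X) :
    psi τ (KG.pullback f ξ) = KTau.pullback τ f (psi τ ξ) := by
  refine DFunLike.congr_fun (f := (psi τ).comp (KG.pullback f))
    (g := (KTau.pullback τ f).comp (psi τ)) (groth_ext fun c => ?_) ξ
  simp only [AddMonoidHom.comp_apply, KTau.pullback, KG.pullback, psi, grothMap_of]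
  obtain ⟨E⟩ := c
  exact congrArg _ (Subtype.ext (Vec.mk_eq (GVect.isotypicPullback τ E f)))

/-- The homomorphism `K_G^n(X) → K^n_{G_[τ], τ}(X)` given by `E ↦ V_τ ⊗ Hom_A(V_τ, E)`, applied to
bundles over `X` for `n = 0` and over `Σ^n X_+` for `n > 0`. -/
noncomputable def psin : ∀ n, KGn.{u, v} G X n →+ KTaun.{u, v} τ X n
  | 0 => psi τ
  | n + 1 => ((psi τ).comp (KG.red.{u, v} G X (n + 1)).subtype).codRestrict
      (KTau.red.{u, v} τ X (n + 1)) fun ξ => by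
        have h : KG.pullback (GMap.suspPt G (n + 1) X) ξ.1 = 0 := AddMonoidHom.mem_ker.1 ξ.2
        refine AddMonoidHom.mem_ker.2 ?_
        refine (psi_pullback τ (GMap.suspPt G (n + 1) X) _).symm.trans ?_
        exact (congrArg _ h).trans (map_zero _)

end KTau

section KInd

variable {G : Type v} [Group G] [Finite G] {A : Subgroup G} [A.Normal] (τ : IrrRep.{v} A)
  {X : Type u} {Y : Type u'}
  [TopologicalSpace X] [MulAction G X] [ContinuousConstSMul G X] [ActsTrivially A.subtype X]
  [TopologicalSpace Y] [MulAction G Y] [ContinuousConstSMul G Y] [ActsTrivially A.subtype Y]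

/-- `[F] ↦ [Ind F]` on isomorphism classes. -/
noncomputable def vecInd (S : Subgroup G) : Vec.{u, v} S X →+ Vec.{u, v} G X where
  toFun := Quotient.map (fun F => F.ind) fun _ _ ⟨e⟩ => ⟨GVect.indCongr e⟩
  map_zero' := Vec.mk_eq (GVect.indZero S X)
  map_add' := by rintro ⟨E⟩ ⟨F⟩; exact Vec.mk_eq (GVect.indSum E F)

/-- The homomorphism `K^0_{G_[τ], τ}(X) → K_G^0(X)`, `[F] ↦ [Ind F]`, of induction from `G_[τ]`
to `G`. -/
noncomputable def kInd : KTau.{u, v} τ X →+ KG.{u, v} G X :=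
  grothMap ((vecInd τ.stab).comp (VecTau.{u, v} τ X).subtype)

theorem kInd_of (F : GVect.{u, v} τ.stab X) (hF : F.IsIsotypic τ.incl τ) :
    kInd τ (KTau.of τ F hF) = KG.of F.ind := grothMap_of _ _

theorem kInd_pullback (f : GMap G Y X) (η : KTau.{u, v} τ X) :
    kInd τ (KTau.pullback τ f η) = KG.pullback f (kInd τ η) := by
  refine DFunLike.congr_fun (f := (kInd τ).comp (KTau.pullback τ f))
    (g := (KG.pullback f).comp (kInd τ)) (groth_ext fun c => ?_) η
  simp only [AddMonoidHom.comp_apply, KTau.pullback, KG.pullback, kInd, grothMap_of]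
  obtain ⟨_, F, hF, rfl⟩ := c
  exact congrArg _ (Vec.mk_eq (GVect.indPullback F f))

/-- Induction `K^n_{G_[τ], τ}(X) → K_G^n(X)`. -/
noncomputable def kIndn : ∀ n, KTaun.{u, v} τ X n →+ KGn.{u, v} G X n
  | 0 => kInd τ
  | n + 1 => ((kInd τ).comp (KTau.red.{u, v} τ X (n + 1)).subtype).codRestrict
      (KG.red.{u, v} G X (n + 1)) fun η => by
        have h : KTau.pullback τ (GMap.suspPt G (n + 1) X) η.1 = 0 := AddMonoidHom.mem_ker.1 η.2
        refine AddMonoidHom.mem_ker.2 ?_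
        refine (kInd_pullback τ (GMap.suspPt G (n + 1) X) _).symm.trans ?_
        exact (congrArg _ h).trans (map_zero _)

end KInd

/-! ### Spaces and orbits -/

/-- A compact Hausdorff `G`-space on which the subgroup `A` acts trivially. -/
structure TrivSpace {G : Type v} [Group G] (A : Subgroup G) : Type (max v (u + 1)) where
  carrier : Type u
  [top : TopologicalSpace carrier]
  [compact : CompactSpace carrier]
  [t2 : T2Space carrier]
  [action : MulAction G carrier]
  [cont : ContinuousConstSMul G carrier]
  [triv : ActsTrivially A.subtype carrier]

attribute [instance] TrivSpace.top TrivSpace.compact TrivSpace.t2 TrivSpace.action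
  TrivSpace.cont TrivSpace.triv

instance {G : Type v} [Group G] (A : Subgroup G) :
    CoeSort (TrivSpace.{u, v} A) (Type u) := ⟨TrivSpace.carrier⟩

/-- The set `G \ Irr(A)` of orbits. -/
abbrev IrrOrbit {G : Type v} [Group G] (A : Subgroup G) [A.Normal] :=
  MulAction.orbitRel.Quotient G (Irr.{v} A)

/-- The orbit of the class of an irreducible representation. -/
def orbitOf {G : Type v} [Group G] {A : Subgroup G} [A.Normal] (σ : IrrRep.{v} A) : IrrOrbit A :=
  Quotient.mk _ (Irr.mk σ)

end EqK

set_option linter.unusedSectionVars false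

namespace EqK

open TensorProduct Topology

/-! ### Isotypic projectors of representations -/

section Schur

variable {A : Type w} [Group A] {τ : IrrRep.{v} A} {W : Type v} [AddCommGroup W] [Module ℂ W]
  (σ : Representation ℂ A W)

-- Everything rests on the isotypic projector. For an irreducible `τ`, the projector of a
-- representation `W` of `A` onto the image of `V_τ ⊗ Hom_A(V_τ, W)` is `∑ₐ c_a a`, with
-- coefficients that depend on `τ` alone. Hence it commutes with every `A`-map, is continuous on any
-- equivariant bundle, and by Schur's lemma kills the isotypic parts of the other types
-- (`evRetr_evRep_of_ne`). With Maschke's theorem this gives the isotypic decomposition of every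
-- fibre (`bijective_toModule_evRep`), and applied to the functions on `A` it shows that `Irr(A)` is
-- finite (`finite_irr`).
--
-- Let `E` be a `G`-bundle. An element `g` carries the `τ`-part of `E` to its `gτ`-part, because `A`
-- is normal. By orbit-stabilizer the types in the orbit of `τ` are the `g_j τ`, one for each coset
-- of `G_[τ]`. The sum of the corresponding parts is therefore `⊕_j g_j (V_τ ⊗ Hom_A(V_τ, E))`,
-- which is the bundle induced from `V_τ ⊗ Hom_A(V_τ, E)`. The isotypic projectors split off these
-- sums continuously and equivariantly, and summing over orbits gives back `E`. So induction after
-- `Ψ` is the identity (`GVect.sum_vecInd_vecPsi`).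
--
-- In the other direction let `F` be `(G_[τ], τ)`-equivariant. As a representation of `A`, the
-- summand of `Ind F` at `g_j` is a fibre of `F` twisted by `g_j`, so it is purely of type `g_j τ`
-- (`fiberRep_ind_apply`). The `τ`-part of `Ind F` is then the summand of the trivial coset, which
-- is `F` again (`GVect.IsIsotypic.isotypicInd`), and the parts at representations in other orbits
-- vanish (`GVect.IsIsotypic.isotypicIndZero`). So `Ψ` after induction is the identity matrix.
--
-- Both statements hold for isomorphism classes of bundles. They pass to Grothendieck groups by
-- additivity, and to degree `n > 0` because all maps commute with restriction to the base point of
-- the suspension.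

theorem evRep_eq_zero {τ' : IrrRep.{v} A} (h : Irr.mk τ ≠ Irr.mk τ')
    (t : τ.V ⊗[ℂ] (τ.ρ.IntertwiningMap τ'.ρ)) : evRep τ τ'.ρ t = 0 := by
  -- Schur's lemma enters here: without an equivalence the space of intertwining maps between two
  -- irreducibles has a single element, which is what `Subsingleton.elim` uses below.
  have : IsEmpty (τ.ρ.Equiv τ'.ρ) := ⟨fun e => h (Quotient.sound ⟨e⟩)⟩
  induction t using TensorProduct.induction_on with
  | zero => exact map_zero _
  | add s t hs ht => rw [map_add, hs, ht, add_zero]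
  | tmul v f => rw [Subsingleton.elim f 0]; rfl

/-- An equivalence `e` moves `v ⊗ f` to `e v ⊗ f ∘ e⁻¹` without changing the value. The isotypic
part thus depends on the class only, which allows free passage between `τ` and the representative
chosen by `Quotient.out`. -/
theorem range_evRep_le {τ' : IrrRep.{v} A} (h : Irr.mk τ = Irr.mk τ') :
    LinearMap.range (evRep τ σ) ≤ LinearMap.range (evRep τ' σ) := by
  obtain ⟨e⟩ := Quotient.exact (s := IrrRep.setoid.{v} A) h
  rintro _ ⟨t, rfl⟩
  induction t using TensorProduct.induction_on with
  | zero => rw [map_zero]; exact zero_mem _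
  | add s t hs ht => rw [map_add]; exact add_mem hs ht
  | tmul v f =>
    refine ⟨e v ⊗ₜ f.comp e.symm.toIntertwiningMap, ?_⟩
    rw [evRep_tmul, evRep_tmul]
    exact congrArg f (e.symm_apply_apply v)

theorem range_evRep_congr {τ' : IrrRep.{v} A} (h : Irr.mk τ = Irr.mk τ') :
    LinearMap.range (evRep τ σ) = LinearMap.range (evRep τ' σ) :=
  le_antisymm (range_evRep_le σ h) (range_evRep_le σ h.symm)

theorem Irr.mk_out (t : Irr.{v} A) : Irr.mk (Quotient.out t) = t := Quotient.out_eq t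

end Schur

section IsoProj

variable {A : Type w} [Group A] [Finite A] (τ : IrrRep.{v} A)

/-- The coefficients are quantified before `σ`, and this is the source of the naturality of the
projector. The finset `S` is all of `A`; having it as a witness hides the choice of a `Fintype`
structure, so that later statements need only `Finite A`. -/
theorem exists_isoCoeff : ∃ (S : Finset A) (c : A → ℂ),
    ∀ {W : Type v} [AddCommGroup W] [Module ℂ W] (σ : Representation ℂ A W),
      ∃ r : W →ₗ[ℂ] τ.V ⊗[ℂ] (τ.ρ.IntertwiningMap σ),
        (∀ t, r (evRep τ σ t) = t) ∧ ∀ e, evRep τ σ (r e) = ∑ a ∈ S, c a • σ a e := by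
  have := Fintype.ofFinite A
  obtain ⟨c, hc⟩ := exists_retraction τ
  exact ⟨Finset.univ, c, hc⟩

/-- The support of the coefficients of the isotypic projector. -/
noncomputable def isoSupp : Finset A := (exists_isoCoeff τ).choose

/-- The coefficients `c_a` of the isotypic projector `∑ₐ c_a a`. -/
noncomputable def isoCoeff : A → ℂ := (exists_isoCoeff τ).choose_spec.choose

variable {W W' : Type v} [AddCommGroup W] [Module ℂ W] [AddCommGroup W'] [Module ℂ W']
  (σ : Representation ℂ A W) (σ' : Representation ℂ A W')

/-- A retraction of the evaluation `V_τ ⊗ Hom_A(V_τ, W) → W`. -/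
noncomputable def evRetr : W →ₗ[ℂ] τ.V ⊗[ℂ] (τ.ρ.IntertwiningMap σ) :=
  ((exists_isoCoeff τ).choose_spec.choose_spec σ).choose

theorem evRetr_evRep (t : τ.V ⊗[ℂ] (τ.ρ.IntertwiningMap σ)) : evRetr τ σ (evRep τ σ t) = t :=
  ((exists_isoCoeff τ).choose_spec.choose_spec σ).choose_spec.1 t

theorem evRep_evRetr (e : W) :
    evRep τ σ (evRetr τ σ e) = ∑ a ∈ isoSupp τ, isoCoeff τ a • σ a e :=
  ((exists_isoCoeff τ).choose_spec.choose_spec σ).choose_spec.2 e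

-- The same element `∑ₐ c_a a` of the group algebra acts on both sides, so every `A`-map commutes
-- with the projector.
variable {σ σ'} in
theorem evRep_evRetr_map (φ : W →ₗ[ℂ] W') (hφ : ∀ a w, φ (σ a w) = σ' a (φ w)) (e : W) :
    evRep τ σ' (evRetr τ σ' (φ e)) = φ (evRep τ σ (evRetr τ σ e)) := by
  simp only [evRep_evRetr, map_sum, map_smul, hφ]

variable {τ}

/-- Orthogonality of the projectors. By naturality along `f : V_τ' → W` it suffices to see that the
`τ`-projector of `V_τ'` is zero, which is Schur's lemma. -/
theorem evRetr_evRep_of_ne {τ' : IrrRep.{v} A} (h : Irr.mk τ ≠ Irr.mk τ')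
    (t : τ'.V ⊗[ℂ] (τ'.ρ.IntertwiningMap σ)) : evRetr τ σ (evRep τ' σ t) = 0 := by
  induction t using TensorProduct.induction_on with
  | zero => rw [map_zero, map_zero]
  | add s t hs ht => rw [map_add, map_add, hs, ht, add_zero]
  | tmul v f =>
    apply evRep_injective τ σ
    rw [evRep_tmul, map_zero]
    have := evRep_evRetr_map τ (σ := τ'.ρ) (σ' := σ) f.toLinearMap
      (fun a w => f.isIntertwining _ _ a w) v
    refine this.trans ?_
    rw [evRep_eq_zero h, map_zero]

/-- There are no nonzero maps from `V_τ` to a `τ'`-isotypic representation if `τ ≇ τ'`. -/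
theorem intertwiningMap_eq_zero {τ' : IrrRep.{v} A} (h : Irr.mk τ ≠ Irr.mk τ')
    (hσ : Function.Surjective (evRep τ' σ)) (f : τ.ρ.IntertwiningMap σ) (v : τ.V) : f v = 0 := by
  obtain ⟨t, ht⟩ := hσ (f v)
  -- The tensor `v ⊗ f` is recovered from `f v` by the retraction. But `f v` lies in the `τ'`-part,
  -- where that retraction vanishes, so `v ⊗ f = 0` and its value is zero.
  have h1 := evRetr_evRep τ σ (v ⊗ₜ f)
  rw [evRep_tmul, ← ht, evRetr_evRep_of_ne σ h] at h1
  rw [← evRep_tmul, ← h1, map_zero]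

/-- The retraction at `t` kills the parts of all other classes, while on the part of `t` it is
inverse to evaluation. Nothing nonzero can lie in both. -/
theorem iSupIndep_range_evRep :
    iSupIndep fun t : Irr.{v} A => LinearMap.range (evRep (Quotient.out t) σ) := by
  intro t
  rw [Submodule.disjoint_def]
  rintro _ ⟨s, rfl⟩ h2
  have h3 : (⨆ t' : Irr.{v} A, ⨆ _ : t' ≠ t, LinearMap.range (evRep (Quotient.out t') σ)) ≤
      LinearMap.ker (evRetr (Quotient.out t) σ) := by
    refine iSup_le fun t' => iSup_le fun ht' => ?_
    rintro _ ⟨s', rfl⟩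
    refine LinearMap.mem_ker.2 (evRetr_evRep_of_ne σ ?_ s')
    rw [Irr.mk_out, Irr.mk_out]
    exact ht'.symm
  have h4 := LinearMap.mem_ker.1 (h3 h2)
  rw [evRetr_evRep] at h4
  rw [h4, map_zero]

end IsoProj

-- Complete reducibility over `A` and finiteness of `Irr(A)`

section Semisimple

variable {A : Type w} [Group A] {W : Type v} [AddCommGroup W] [Module ℂ W]
  (σ : Representation ℂ A W)

/-- The subrepresentations of `a` form the interval below `a` in the lattice of subrepresentations
of `W`, and that interval is simple exactly when `a` is an atom. -/
theorem Subrepresentation.isIrreducible_of_isAtom (a : Subrepresentation σ) (ha : IsAtom a) :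
    a.toRepresentation.IsIrreducible := by
  let f : Subrepresentation a.toRepresentation ≃o Set.Iic a :=
    { toFun := fun s => ⟨⟨s.toSubmodule.map a.toSubmodule.subtype, by
          rintro g _ ⟨v, hv, rfl⟩
          exact ⟨_, s.apply_mem_toSubmodule g hv, rfl⟩⟩, by
          rintro _ ⟨v, hv, rfl⟩
          exact v.2⟩
      invFun := fun s => ⟨s.1.toSubmodule.comap a.toSubmodule.subtype, fun g v hv =>
        s.1.apply_mem_toSubmodule g hv⟩
      left_inv := fun s => Subrepresentation.toSubmodule_injective
        (Submodule.comap_map_eq_of_injective Subtype.val_injective _)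
      right_inv := fun s => Subtype.ext (Subrepresentation.toSubmodule_injective
        (Submodule.map_comap_subtype _ _ |>.trans (inf_eq_right.2 s.2)))
      map_rel_iff' := fun {s t} => Submodule.map_le_map_iff_of_injective
        (f := a.toSubmodule.subtype) Subtype.val_injective s.toSubmodule t.toSubmodule }
  exact f.isSimpleOrder_iff.2 (Set.isSimpleOrder_Iic_iff_isAtom.2 ha)

variable [FiniteDimensional ℂ W]

theorem exists_isAtom_le (C : Subrepresentation σ) (hC : C ≠ ⊥) : ∃ a ≤ C, IsAtom a := by
  have hw : WellFounded ((· < ·) : Subrepresentation σ → Subrepresentation σ → Prop) :=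
    Subrelation.wf (r := InvImage (· < ·) Subrepresentation.toSubmodule)
      (fun {s t} (h : s < t) => (h : s.toSubmodule < t.toSubmodule))
      (InvImage.wf _ wellFounded_lt)
  have := isAtomic_of_orderBot_wellFounded_lt hw
  obtain ⟨a, ha, hle⟩ := (eq_bot_or_exists_atom_le C).resolve_left hC
  exact ⟨a, hle, ha⟩

variable [Finite A]

/-- The sum `U` of the isotypic parts is invariant, so Maschke's theorem provides an invariant
complement. If the complement were nonzero it would contain an irreducible subrepresentation; its
inclusion is an intertwining map, so it would lie in `U` as well. -/
theorem iSup_range_evRep :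
    ⨆ t : Irr.{v} A, LinearMap.range (evRep (Quotient.out t) σ) = ⊤ := by
  let U : Subrepresentation σ := ⟨⨆ t : Irr.{v} A, LinearMap.range (evRep (Quotient.out t) σ), by
    intro g v hv
    have : (⨆ t : Irr.{v} A, LinearMap.range (evRep (Quotient.out t) σ)) ≤
        (⨆ t : Irr.{v} A, LinearMap.range (evRep (Quotient.out t) σ)).comap (σ g) := by
      refine iSup_le fun t => ?_
      rintro _ ⟨s, rfl⟩
      refine Submodule.mem_iSup_of_mem t ?_
      induction s using TensorProduct.induction_on with
      | zero => rw [map_zero, map_zero]; exact zero_mem _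
      | add s t hs ht => rw [map_add, map_add]; exact add_mem hs ht
      | tmul v f => exact ⟨(Quotient.out t).ρ g v ⊗ₜ f, f.isIntertwining _ _ g v⟩
    exact this hv⟩
  -- The hypothesis of Maschke's theorem, needed for the complement taken on the next line.
  have : NeZero (Nat.card A : ℂ) := ⟨Nat.cast_ne_zero.2 Nat.card_pos.ne'⟩
  obtain ⟨C, hC⟩ := exists_isCompl U
  by_cases h : C = ⊥
  · subst h
    exact congrArg Subrepresentation.toSubmodule (eq_top_of_isCompl_bot hC)
  · exfalso
    obtain ⟨a, hle, ha⟩ := exists_isAtom_le σ C h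
    let α : IrrRep.{v} A := ⟨a.toSubmodule, a.toRepresentation,
      Subrepresentation.isIrreducible_of_isAtom σ a ha⟩
    have haU : a ≤ U := by
      intro v hv
      have h1 : v ∈ LinearMap.range (evRep α σ) :=
        ⟨(⟨v, hv⟩ : a.toSubmodule) ⊗ₜ ⟨a.toSubmodule.subtype, fun _ => rfl⟩, rfl⟩
      rw [range_evRep_congr σ (Irr.mk_out (Irr.mk α)).symm] at h1
      exact Submodule.mem_iSup_of_mem (Irr.mk α) h1
    exact ha.1 (le_bot_iff.1 (hC.disjoint haU hle))

/-- Injectivity is orthogonality: the retraction at `T t` reads off the `t`-th component of a vector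
from its image. Surjectivity is the preceding spanning statement. -/
theorem bijective_toModule_evRep [DecidableEq (Irr.{v} A)] (T : Irr.{v} A → IrrRep.{v} A)
    (hT : ∀ t, Irr.mk (T t) = t) :
    Function.Bijective (DirectSum.toModule ℂ (Irr.{v} A) W fun t => evRep (T t) σ) := by
  have hlof : ∀ t s, DirectSum.toModule ℂ (Irr.{v} A) W (fun t => evRep (T t) σ)
      (DirectSum.of (fun t => (T t).V ⊗[ℂ] ((T t).ρ.IntertwiningMap σ)) t s) = evRep (T t) σ s :=
    fun t s => DirectSum.toModule_lof (M := fun t => (T t).V ⊗[ℂ] ((T t).ρ.IntertwiningMap σ))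
      (φ := fun t => evRep (T t) σ) ℂ t s
  constructor
  · rw [injective_iff_map_eq_zero]
    intro x hx
    have key : ∀ x t, evRetr (T t) σ (DirectSum.toModule ℂ (Irr.{v} A) W
        (fun t => evRep (T t) σ) x) = x t := by
      intro x t
      induction x using DirectSum.induction_on with
      | zero => simp only [map_zero, DirectSum.zero_apply]
      | add x y hx hy => simp only [map_add, DirectSum.add_apply, hx, hy]
      | of t' s =>
        rw [hlof]
        by_cases h : t' = t
        · subst h
          rw [evRetr_evRep, DirectSum.of_eq_same]
        · rw [DirectSum.of_eq_of_ne _ _ _ (Ne.symm h)]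
          refine evRetr_evRep_of_ne σ ?_ s
          rw [hT, hT]
          exact Ne.symm h
    refine DFinsupp.ext fun t => ?_
    rw [← key x t, hx, map_zero]
    rfl
  · rw [← LinearMap.range_eq_top, eq_top_iff, ← iSup_range_evRep σ]
    refine iSup_le fun t => ?_
    rw [range_evRep_congr σ ((Irr.mk_out t).trans (hT t).symm)]
    rintro _ ⟨s, rfl⟩
    exact ⟨_, hlof t s⟩

end Semisimple

theorem IrrRep.exists_ne_zero {A : Type w} [Group A] (τ : IrrRep.{v} A) : ∃ x : τ.V, x ≠ 0 := by
  by_contra! h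
  have h1 : (⊥ : Subrepresentation τ.ρ) = ⊤ := Subrepresentation.toSubmodule_injective
    (Submodule.ext fun x => ⟨fun _ => trivial, fun _ => h x⟩)
  exact bot_ne_top h1

/-- Every irreducible representation occurs in the finite-dimensional space of functions on `A`,
through its matrix coefficients. The isotypic parts there are nonzero and independent, so there are
finitely many. `A` is taken in `Type v` so that the functions on `A` live in the same universe as
the spaces `V_τ`. -/
theorem finite_irr (A : Type v) [Group A] [Finite A] : Finite (Irr.{v} A) := by
  let R : Representation ℂ A (A → ℂ) :=
    { toFun := fun a => LinearMap.funLeft ℂ ℂ fun b => a⁻¹ * b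
      map_one' := by ext; simp [LinearMap.funLeft_apply]
      map_mul' := fun a b => by ext; simp [LinearMap.funLeft_apply, mul_assoc] }
  refine WellFoundedGT.finite_of_iSupIndep (iSupIndep_range_evRep R) fun t ht => ?_
  obtain ⟨x, hx⟩ := (Quotient.out t).exists_ne_zero
  refine hx ((Module.forall_dual_apply_eq_zero_iff ℂ x).1 fun ξ => ?_)
  -- The matrix coefficient map `y ↦ (b ↦ ξ(b⁻¹ y))`. If the isotypic part is zero, then evaluating
  -- `f x` at `b = 1` gives `ξ x = 0`; as `ξ` is arbitrary, `x = 0`.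
  let f : (Quotient.out t).ρ.IntertwiningMap R :=
    ⟨LinearMap.pi fun b => ξ ∘ₗ (Quotient.out t).ρ b⁻¹, fun a => by
      ext y b
      change ξ ((Quotient.out t).ρ b⁻¹ ((Quotient.out t).ρ a y)) =
        ξ ((Quotient.out t).ρ (a⁻¹ * b)⁻¹ y)
      rw [mul_inv_rev, inv_inv, map_mul, Module.End.mul_apply]⟩
  have h : f x ∈ LinearMap.range (evRep (Quotient.out t) R) := ⟨x ⊗ₜ f, rfl⟩
  rw [ht] at h
  have h1 : ξ ((Quotient.out t).ρ 1⁻¹ x) = 0 := congrFun ((Submodule.mem_bot ℂ).1 h) 1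
  rwa [inv_one, map_one] at h1

instance {G : Type v} [Group G] [Finite G] (A : Subgroup G) [A.Normal] : Finite (IrrOrbit A) :=
  have := finite_irr A
  Quotient.finite _

theorem VB.finiteDimensional_fiber {X : Type u} [TopologicalSpace X] (E : VB.{u, v} X) (x : X) :
    FiniteDimensional ℂ (E.fiber x) := by
  obtain ⟨U, -, hx, n, φ, ψ, h1, -⟩ := E.locTriv x
  exact Module.Finite.of_surjective (ψ x) fun e => ⟨φ x e, h1 x hx e⟩

namespace GVect

/-! ### The decomposition of a bundle over the orbits of irreducible representations -/

section Decomposition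

variable {G : Type v} [Group G] [Finite G] {A : Subgroup G} [A.Normal]
  {X : Type u} [TopologicalSpace X] [MulAction G X] [ContinuousConstSMul G X]
  [ActsTrivially A.subtype X] (E : GVect.{u, v} G X) (τ : IrrRep.{v} A)

/-- The element `p` of the total space lies in the image of evaluation at `τ`. -/
def MemEv (p : Tot E.fiber) : Prop := p.vec ∈ LinearMap.range (E.ev A.subtype τ p.base)

variable {E τ}

theorem MemEv.congr {p : Tot E.fiber} (h : E.MemEv τ p) {τ' : IrrRep.{v} A}
    (hτ : Irr.mk τ = Irr.mk τ') : E.MemEv τ' p :=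
  range_evRep_le (E.fiberRep A.subtype p.base) hτ h

/-- For an `A`-map `f : V_τ → E_x`, the composite `g ∘ f` is an `A`-map into `E_{gx}` once `V_τ`
carries the conjugate action. So `g` permutes the isotypic parts in the way it permutes `Irr(A)`. -/
theorem MemEv.tact {p : Tot E.fiber} (h : E.MemEv τ p) (g : G) :
    E.MemEv (τ.conj g) (E.tact g p) := by
  obtain ⟨x, e⟩ := p
  obtain ⟨t, rfl⟩ : ∃ t, E.ev A.subtype τ x t = e := h
  change E.act g x (E.ev A.subtype τ x t) ∈ LinearMap.range (E.ev A.subtype (τ.conj g) (g • x))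
  induction t using TensorProduct.induction_on with
  | zero => rw [map_zero, map_zero]; exact zero_mem _
  | add s t hs ht => rw [map_add, map_add]; exact add_mem hs ht
  | tmul v f =>
    let f' : (τ.conj g).ρ.IntertwiningMap (E.fiberRep A.subtype (g • x)) :=
      ⟨E.act g x ∘ₗ f.toLinearMap, fun a => LinearMap.ext fun w : τ.V =>
        (congrArg (E.act g x) (f.isIntertwining _ _ (MulAut.conjNormal g⁻¹ a) w)).trans
          (E.act_fiberRep g x a (f w))⟩
    exact ⟨(v : (τ.conj g).V) ⊗ₜ f', rfl⟩

variable (E τ)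

/-- The map `V_τ ⊗ Hom_A(V_τ, E_{g⁻¹ x}) → E_x`, `v ⊗ f ↦ g (f v)`. -/
noncomputable def actEv (g : G) (x : X) : E.IsoFiber A.subtype τ (g⁻¹ • x) →ₗ[ℂ] E.fiber x :=
  (E.cast (smul_inv_smul g x)).toLinearMap ∘ₗ E.act g (g⁻¹ • x) ∘ₗ E.ev A.subtype τ (g⁻¹ • x)

theorem mk_actEv (g : G) (x : X) (t : E.IsoFiber A.subtype τ (g⁻¹ • x)) :
    (⟨x, E.actEv τ g x t⟩ : Tot E.fiber) = E.tact g ⟨g⁻¹ • x, E.ev A.subtype τ (g⁻¹ • x) t⟩ :=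
  E.mk_cast _ _

/-- The map `E_x → V_τ ⊗ Hom_A(V_τ, E_{g⁻¹ x})` given by `g⁻¹` and the isotypic projection. -/
noncomputable def retrAct (g : G) (x : X) : E.fiber x →ₗ[ℂ] E.IsoFiber A.subtype τ (g⁻¹ • x) :=
  evRetr τ (E.fiberRep A.subtype (g⁻¹ • x)) ∘ₗ E.act g⁻¹ x

theorem act_inv_actEv (g : G) (x : X) (t : E.IsoFiber A.subtype τ (g⁻¹ • x)) :
    E.act g⁻¹ x (E.actEv τ g x t) = E.ev A.subtype τ (g⁻¹ • x) t := by
  apply Tot.mk_inj (F := E.fiber)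
  rw [← tact_mk, mk_actEv, ← tact_mul, inv_mul_cancel, tact_one]

theorem retrAct_actEv (g : G) (x : X) (t : E.IsoFiber A.subtype τ (g⁻¹ • x)) :
    E.retrAct τ g x (E.actEv τ g x t) = t :=
  (congrArg _ (E.act_inv_actEv τ g x t)).trans (evRetr_evRep τ _ t)

theorem memEv_actEv (g : G) (x : X) (t : E.IsoFiber A.subtype τ (g⁻¹ • x)) :
    E.MemEv (τ.conj g) ⟨x, E.actEv τ g x t⟩ := by
  rw [mk_actEv]
  exact MemEv.tact (p := ⟨_, _⟩) ⟨t, rfl⟩ g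

/-- After translation by `g⁻¹` the vector has type `g⁻¹ g' τ'`, which differs from `τ`, and
orthogonality of the projectors applies. -/
theorem retrAct_actEv_of_ne {τ' : IrrRep.{v} A} (g g' : G) (x : X)
    (h : g • Irr.mk τ ≠ g' • Irr.mk τ') (t : E.IsoFiber A.subtype τ' (g'⁻¹ • x)) :
    E.retrAct τ g x (E.actEv τ' g' x t) = 0 := by
  obtain ⟨s, hs⟩ := (E.memEv_actEv τ' g' x t).tact g⁻¹
  refine (congrArg (evRetr τ (E.fiberRep A.subtype (g⁻¹ • x))) hs).symm.trans
    (evRetr_evRep_of_ne _ (fun h' => h ?_) s)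
  have h' : Irr.mk τ = g⁻¹ • g' • Irr.mk τ' := h'
  rw [h', smul_inv_smul]

/-- Translating a vector of type `gτ` at `x` back by `g⁻¹` gives a vector of type `τ` at `g⁻¹ x`,
whose preimage under evaluation is the required one. -/
theorem range_ev_le_range_actEv {σ : IrrRep.{v} A} (g : G) (h : Irr.mk σ = g • Irr.mk τ) (x : X) :
    LinearMap.range (E.ev A.subtype σ x) ≤ LinearMap.range (E.actEv τ g x) := by
  rintro e he
  have h1 : E.MemEv σ ⟨x, e⟩ := he
  have h2 : Irr.mk (σ.conj g⁻¹) = Irr.mk τ := by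
    change g⁻¹ • Irr.mk σ = _
    rw [h, inv_smul_smul]
  obtain ⟨t, ht⟩ := (h1.tact g⁻¹).congr h2
  refine ⟨t, Tot.mk_inj (F := E.fiber) ?_⟩
  refine (E.mk_actEv τ g x t).trans ((congrArg (fun e => E.tact g ⟨g⁻¹ • x, e⟩) ht).trans ?_)
  change E.tact g (E.tact g⁻¹ ⟨x, e⟩) = _
  rw [← tact_mul, mul_inv_cancel, tact_one]

/-- Orbit-stabilizer, in the form that `q ↦ q.out • [τ]` is a bijection from cosets of `G_[τ]` to
the orbit of `[τ]`: this is injectivity, and `exists_out_smul_mk` is surjectivity. Each type of the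
orbit thus occurs at exactly one coset. -/
theorem out_smul_mk_inj {q q' : G ⧸ τ.stab} (h : q.out • Irr.mk τ = q'.out • Irr.mk τ) :
    q = q' := by
  rw [← QuotientGroup.out_eq' q, ← QuotientGroup.out_eq' q', QuotientGroup.eq]
  refine MulAction.mem_stabilizer_iff.2 ?_
  rw [mul_smul, ← h, inv_smul_smul]

theorem exists_out_smul_mk {σ : IrrRep.{v} A} (h : orbitOf σ = orbitOf τ) :
    ∃ q : G ⧸ τ.stab, Irr.mk σ = q.out • Irr.mk τ := by
  obtain ⟨g, hg⟩ : ∃ g : G, g • Irr.mk τ = Irr.mk σ := Quotient.exact h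
  refine ⟨g, ?_⟩
  have h1 : (((g : G ⧸ τ.stab).out : G) : G ⧸ τ.stab) = g := QuotientGroup.out_eq' _
  have h2 := MulAction.mem_stabilizer_iff.1 (QuotientGroup.eq.1 h1)
  rw [mul_smul, inv_smul_eq_iff] at h2
  rw [← hg, h2]

theorem orbitOf_eq_of_smul_eq {σ : IrrRep.{v} A} {g g' : G}
    (h : g • Irr.mk σ = g' • Irr.mk τ) : orbitOf σ = orbitOf τ :=
  Quotient.sound (s := MulAction.orbitRel G (Irr.{v} A))
    ⟨g⁻¹ * g', by
      change (g⁻¹ * g') • Irr.mk τ = Irr.mk σ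
      rw [mul_smul, ← h, inv_smul_smul]⟩

/-- The part `Ind (V_τ ⊗ Hom_A(V_τ, E))` of `E` belonging to the orbit of `τ`. -/
noncomputable abbrev orbitPart : GVect.{u, v} G X := (E.isotypic τ).ind

/-- The fibre of the part of `E` belonging to the orbit of `τ`. -/
abbrev OrbitFiber (x : X) : Type v :=
  ∀ q : G ⧸ τ.stab, E.IsoFiber A.subtype τ (q.out⁻¹ • x)

theorem continuous_evTot :
    Continuous fun p : Tot (E.isotypic τ).fiber => (⟨p.base, E.ev A.subtype τ p.base p.vec⟩ :
      Tot E.fiber) :=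
  (E.isoVB_isInducing A.subtype τ).continuous

theorem continuous_isotypicTot_iff {Z : Type*} [TopologicalSpace Z]
    {f : Z → Tot (E.isotypic τ).fiber} : Continuous f ↔ Continuous fun z =>
      (⟨(f z).base, E.ev A.subtype τ (f z).base (f z).vec⟩ : Tot E.fiber) :=
  (E.isoVB_isInducing A.subtype τ).continuous_iff

/-- Fibrewise the projector is a fixed linear combination of the actions of elements of `A`, each
continuous on the total space. -/
theorem continuous_ev_evRetr :
    Continuous fun p : Tot E.fiber => (⟨p.base, E.ev A.subtype τ p.base
      (evRetr τ (E.fiberRep A.subtype p.base) p.vec)⟩ : Tot E.fiber) := by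
  have : (fun p : Tot E.fiber => (⟨p.base, E.ev A.subtype τ p.base
      (evRetr τ (E.fiberRep A.subtype p.base) p.vec)⟩ : Tot E.fiber)) =
      fun p => ⟨p.base, ∑ a ∈ isoSupp τ, isoCoeff τ a • E.fiberRep A.subtype p.base a p.vec⟩ :=
    funext fun p => congrArg _ (evRep_evRetr τ _ p.vec)
  rw [this]
  refine E.continuous_sum E.continuous_base _ fun a _ => E.continuous_smul ?_ _
  exact (E.continuous_tact (a : G)).congr fun p => (E.mk_fiberRep A.subtype _ a _).symm

variable [Fintype (G ⧸ τ.stab)]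

/-- The inclusion of the part of `E` belonging to the orbit of `τ`, on fibres. -/
noncomputable def orbitInclFun (x : X) : E.OrbitFiber τ x →ₗ[ℂ] E.fiber x :=
  ∑ q : G ⧸ τ.stab, E.actEv τ q.out x ∘ₗ LinearMap.proj q

theorem orbitInclFun_apply (x : X) (t : E.OrbitFiber τ x) :
    E.orbitInclFun τ x t = ∑ q : G ⧸ τ.stab, E.actEv τ q.out x (t q) := by
  simp [orbitInclFun]

/-- The inclusion of the part of `E` belonging to the orbit of `τ`. -/
noncomputable def orbitIncl : Hom (E.orbitPart τ) E where
  toFun := E.orbitInclFun τ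
  continuous_toFun := by
    have hb := (E.orbitPart τ).continuous_base
    have := E.continuous_sum hb Finset.univ
      (s := fun (q : G ⧸ τ.stab) (p : Tot (E.orbitPart τ).fiber) =>
        E.actEv τ q.out p.base (p.vec q))
      fun q _ => ?_
    · exact this.congr fun p => congrArg _ (E.orbitInclFun_apply τ p.base p.vec).symm
    · refine ((E.continuous_tact q.out).comp ((E.continuous_evTot τ).comp
        ((E.isotypic τ).continuous_indComp q))).congr fun p => ?_
      exact (E.mk_actEv τ q.out p.base (p.vec q)).symm
  map_act g x t := by
    refine (E.orbitInclFun_apply τ _ _).trans ?_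
    refine Eq.trans ?_ (congrArg (E.act g x) (E.orbitInclFun_apply τ x t)).symm
    rw [map_sum]
    -- The component at `q` of the image under `g` comes from the coset `g⁻¹ q`, so the sum is
    -- reindexed accordingly. The terms then match because `g_l s = g g_j`, where `s` is `cosetElt`.
    refine Fintype.sum_equiv (MulAction.toPerm g⁻¹) _ _ fun q => ?_
    apply Tot.mk_inj (F := E.fiber)
    refine (E.mk_actEv τ q.out (g • x) ((E.isotypic τ).indAct g x t q)).trans ?_
    have h1 := congrArg (fun p : Tot (E.isotypic τ).fiber =>
      (⟨p.base, E.ev A.subtype τ p.base p.vec⟩ : Tot E.fiber))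
      ((E.isotypic τ).indComp_act g q ⟨x, t⟩)
    refine (congrArg (E.tact q.out) h1).trans ?_
    refine (congrArg (fun e => E.tact q.out ⟨_, e⟩) (E.ev_star τ _ _ _)).trans ?_
    refine (E.tact_mul q.out (cosetElt τ.stab g q : G) ⟨_, _⟩).symm.trans ?_
    refine Eq.trans ?_ (congrArg (E.tact g) (E.mk_actEv τ (g⁻¹ • q).out x (t (g⁻¹ • q)))).symm
    refine Eq.trans ?_ (E.tact_mul g (g⁻¹ • q).out ⟨_, _⟩)
    refine congrArg (fun h => E.tact h _) ?_
    change q.out * (q.out⁻¹ * g * (g⁻¹ • q).out) = _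
    group

/-- The projection to the part of `E` belonging to the orbit of `τ`, on fibres. -/
noncomputable def orbitProjFun (x : X) : E.fiber x →ₗ[ℂ] E.OrbitFiber τ x :=
  LinearMap.pi fun q => E.retrAct τ q.out x

/-- Continuity into an induced bundle is tested on components, and continuity into the isotypic part
is tested after evaluation. What remains is the action of `q.out⁻¹` followed by the isotypic
projector. -/
theorem continuous_orbitProjFun :
    Continuous fun p : Tot E.fiber =>
      (⟨p.base, E.orbitProjFun τ p.base p.vec⟩ : Tot (E.orbitPart τ).fiber) := by
  refine ind_continuous_iff.2 ⟨E.continuous_base, fun q => ?_⟩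
  refine (E.continuous_isotypicTot_iff τ).2 ?_
  exact (E.continuous_ev_evRetr τ).comp (E.continuous_tact q.out⁻¹)

/-- Different cosets carry different types within the orbit, so the off-diagonal terms vanish and
the diagonal one is the retraction identity. -/
theorem orbitProjFun_orbitInclFun (x : X) (t : E.OrbitFiber τ x) :
    E.orbitProjFun τ x (E.orbitInclFun τ x t) = t := by
  funext q
  change E.retrAct τ q.out x _ = _
  rw [orbitInclFun_apply, map_sum, Finset.sum_eq_single q, retrAct_actEv]
  · exact fun q' _ hq => E.retrAct_actEv_of_ne τ _ _ x
      (fun h => hq (out_smul_mk_inj τ h).symm) _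
  · exact fun h => absurd (Finset.mem_univ q) h

theorem orbitProjFun_orbitInclFun_of_ne {τ' : IrrRep.{v} A} [Fintype (G ⧸ τ'.stab)]
    (h : orbitOf τ ≠ orbitOf τ') (x : X) (t : E.OrbitFiber τ' x) :
    E.orbitProjFun τ x (E.orbitInclFun τ' x t) = 0 := by
  funext q
  change E.retrAct τ q.out x _ = _
  rw [orbitInclFun_apply, map_sum]
  exact Finset.sum_eq_zero fun q' _ => E.retrAct_actEv_of_ne τ _ _ x
    (fun h' => h (orbitOf_eq_of_smul_eq _ h')) _

theorem range_ev_le_range_orbitInclFun {σ : IrrRep.{v} A} (h : orbitOf σ = orbitOf τ) (x : X) :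
    LinearMap.range (E.ev A.subtype σ x) ≤ LinearMap.range (E.orbitInclFun τ x) := by
  classical
  obtain ⟨q, hq⟩ := exists_out_smul_mk τ h
  refine (E.range_ev_le_range_actEv τ q.out hq x).trans ?_
  rintro _ ⟨t, rfl⟩
  refine ⟨Pi.single q t, ?_⟩
  rw [orbitInclFun_apply, Finset.sum_eq_single q, Pi.single_eq_same]
  · intro q' _ hq'
    rw [Pi.single_eq_of_ne hq', map_zero]
  · exact fun h => absurd (Finset.mem_univ q) h

/-- The summand at `q` consists of vectors of type `q.out • τ`, and these types exhaust the orbit.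
This identifies the induced bundle with the subbundle `E_O` independently of the choice of `τ` and
of coset representatives. -/
theorem range_orbitInclFun (x : X) :
    LinearMap.range (E.orbitInclFun τ x) =
      ⨆ σ : {σ : IrrRep.{v} A // orbitOf σ = orbitOf τ},
        LinearMap.range (E.ev A.subtype σ.1 x) := by
  refine le_antisymm ?_ (iSup_le fun σ => E.range_ev_le_range_orbitInclFun τ σ.2 x)
  rintro _ ⟨t, rfl⟩
  rw [orbitInclFun_apply]
  refine Submodule.sum_mem _ fun q _ => ?_
  refine Submodule.mem_iSup_of_mem ⟨τ.conj q.out, ?_⟩ (E.memEv_actEv τ q.out x (t q))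
  refine orbitOf_eq_of_smul_eq τ (g := 1) (g' := q.out) ?_
  rw [one_smul]
  rfl

end Decomposition

end GVect

-- Assembling the orbit parts of a bundle

namespace GVect

section Decomposition

variable {G : Type v} [Group G] [Finite G] {A : Subgroup G} [A.Normal]
  {X : Type u} [TopologicalSpace X] [MulAction G X] [ContinuousConstSMul G X]
  [ActsTrivially A.subtype X] (E : GVect.{u, v} G X)

theorem bijective_toModule_ev [DecidableEq (Irr.{v} A)] (x : X) :
    Function.Bijective (DirectSum.toModule ℂ (Irr.{v} A) (E.fiber x)
      fun t => E.ev A.subtype (Quotient.out t) x) :=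
  have := E.finiteDimensional_fiber x
  bijective_toModule_evRep (E.fiberRep A.subtype x) (fun t => Quotient.out t) Irr.mk_out

variable (τ : IrrOrbit A → IrrRep.{v} A) [∀ o, Fintype (G ⧸ (τ o).stab)]

/-- Every irreducible type lies in some orbit, so the orbit parts span the fibre by complete
reducibility. Identities between linear maps can therefore be checked on one orbit part at a time.
-/
theorem ext_orbitInclFun (hτ : ∀ o, orbitOf (τ o) = o) {M : Type*} [AddCommGroup M]
    [Module ℂ M] {x : X} {f g : E.fiber x →ₗ[ℂ] M}
    (h : ∀ o t, f (E.orbitInclFun (τ o) x t) = g (E.orbitInclFun (τ o) x t)) : f = g := by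
  have := E.finiteDimensional_fiber x
  have hle : (⊤ : Submodule ℂ (E.fiber x)) ≤ LinearMap.eqLocus f g := by
    rw [← iSup_range_evRep (E.fiberRep A.subtype x)]
    refine iSup_le fun t => ?_
    refine (E.range_ev_le_range_orbitInclFun (τ (orbitOf (Quotient.out t)))
      (hτ _).symm x).trans ?_
    rintro _ ⟨s, rfl⟩
    exact h _ s
  exact LinearMap.ext fun e => hle trivial

theorem orbitProjFun_orbitInclFun_of_ne' (hτ : ∀ o, orbitOf (τ o) = o) {o o' : IrrOrbit A}
    (h : o ≠ o') (x : X) (t : E.OrbitFiber (τ o) x) :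
    E.orbitProjFun (τ o') x (E.orbitInclFun (τ o) x t) = 0 :=
  E.orbitProjFun_orbitInclFun_of_ne (τ o') (by rw [hτ, hτ]; exact h.symm) x t

/-- The projection to the part of `E` belonging to the orbit `o`. -/
noncomputable def orbitProj (hτ : ∀ o, orbitOf (τ o) = o) (o : IrrOrbit A) :
    Hom E (E.orbitPart (τ o)) where
  toFun := E.orbitProjFun (τ o)
  continuous_toFun := E.continuous_orbitProjFun (τ o)
  -- Equivariance is not computed with coset representatives. It is checked on the images of the
  -- inclusions, which are equivariant and on which the projections are either the identity or zero.
  map_act g x := LinearMap.congr_fun (f := E.orbitProjFun (τ o) (g • x) ∘ₗ E.act g x)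
    (g := (E.orbitPart (τ o)).act g x ∘ₗ E.orbitProjFun (τ o) x)
    (E.ext_orbitInclFun τ hτ fun o' t => by
      refine (congrArg (E.orbitProjFun (τ o) (g • x))
        ((E.orbitIncl (τ o')).map_act g x t).symm).trans ?_
      by_cases h : o' = o
      · subst h
        refine (E.orbitProjFun_orbitInclFun (τ o') (g • x) _).trans ?_
        exact congrArg ((E.orbitPart (τ o')).act g x)
          (E.orbitProjFun_orbitInclFun (τ o') x t).symm
      · refine (E.orbitProjFun_orbitInclFun_of_ne' τ hτ h (g • x) _).trans ?_
        refine (map_zero ((E.orbitPart (τ o)).act g x)).symm.trans ?_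
        exact congrArg ((E.orbitPart (τ o)).act g x)
          (E.orbitProjFun_orbitInclFun_of_ne' τ hτ h x t).symm)

theorem sum_orbitInclFun_orbitProjFun (hτ : ∀ o, orbitOf (τ o) = o)
    [Fintype (IrrOrbit A)] (x : X) (e : E.fiber x) :
    ∑ o, E.orbitInclFun (τ o) x (E.orbitProjFun (τ o) x e) = e := by
  have h : ∑ o, E.orbitInclFun (τ o) x ∘ₗ E.orbitProjFun (τ o) x = LinearMap.id :=
    E.ext_orbitInclFun τ hτ fun o t => by
      rw [LinearMap.sum_apply, Finset.sum_eq_single o]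
      · exact congrArg (E.orbitInclFun (τ o) x) (E.orbitProjFun_orbitInclFun (τ o) x t)
      · intro o' _ ho'
        exact (congrArg (E.orbitInclFun (τ o') x)
          (E.orbitProjFun_orbitInclFun_of_ne' τ hτ ho'.symm x t)).trans (map_zero _)
      · exact fun h => absurd (Finset.mem_univ o) h
  simpa using LinearMap.congr_fun h e

end Decomposition

-- A bundle with finitely many complementary summands

section FiniteSum

variable {G : Type w} [Group G] {X : Type u} [TopologicalSpace X] [MulAction G X]
  [ContinuousConstSMul G X] {ι : Type*} [DecidableEq ι] {E : GVect.{u, v} G X}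
  {P : ι → GVect.{u, v} G X} (j : ∀ o, Hom (P o) E) (p : ∀ o, Hom E (P o))

/-- The sum of classes in `Vec` is an iterated binary sum, so the bundle representing it is built by
induction together with its inclusion into `E` and projection from `E`. The orbits form a type in a
larger universe than the index types of `VB.pi`, so that direct sum does not apply to them. Carrying
the formula for `J ∘ Q` through the induction is what makes the next summand orthogonal to the
previous ones. -/
theorem exists_partialSum (h1 : ∀ o x t, (p o).toFun x ((j o).toFun x t) = t)
    (h2 : ∀ o o' x t, o ≠ o' → (p o').toFun x ((j o).toFun x t) = 0)
    (s : Finset ι) :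
    ∃ (S : GVect.{u, v} G X) (J : Hom S E) (Q : Hom E S), Vec.mk S = ∑ o ∈ s, Vec.mk (P o) ∧
      (∀ x t, Q.toFun x (J.toFun x t) = t) ∧
      ∀ x e, J.toFun x (Q.toFun x e) = ∑ o ∈ s, (j o).toFun x ((p o).toFun x e) := by
  induction s using Finset.induction_on with
  | empty =>
    refine ⟨GVect.zero G X, ⟨fun _ => 0, ?_, ?_⟩, ⟨fun _ => 0, ?_, ?_⟩, ?_, ?_, ?_⟩
    · exact E.continuous_zero (GVect.zero.{u, v} G X).continuous_base
    · intro g x t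
      exact (map_zero (E.act g x)).symm
    · exact (GVect.zero.{u, v} G X).continuous_zero E.continuous_base
    · intro g x t
      rfl
    · rfl
    · intro x t
      rfl
    · intro x e
      rw [Finset.sum_empty]
      rfl
  | insert a s ha ih =>
    obtain ⟨S, J, Q, hS, hQJ, hJQ⟩ := ih
    have hpJ : ∀ x t, (p a).toFun x (J.toFun x t) = 0 := by
      intro x t
      -- Replacing `t` by `Q (J t)` turns `J t` into a sum of vectors from the earlier summands,
      -- each of which `p a` kills.
      rw [← hQJ x t, hJQ, map_sum]
      exact Finset.sum_eq_zero fun o ho => h2 _ _ _ _ fun h => ha (h ▸ ho)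
    have hQj : ∀ x t, Q.toFun x ((j a).toFun x t) = 0 := by
      intro x t
      rw [← hQJ x (Q.toFun x ((j a).toFun x t)), hJQ, Finset.sum_eq_zero, map_zero]
      intro o ho
      rw [h2 a o x t fun h => ha (h ▸ ho), map_zero]
    have hj := VB.prod_isInducing (P a).toVB S.toVB
    refine ⟨(P a).sum S, ⟨fun x => ((j a).toFun x).coprod (J.toFun x), ?_, ?_⟩,
      ⟨fun x => ((p a).toFun x).prod (Q.toFun x), ?_, ?_⟩, ?_, ?_, ?_⟩
    · exact E.continuous_add
        ((j a).continuous_toFun.comp (continuous_fst.comp hj.continuous))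
        (J.continuous_toFun.comp (continuous_snd.comp hj.continuous))
    · intro g x t
      refine (congrArg₂ (· + ·) ((j a).map_act g x t.1) (J.map_act g x t.2)).trans ?_
      exact (map_add (E.act g x) _ _).symm
    · exact hj.continuous_iff.2 ((p a).continuous_toFun.prodMk Q.continuous_toFun)
    · intro g x e
      exact Prod.ext ((p a).map_act g x e) (Q.map_act g x e)
    · rw [Finset.sum_insert ha, ← hS, Vec.mk_add]
    · rintro x ⟨t, t'⟩
      refine Prod.ext ?_ ?_
      · change (p a).toFun x ((j a).toFun x t + J.toFun x t') = t
        rw [map_add, h1, hpJ, add_zero]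
      · change Q.toFun x ((j a).toFun x t + J.toFun x t') = t'
        rw [map_add, hQj, hQJ, zero_add]
    · intro x e
      rw [Finset.sum_insert ha, ← hJQ]
      rfl

theorem mk_eq_sum_mk [Fintype ι] (h1 : ∀ o x t, (p o).toFun x ((j o).toFun x t) = t)
    (h2 : ∀ o o' x t, o ≠ o' → (p o').toFun x ((j o).toFun x t) = 0)
    (h3 : ∀ x e, ∑ o, (j o).toFun x ((p o).toFun x e) = e) : Vec.mk E = ∑ o, Vec.mk (P o) := by
  obtain ⟨S, J, Q, hS, hQJ, hJQ⟩ := exists_partialSum j p h1 h2 Finset.univ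
  rw [← hS]
  refine Vec.mk_eq ⟨fun x => LinearEquiv.ofLinearMap (Q.toFun x) (J.toFun x) ?_ ?_,
    Q.continuous_toFun, J.continuous_toFun, Q.map_act⟩
  · exact LinearMap.ext fun t => hQJ x t
  · exact LinearMap.ext fun e => (hJQ x e).trans (h3 x e)

end FiniteSum

/-- Induction after `Ψ` on isomorphism classes: `E` is the direct sum of its orbit parts, and each
orbit part is by construction the bundle induced from an isotypic part. -/
theorem sum_vecInd_vecPsi {G : Type v} [Group G] [Finite G] {A : Subgroup G} [A.Normal]
    {X : Type u} [TopologicalSpace X] [MulAction G X] [ContinuousConstSMul G X]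
    [ActsTrivially A.subtype X] [Fintype (IrrOrbit A)] (τ : IrrOrbit A → IrrRep.{v} A)
    (hτ : ∀ o, orbitOf (τ o) = o) (c : Vec.{u, v} G X) :
    ∑ o, vecInd (τ o).stab (vecPsi (τ o) c).1 = c := by
  classical
  have := fun o => Fintype.ofFinite (G ⧸ (τ o).stab)
  obtain ⟨E⟩ := c
  exact (mk_eq_sum_mk (fun o => E.orbitIncl (τ o)) (fun o => E.orbitProj τ hτ o)
    (fun o x t => E.orbitProjFun_orbitInclFun (τ o) x t)
    (fun o o' x t h => E.orbitProjFun_orbitInclFun_of_ne' τ hτ h x t)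
    (E.sum_orbitInclFun_orbitProjFun τ hτ)).symm

end GVect

/-! ### The isotypic parts of an induced bundle -/

/-- Twisting source and target by the same automorphism of `A` leaves the intertwining maps
unchanged as linear maps. A `τ`-isotypic representation therefore becomes `gτ`-isotypic. -/
theorem surjective_evRep_conj {G : Type w} [Group G] {A : Subgroup G} [A.Normal]
    (τ : IrrRep.{v} A) {W : Type v} [AddCommGroup W] [Module ℂ W] (σ : Representation ℂ A W)
    (h : Function.Surjective (evRep τ σ)) (g : G) :
    Function.Surjective (evRep (τ.conj g)
      (σ.comp (MulAut.conjNormal g⁻¹ : A ≃* A).toMonoidHom)) := by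
  intro e
  obtain ⟨t, rfl⟩ := h e
  induction t using TensorProduct.induction_on with
  | zero => exact ⟨0, rfl⟩
  | add s t hs ht =>
    obtain ⟨s', hs'⟩ := hs
    obtain ⟨t', ht'⟩ := ht
    exact ⟨s' + t', by rw [map_add, map_add, hs', ht']⟩
  | tmul v f =>
    let f' : (τ.conj g).ρ.IntertwiningMap
        (σ.comp (MulAut.conjNormal g⁻¹ : A ≃* A).toMonoidHom) :=
      ⟨f.toLinearMap, fun a => f.isIntertwining' (MulAut.conjNormal g⁻¹ a)⟩
    exact ⟨(v : (τ.conj g).V) ⊗ₜ f', rfl⟩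

namespace GVect

section Ind

variable {G : Type v} [Group G] [Finite G] {A : Subgroup G} [A.Normal] (τ : IrrRep.{v} A)
  {X : Type u} [TopologicalSpace X] [MulAction G X] [ContinuousConstSMul G X]
  [ActsTrivially A.subtype X] (F : GVect.{u, v} τ.stab X)

/-- Since `A` is normal and contained in `G_[τ]`, we have `a g G_[τ] = g (g⁻¹ a g) G_[τ] = g G_[τ]`.
Hence `A` preserves each summand of an induced bundle. -/
theorem coe_smul_coset (a : A) (q : G ⧸ τ.stab) : (a : G) • q = q := by
  obtain ⟨g, rfl⟩ := QuotientGroup.mk_surjective q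
  change (((a : G) * g : G) : G ⧸ τ.stab) = g
  refine (QuotientGroup.eq.2 (τ.le_stab ?_)).symm
  have := ‹A.Normal›.conj_mem a a.2 g⁻¹
  simpa [mul_assoc] using this

theorem cosetElt_coe (a : A) (q : G ⧸ τ.stab) :
    cosetElt τ.stab (a : G) q = τ.incl (MulAut.conjNormal q.out⁻¹ a) := by
  apply Subtype.ext
  have h : (a : G)⁻¹ • q = q := coe_smul_coset τ a⁻¹ q
  change q.out⁻¹ * (a : G) * ((a : G)⁻¹ • q).out = _
  rw [h]
  change _ = ((MulAut.conjNormal q.out⁻¹ a : A) : G)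
  simp

/-- Mackey's formula for the restriction to a normal subgroup: `A` acts on the summand at `q`
through conjugation by `q.out`. -/
theorem fiberRep_ind_apply (x : X) (a : A) (e : F.ind.fiber x) (q : G ⧸ τ.stab) :
    (F.ind.fiberRep A.subtype x a e : F.indVB.fiber x) q =
      F.fiberRep τ.incl (q.out⁻¹ • x) (MulAut.conjNormal q.out⁻¹ a)
        ((e : F.indVB.fiber x) q) := by
  apply Tot.mk_inj (F := F.fiber)
  refine (congrArg (F.indComp q) (F.ind.mk_fiberRep A.subtype x a e)).trans ?_
  refine (F.indComp_act (a : G) q ⟨x, e⟩).trans ?_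
  refine Eq.trans ?_ (F.mk_fiberRep τ.incl (q.out⁻¹ • x) _ _).symm
  exact F.tact_indComp_congr (coe_smul_coset τ a⁻¹ q) (cosetElt_coe τ a q) ⟨x, e⟩

variable {τ F}

/-- The summand at `q` is purely of type `q.out • τ`, so an intertwining map from another
irreducible has no component there. -/
theorem IsIsotypic.intertwiningMap_ind_apply (hF : F.IsIsotypic τ.incl τ)
    {σ : IrrRep.{v} A} {q : G ⧸ τ.stab}
    (h : Irr.mk σ ≠ q.out • Irr.mk τ) (x : X)
    (f : σ.ρ.IntertwiningMap (F.ind.fiberRep A.subtype x)) (v : σ.V) :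
    (f v : F.indVB.fiber x) q = 0 := by
  let ρ' := F.fiberRep τ.incl (q.out⁻¹ • x)
  let pr : F.ind.fiber x →ₗ[ℂ] F.fiber (q.out⁻¹ • x) :=
    (LinearMap.proj q : (∀ q : G ⧸ τ.stab, F.fiber (q.out⁻¹ • x)) →ₗ[ℂ] F.fiber (q.out⁻¹ • x))
  let f' : σ.ρ.IntertwiningMap
      (ρ'.comp (MulAut.conjNormal q.out⁻¹ : A ≃* A).toMonoidHom) :=
    ⟨pr ∘ₗ f.toLinearMap, fun a => LinearMap.ext fun w =>
      (congrArg pr (f.isIntertwining _ _ a w)).trans (fiberRep_ind_apply τ F x a (f w) q)⟩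
  exact intertwiningMap_eq_zero _ (τ' := τ.conj q.out) h
    (surjective_evRep_conj τ ρ' (hF _).2 q.out) f' v

theorem IsIsotypic.ev_ind_apply (hF : F.IsIsotypic τ.incl τ)
    {σ : IrrRep.{v} A} {q : G ⧸ τ.stab}
    (h : Irr.mk σ ≠ q.out • Irr.mk τ) (x : X) (t : F.ind.IsoFiber A.subtype σ x) :
    (F.ind.ev A.subtype σ x t : F.indVB.fiber x) q = 0 := by
  induction t using TensorProduct.induction_on with
  | zero => rw [map_zero]; rfl
  | add s t hs ht =>
    rw [map_add]
    exact (congrArg₂ (· + ·) hs ht).trans (add_zero _)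
  | tmul v f => exact hF.intertwiningMap_ind_apply h x f v

/-- The isotypic part of an induced bundle at a representation in another orbit is zero. -/
noncomputable def IsIsotypic.isotypicIndZero (hF : F.IsIsotypic τ.incl τ)
    {σ : IrrRep.{v} A} (h : orbitOf σ ≠ orbitOf τ) :
    Iso (F.ind.isotypic σ) (GVect.zero.{u, v} σ.stab X) :=
  -- All types occurring in the induced bundle lie in the orbit of `τ`. Every component of the
  -- evaluation at `σ` is therefore zero, and evaluation is injective.
  have key : ∀ (x : X) (t : F.ind.IsoFiber A.subtype σ x), 0 = t := fun x t =>
    F.ind.ev_injective A.subtype σ x (by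
      rw [map_zero]
      refine funext fun q => (hF.ev_ind_apply (fun h' => h ?_) x t).symm
      exact orbitOf_eq_of_smul_eq τ (g := 1) (g' := q.out) (by rw [one_smul]; exact h'))
  { toEquiv := fun x => LinearEquiv.ofLinearMap (0 : _ →ₗ[ℂ] PUnit.{v + 1}) 0
      (LinearMap.ext fun _ => rfl) (LinearMap.ext fun t => key x t)
    continuous_toFun := continuous_induced_rng.2 (F.ind.isotypic σ).continuous_base
    continuous_invFun := (F.ind.isotypic σ).continuous_zero
      (GVect.zero.{u, v} σ.stab X).continuous_base
    map_act := fun _ _ _ => rfl }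

end Ind

-- The summand of the trivial coset

section IndSelf

variable {G : Type v} [Group G] [Finite G] {S : Subgroup G}
  {X : Type u} [TopologicalSpace X] [MulAction G X] [ContinuousConstSMul G X]
  (F : GVect.{u, v} S X)

/-- The chosen representative of the trivial coset. -/
noncomputable def outOne (S : Subgroup G) : S :=
  ⟨((1 : G) : G ⧸ S).out, by
    have h : ((((1 : G) : G ⧸ S).out : G) : G ⧸ S) = ((1 : G) : G ⧸ S) := QuotientGroup.out_eq' _
    have := QuotientGroup.eq.1 h.symm
    simpa using this⟩

/-- The projection of the induced bundle to the summand of the trivial coset. -/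
noncomputable def indFst (x : X) : F.ind.fiber x →ₗ[ℂ] F.fiber x :=
  -- The chosen representative of the trivial coset need not be `1`. The summand at `x` is thus the
  -- fibre of `F` at `(outOne S)⁻¹ x`, and `outOne S` carries it back to `x`.
  (F.cast (smul_inv_smul (outOne S) x)).toLinearMap ∘ₗ F.act (outOne S) ((outOne S)⁻¹ • x) ∘ₗ
    (LinearMap.proj ((1 : G) : G ⧸ S) :
      (∀ q : G ⧸ S, F.fiber (q.out⁻¹ • x)) →ₗ[ℂ] F.fiber (((1 : G) : G ⧸ S).out⁻¹ • x))

theorem mk_indFst (p : Tot F.ind.fiber) :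
    (⟨p.base, F.indFst p.base p.vec⟩ : Tot F.fiber) =
      F.tact (outOne S) (F.indComp ((1 : G) : G ⧸ S) p) := F.mk_cast _ _

theorem continuous_indFst :
    Continuous fun p : Tot F.ind.fiber => (⟨p.base, F.indFst p.base p.vec⟩ : Tot F.fiber) :=
  ((F.continuous_tact _).comp (F.continuous_indComp _)).congr fun p => (F.mk_indFst p).symm

open Classical in
/-- The inclusion of a bundle into the induced bundle, as the summand of the trivial coset. -/
noncomputable def indIncl (x : X) : F.fiber x →ₗ[ℂ] F.ind.fiber x :=
  (LinearMap.single ℂ (fun q : G ⧸ S => F.fiber (q.out⁻¹ • x)) ((1 : G) : G ⧸ S)) ∘ₗ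
    F.act (outOne S)⁻¹ x

open Classical in
theorem indIncl_apply_one (x : X) (e : F.fiber x) :
    (F.indIncl x e : F.indVB.fiber x) ((1 : G) : G ⧸ S) = F.act (outOne S)⁻¹ x e :=
  Pi.single_eq_same (M := fun q : G ⧸ S => F.fiber (q.out⁻¹ • x)) _ _

open Classical in
theorem indIncl_apply_of_ne (x : X) (e : F.fiber x) {q : G ⧸ S} (hq : q ≠ ((1 : G) : G ⧸ S)) :
    (F.indIncl x e : F.indVB.fiber x) q = 0 :=
  Pi.single_eq_of_ne (M := fun q : G ⧸ S => F.fiber (q.out⁻¹ • x)) hq _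

theorem continuous_indIncl :
    Continuous fun p : Tot F.fiber => (⟨p.base, F.indIncl p.base p.vec⟩ : Tot F.ind.fiber) := by
  refine ind_continuous_iff.2 ⟨F.continuous_base, fun q => ?_⟩
  by_cases hq : q = ((1 : G) : G ⧸ S)
  · subst hq
    exact (F.continuous_tact (outOne S)⁻¹).congr fun p =>
      congrArg (Tot.mk _) (F.indIncl_apply_one p.base p.vec).symm
  · refine (F.continuous_zero ((continuous_const_smul q.out⁻¹).comp F.continuous_base)).congr
      fun p => congrArg (Tot.mk _) (F.indIncl_apply_of_ne p.base p.vec hq).symm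

theorem indFst_indIncl (x : X) (e : F.fiber x) : F.indFst x (F.indIncl x e) = e := by
  apply Tot.mk_inj (F := F.fiber)
  refine (F.mk_indFst ⟨x, F.indIncl x e⟩).trans ?_
  refine (congrArg (fun e => F.tact (outOne S) ⟨(outOne S)⁻¹ • x, e⟩)
    (F.indIncl_apply_one x e)).trans ?_
  refine (F.tact_mul (outOne S) (outOne S)⁻¹ ⟨x, e⟩).symm.trans ?_
  rw [mul_inv_cancel, tact_one]

/-- The two maps are inverse only on vectors supported at the trivial coset; the hypothesis `he` is
supplied later by isotypicality. -/
theorem indIncl_indFst (x : X) (e : F.ind.fiber x)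
    (he : ∀ q : G ⧸ S, q ≠ ((1 : G) : G ⧸ S) → (e : F.indVB.fiber x) q = 0) :
    F.indIncl x (F.indFst x e) = e := by
  funext q
  by_cases hq : q = ((1 : G) : G ⧸ S)
  · subst hq
    refine (F.indIncl_apply_one x _).trans ?_
    apply Tot.mk_inj (F := F.fiber)
    refine (congrArg (F.tact (outOne S)⁻¹) (F.mk_indFst ⟨x, e⟩)).trans ?_
    rw [← tact_mul, inv_mul_cancel, tact_one]
    rfl
  · exact (F.indIncl_apply_of_ne x _ hq).trans (he q hq).symm

/-- Elements of `S` fix the trivial coset, and the conjugation by its representative hidden in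
`cosetElt` is undone by the factor `outOne S`. -/
theorem indFst_act (s : S) (x : X) (e : F.ind.fiber x) :
    F.indFst ((s : G) • x) (F.ind.act (s : G) x e) = F.act s x (F.indFst x e) := by
  apply Tot.mk_inj (F := F.fiber)
  refine (F.mk_indFst (F.ind.tact (s : G) ⟨x, e⟩)).trans ?_
  refine Eq.trans ?_ (congrArg (F.tact s) (F.mk_indFst ⟨x, e⟩)).symm
  refine (congrArg (F.tact (outOne S)) (F.indComp_act (s : G) _ ⟨x, e⟩)).trans ?_
  rw [← tact_mul, ← tact_mul]
  have hq : (s : G)⁻¹ • ((1 : G) : G ⧸ S) = ((1 : G) : G ⧸ S) := by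
    change (((s : G)⁻¹ * 1 : G) : G ⧸ S) = _
    rw [QuotientGroup.eq]
    simp
  refine F.tact_indComp_congr hq (Subtype.ext ?_) ⟨x, e⟩
  change ((1 : G) : G ⧸ S).out * (((1 : G) : G ⧸ S).out⁻¹ * s *
    ((s : G)⁻¹ • ((1 : G) : G ⧸ S)).out) = s * ((1 : G) : G ⧸ S).out
  rw [hq]
  group

end IndSelf

-- Recovering `F` from the induced bundle

section Ind

variable {G : Type v} [Group G] [Finite G] {A : Subgroup G} [A.Normal] {τ : IrrRep.{v} A}
  {X : Type u} [TopologicalSpace X] [MulAction G X] [ContinuousConstSMul G X]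
  [ActsTrivially A.subtype X] {F : GVect.{u, v} τ.stab X}

theorem indFst_fiberRep (x : X) (a : A) (e : F.ind.fiber x) :
    F.indFst x (F.ind.fiberRep A.subtype x a e) = F.fiberRep τ.incl x a (F.indFst x e) := by
  apply Tot.mk_inj (F := F.fiber)
  refine (congrArg (fun p : Tot F.ind.fiber => (⟨p.base, F.indFst p.base p.vec⟩ : Tot F.fiber))
    (F.ind.mk_fiberRep A.subtype x a e)).trans ?_
  refine Eq.trans ?_ (F.mk_fiberRep τ.incl x a _).symm
  exact congrArg (Tot.mk _) (F.indFst_act (τ.incl a) x e)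

/-- Deduced from the equivariance of `indFst`: the action of `A` is componentwise, so it keeps the
support at the trivial coset, and there `indFst` can be inverted. -/
theorem indIncl_fiberRep (x : X) (a : A) (e : F.fiber x) :
    F.indIncl x (F.fiberRep τ.incl x a e) = F.ind.fiberRep A.subtype x a (F.indIncl x e) := by
  rw [← F.indIncl_indFst x (F.ind.fiberRep A.subtype x a (F.indIncl x e)), indFst_fiberRep,
    indFst_indIncl]
  intro q hq
  rw [fiberRep_ind_apply, indIncl_apply_of_ne _ _ _ hq]
  exact map_zero (F.fiberRep τ.incl (q.out⁻¹ • x) (MulAut.conjNormal q.out⁻¹ a))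

/-- The `τ`-part of `Ind F` is concentrated at the trivial coset, because `q.out` fixes `[τ]` only
when `q` is trivial. -/
theorem IsIsotypic.indIncl_indFst_ev (hF : F.IsIsotypic τ.incl τ)
    (x : X) (t : F.ind.IsoFiber A.subtype τ x) :
    F.indIncl x (F.indFst x (F.ind.ev A.subtype τ x t)) = F.ind.ev A.subtype τ x t := by
  refine F.indIncl_indFst x _ fun q hq => hF.ev_ind_apply (fun h => hq ?_) x t
  have h1 : q.out ∈ τ.stab := MulAction.mem_stabilizer_iff.2 h.symm
  rw [← QuotientGroup.out_eq' q, QuotientGroup.eq, mul_one]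
  exact inv_mem h1

/-- Conversely the whole summand of the trivial coset is of type `τ`: the inclusion is an `A`-map
out of a `τ`-isotypic representation, so its image is fixed by the projector. -/
theorem IsIsotypic.ev_evRetr_indIncl (hF : F.IsIsotypic τ.incl τ)
    (x : X) (e : F.fiber x) :
    F.ind.ev A.subtype τ x (evRetr τ (F.ind.fiberRep A.subtype x) (F.indIncl x e)) =
      F.indIncl x e := by
  obtain ⟨t, rfl⟩ := (hF x).2 e
  have h := ev_isoMap τ.incl τ A.subtype (E := F) (F := F.ind) (F.indIncl x)
    (indIncl_fiberRep x) t
  rw [← h]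
  exact congrArg _ (evRetr_evRep τ _ _)

/-- A `(G_[τ], τ)`-equivariant bundle is the `τ`-isotypic part of the bundle it induces. -/
noncomputable def IsIsotypic.isotypicInd (hF : F.IsIsotypic τ.incl τ) :
    Iso (F.ind.isotypic τ) F where
  toEquiv x := LinearEquiv.ofLinearMap (F.indFst x ∘ₗ F.ind.ev A.subtype τ x)
    (evRetr τ (F.ind.fiberRep A.subtype x) ∘ₗ F.indIncl x)
    (LinearMap.ext fun e => (congrArg (F.indFst x) (hF.ev_evRetr_indIncl x e)).trans
      (F.indFst_indIncl x e))
    (LinearMap.ext fun t => (congrArg (evRetr τ (F.ind.fiberRep A.subtype x))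
      (hF.indIncl_indFst_ev x t)).trans (evRetr_evRep τ _ t))
  continuous_toFun := F.continuous_indFst.comp (F.ind.continuous_evTot τ)
  -- The isotypic part carries the topology induced by evaluation, and after evaluation the inverse
  -- becomes `indIncl`.
  continuous_invFun := (F.ind.continuous_isotypicTot_iff τ).2
    (F.continuous_indIncl.congr fun _ => congrArg (Tot.mk _) (hF.ev_evRetr_indIncl _ _).symm)
  map_act h x t := (congrArg (F.indFst ((h : G) • x)) (F.ind.ev_star τ h x t)).trans
    (F.indFst_act h x _)

end Ind

end GVect

/-! ### The decomposition of equivariant K-theory -/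

section KDecomposition

variable {G : Type v} [Group G] [Finite G] {A : Subgroup G} [A.Normal]
  {X : Type u} [TopologicalSpace X] [MulAction G X] [ContinuousConstSMul G X]
  [ActsTrivially A.subtype X] {Y : Type u'} [TopologicalSpace Y] [MulAction G Y]
  [ContinuousConstSMul G Y] [ActsTrivially A.subtype Y]

/-- Homomorphisms out of a Grothendieck group are determined by the classes of bundles, so the
decomposition of a single bundle suffices. The same reduction gives the two lemmas that follow. -/
theorem sum_kInd_psi [Fintype (IrrOrbit A)] (τ : IrrOrbit A → IrrRep.{v} A)
    (hτ : ∀ o, orbitOf (τ o) = o) (ξ : KG.{u, v} G X) :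
    ∑ o, kInd (τ o) (psi (τ o) ξ) = ξ := by
  have h : ∑ o, (kInd (τ o)).comp (psi (τ o)) = AddMonoidHom.id (KG.{u, v} G X) :=
    groth_ext fun c => by
      simp only [AddMonoidHom.finsetSum_apply, AddMonoidHom.comp_apply, psi, kInd, grothMap_of,
        AddMonoidHom.id_apply, ← map_sum]
      exact congrArg _ (GVect.sum_vecInd_vecPsi τ hτ c)
  simpa using DFunLike.congr_fun h ξ

theorem psi_kInd (τ : IrrRep.{v} A) (η : KTau.{u, v} τ X) : psi τ (kInd τ η) = η := by
  refine DFunLike.congr_fun (f := (psi τ).comp (kInd τ)) (g := AddMonoidHom.id _)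
    (groth_ext fun c => ?_) η
  simp only [AddMonoidHom.comp_apply, psi, kInd, grothMap_of, AddMonoidHom.id_apply]
  obtain ⟨_, F, hF, rfl⟩ := c
  exact congrArg _ (Subtype.ext (Vec.mk_eq hF.isotypicInd))

theorem psi_kInd_of_ne {σ τ : IrrRep.{v} A} (h : orbitOf σ ≠ orbitOf τ) (η : KTau.{u, v} τ X) :
    psi σ (kInd τ η) = 0 := by
  refine DFunLike.congr_fun (f := (psi σ).comp (kInd τ)) (g := 0) (groth_ext fun c => ?_) η
  simp only [AddMonoidHom.comp_apply, psi, kInd, grothMap_of, AddMonoidHom.zero_apply]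
  obtain ⟨_, F, hF, rfl⟩ := c
  refine Eq.trans ?_ (map_zero (Algebra.GrothendieckAddGroup.of (M := VecTau.{u, v} σ X)))
  exact congrArg _ (Subtype.ext (Vec.mk_eq (hF.isotypicIndZero h)))

/-- In positive degree the maps are restrictions, to the kernels of restriction to the base point,
of the degree-zero maps over the suspension. An identity in degree zero over `Susp (n + 1) X`
therefore restricts. -/
theorem sum_kIndn_psin [Fintype (IrrOrbit A)] (τ : IrrOrbit A → IrrRep.{v} A)
    (hτ : ∀ o, orbitOf (τ o) = o) : ∀ (n : ℕ) (ξ : KGn.{u, v} G X n),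
    ∑ o, kIndn (τ o) n (psin (τ o) n ξ) = ξ
  | 0, ξ => sum_kInd_psi τ hτ ξ
  | n + 1, ξ => by
    refine Subtype.ext ?_
    refine (map_sum (KG.red.{u, v} G X (n + 1)).subtype _ _).trans ?_
    exact sum_kInd_psi (X := Susp (n + 1) X) τ hτ ξ.1

theorem psin_kIndn (τ : IrrRep.{v} A) : ∀ (n : ℕ) (η : KTaun.{u, v} τ X n),
    psin τ n (kIndn τ n η) = η
  | 0, η => psi_kInd τ η
  | n + 1, η => Subtype.ext (psi_kInd (X := Susp (n + 1) X) τ η.1)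

theorem psin_kIndn_of_ne {σ τ : IrrRep.{v} A} (h : orbitOf σ ≠ orbitOf τ) :
    ∀ (n : ℕ) (η : KTaun.{u, v} τ X n), psin σ n (kIndn τ n η) = 0
  | 0, η => psi_kInd_of_ne h η
  | n + 1, η => Subtype.ext (psi_kInd_of_ne (X := Susp (n + 1) X) h η.1)

theorem psin_pullback (τ : IrrRep.{v} A) (f : GMap G Y X) : ∀ (n : ℕ) (ξ : KGn.{u, v} G X n),
    psin τ n (KGn.pullback f n ξ) = KTaun.pullback τ f n (psin τ n ξ)
  | 0, ξ => psi_pullback τ f ξ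
  | n + 1, ξ => Subtype.ext (psi_pullback τ (f.susp (n + 1)) ξ.1)

variable [DecidableEq (IrrOrbit A)]

/-- The decomposition of `K_G^n(X)` over the orbits of `G` on `Irr(A)`. -/
noncomputable def kDecomposition (τ : IrrOrbit A → IrrRep.{v} A) (hτ : ∀ o, orbitOf (τ o) = o)
    (X : Type u) [TopologicalSpace X] [MulAction G X] [ContinuousConstSMul G X]
    [ActsTrivially A.subtype X] (n : ℕ) :
    KGn.{u, v} G X n ≃+ DirectSum (IrrOrbit A) fun o => KTaun.{u, v} (τ o) X n :=
  letI := Fintype.ofFinite (IrrOrbit A)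
  -- There are finitely many orbits, so the components `psin` assemble into a map to the direct sum.
  -- That map applied to a class induced from the orbit `o` has only the component at `o`, where it
  -- is the original class.
  have key : ∀ o, (∑ o', (DirectSum.of (fun o => KTaun.{u, v} (τ o) X n) o').comp
      (psin (τ o') n)).comp (kIndn (τ o) n) = DirectSum.of (fun o => KTaun.{u, v} (τ o) X n) o :=
    fun o => AddMonoidHom.ext fun η => by
      rw [AddMonoidHom.comp_apply, AddMonoidHom.finsetSum_apply, Finset.sum_eq_single o]
      · rw [AddMonoidHom.comp_apply, psin_kIndn]
      · intro o' _ ho'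
        rw [AddMonoidHom.comp_apply, psin_kIndn_of_ne (by rwa [hτ, hτ]), map_zero]
      · exact fun h => absurd (Finset.mem_univ o) h
  AddMonoidHom.toAddEquiv
    (∑ o, (DirectSum.of (fun o => KTaun.{u, v} (τ o) X n) o).comp (psin (τ o) n))
    (DirectSum.toAddMonoid fun o => kIndn (τ o) n)
    (AddMonoidHom.ext fun ξ => by
      simp only [AddMonoidHom.comp_apply, AddMonoidHom.finsetSum_apply, map_sum,
        DirectSum.toAddMonoid_of, AddMonoidHom.id_apply]
      exact sum_kIndn_psin τ hτ n ξ)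
    (DirectSum.addHom_ext fun o η => by
      rw [AddMonoidHom.comp_apply, DirectSum.toAddMonoid_of]
      exact DFunLike.congr_fun (key o) η)

theorem kDecomposition_apply (τ : IrrOrbit A → IrrRep.{v} A) (hτ : ∀ o, orbitOf (τ o) = o)
    (n : ℕ) (ξ : KGn.{u, v} G X n) (o : IrrOrbit A) :
    kDecomposition τ hτ X n ξ o = psin (τ o) n ξ := by
  -- This is the instance used in the definition of `kDecomposition`, so the sum in the next line
  -- agrees with it definitionally.
  let := Fintype.ofFinite (IrrOrbit A)
  change (∑ o, (DirectSum.of (fun o => KTaun.{u, v} (τ o) X n) o).comp (psin (τ o) n)) ξ o = _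
  rw [AddMonoidHom.finsetSum_apply, DFinsupp.finsetSum_apply, Finset.sum_eq_single o]
  · exact DirectSum.of_eq_same _ _
  · intro o' _ ho'
    exact DirectSum.of_eq_of_ne _ _ _ ho'.symm
  · exact fun h => absurd (Finset.mem_univ o) h

theorem kDecomposition_symm_of (τ : IrrOrbit A → IrrRep.{v} A) (hτ : ∀ o, orbitOf (τ o) = o)
    (n : ℕ) (o : IrrOrbit A) (η : KTaun.{u, v} (τ o) X n) :
    (kDecomposition τ hτ X n).symm (DirectSum.of (fun o => KTaun.{u, v} (τ o) X n) o η) =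
      kIndn (τ o) n η :=
  DirectSum.toAddMonoid_of (fun o => kIndn (X := X) (τ o) n) o η

end KDecomposition

end EqK

-- The main theorem

theorem mainTheorem2 {G : Type v} [Group G] [Finite G] (A : Subgroup G) [A.Normal]
    [DecidableEq (EqK.Irr.{v} A)] [DecidableEq (EqK.IrrOrbit A)]
    -- a choice of one representation `τ o` in each orbit `o` of `G` on `Irr(A)`
    (τ : EqK.IrrOrbit A → EqK.IrrRep.{v} A) (hτ : ∀ o, EqK.orbitOf (τ o) = o) :
    (∃ Ψ : ∀ (X : EqK.TrivSpace.{u, v} A) (n : ℕ),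
        EqK.KGn.{u, v} G X n ≃+ DirectSum (EqK.IrrOrbit A) fun o => EqK.KTaun.{u, v} (τ o) X n,
      -- the component of `Ψ` at `o` is induced by `E ↦ V_τ ⊗ Hom_A(V_τ, E)`
      (∀ X n ξ o, Ψ X n ξ o = EqK.psin (τ o) n ξ) ∧
      -- in degree zero, on the class of a bundle `E`
      (∀ (X : EqK.TrivSpace.{u, v} A) (E : EqK.GVect.{u, v} G X) o, Ψ X 0 (EqK.KG.of E) o =
        EqK.KTau.of (τ o) (E.isotypic (τ o)) (E.isotypic_isIsotypic (τ o))) ∧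
      -- functoriality on `G`-maps
      (∀ (X Y : EqK.TrivSpace.{u, v} A) (f : EqK.GMap G X Y) n ξ o,
        Ψ X n (EqK.KGn.pullback f n ξ) o = EqK.KTaun.pullback (τ o) f n (Ψ Y n ξ o)) ∧
      -- induction gives the inverse
      (∀ X n o η, (Ψ X n).symm (DirectSum.of (fun o => EqK.KTaun.{u, v} (τ o) X n) o η) =
        EqK.kIndn (τ o) n η)) ∧
    -- the isotypic decomposition of a `G`-vector bundle, grouped over the orbits
    ∀ (X : EqK.TrivSpace.{u, v} A) (E : EqK.GVect.{u, v} G X),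
      (∀ x, Function.Bijective (DirectSum.toModule ℂ (EqK.Irr.{v} A) (E.fiber x)
        fun t => E.ev A.subtype (Quotient.out t) x)) ∧
      ∃ (P : EqK.IrrOrbit A → EqK.GVect.{u, v} G X) (j : ∀ o, EqK.GVect.Hom (P o) E)
        (p : ∀ o, EqK.GVect.Hom E (P o)),
        (∀ o x, LinearMap.range ((j o).toFun x) =
          ⨆ σ : {σ : EqK.IrrRep.{v} A // EqK.orbitOf σ = o},
            LinearMap.range (E.ev A.subtype σ.1 x)) ∧
        (∀ o x v, (p o).toFun x ((j o).toFun x v) = v) ∧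
        (∀ o o' x v, o ≠ o' → (p o').toFun x ((j o).toFun x v) = 0) ∧
        (∀ x v, ∑ᶠ o, (j o).toFun x ((p o).toFun x v) = v) := by
  refine ⟨⟨fun X n => EqK.kDecomposition τ hτ X n, ?_, ?_, ?_, ?_⟩, fun X E => ⟨?_, ?_⟩⟩
  · exact fun X n ξ o => EqK.kDecomposition_apply τ hτ n ξ o
  · exact fun X E o => (EqK.kDecomposition_apply τ hτ 0 _ o).trans (EqK.psi_of (τ o) E)
  · intro X Y f n ξ o
    rw [EqK.kDecomposition_apply, EqK.kDecomposition_apply, EqK.psin_pullback]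
  · exact fun X n o η => EqK.kDecomposition_symm_of τ hτ n o η
  · exact E.bijective_toModule_ev
  -- The subbundle `E_O` is realized as the induced bundle `orbitPart`, with its inclusion and
  -- projection. The complementary projections express `E = ⊕_O E_O` equivariantly and continuously.
  · let := fun o => Fintype.ofFinite (G ⧸ (τ o).stab)
    let := Fintype.ofFinite (EqK.IrrOrbit A)
    refine ⟨fun o => E.orbitPart (τ o), fun o => E.orbitIncl (τ o),
      fun o => E.orbitProj τ hτ o, fun o x => ?_,
      fun o x t => E.orbitProjFun_orbitInclFun (τ o) x t,
      fun o o' x t h => E.orbitProjFun_orbitInclFun_of_ne' τ hτ h x t, fun x e => ?_⟩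
    · refine (E.range_orbitInclFun (τ o) x).trans ?_
      rw [hτ o]
    · rw [finsum_eq_sum_of_fintype]
      exact E.sum_orbitInclFun_orbitProjFun τ hτ x e
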